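/- **Setting.** Let $d\ge 2$ (polygons for $d=2$, polyhedra for $d=3$), let $\Omega\subset\mathbb{R}^d$ be a bounded polytopal domain, $k\ge 1$ an integer and $\rho>0$, $\lambda>0$, $\Lambda$ constants. Let $a=a(x,\eta,p)$ be a symmetric $d\times d$ matrix-valued function on $\Omega\times\mathbb{R}\times\mathbb{R}^d$, measurable in $x$ and continuous in $(\eta,p)$, with $\xi^t a(x,\eta,p)\xi\ge\lambda\,\xi^t\xi$ for all $\xi\in\mathbb{R}^d$ and $|a(x,\eta,p)|\le\Lambda$ (operator norm) for all $x\in\Omega$, $\eta\in\mathbb{R}$, $p\in\mathbb{R}^d$. Let $\mathcal{T}_h$ be a partition of $\Omega$ into closed simply connected polytopal elements, with set $\mathcal{E}_h$ of edges/flat faces, $\partial\Omega$ being a union of such faces (an edge containing a hanging node is split there, so that $\partial T$ is a union of members of $\mathcal E_h$ for each $T\in\mathcal T_h$). Write $h_T,h_e$ for diameters, $|T|,|e|$ for volume and area. The partition is *shape regular* with constants $\varrho_v,\varrho_e,\kappa,\sigma^*,\gamma_*,\varrho_S>0$, $\theta_0<\pi/2$, $N,N_F\in\mathbb{N}$ if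 for every $T\in\mathcal{T}_h$ and every face $e$ of $T$: * (A1) $\varrho_v h_T^d\le|T|$ and $\varrho_e h_e^{d-1}\le|e|$; * (A2) $\kappa h_T\le h_e$; * (A3) there is a pyramid contained in $T$ with base $e$, apex $A_e\in T$ and height at least $\sigma^* h_T$, such that the angle between $x_e-A_e$ and the outward normal of $e$ is at most $\theta_0$ for all $x_e\in e$; * (A4) there are simplices $S(T)\supseteq T$, each containing a ball of radius $\varrho_S$ times its diameter, with diameter $h_{S(T)}\le\gamma_* h_T$, such that each $S(T)$ meets at most $N$ of the simplices $S(T')$, $T'\in\mathcal{T}_h$ (itself included); and each element has at most $N_F$ faces. Let $V_h$ be the space of $v=\{v_0,v_b\}$ with $v_0|_T\in P_k(T)$ for $T\in\mathcal{T}_h$ and $v_b|_e\in P_k(e)$ for $e\in\mathcal{E}_h$ ($v_b$ single-valued on each $e$), and $V_h^0=\{v\in V_h: v_b=0\text{ on }\partial\Omega\}$. The discrete weak gradient $\nabla_w v|_T\in[P_{k-1}(T)]^d$ is defined by $$(\nabla_w v,q)_T=-(v_0,\nabla\cdot q)_T+\langle v_b,q\cdot\mathbf{n}\rangle_{\partial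 T}\qquad\forall q\in[P_{k-1}(T)]^d .$$ Put $$\mathfrak{a}_s(\phi;v,w)=\sum_{T}\int_T a(x,\phi_0,\nabla_w\phi)\nabla_w v\cdot\nabla_w w\,dx+\rho\sum_T h_T^{-1}\langle v_0-v_b,w_0-w_b\rangle_{\partial T},$$ $|||v|||_\phi=\sqrt{\mathfrak{a}_s(\phi;v,v)}$ and $|||v|||=|||v|||_0$. For $g\in L^2(\partial\Omega)$ (in particular for $g\in H^{1/2}(\partial\Omega)$) let $Q_bg$ be the $L^2$ projection of $g$ onto $P_k(e)$ on each boundary face $e$, and $B_{g,h}=\{v\in V_h: v_b=Q_bg\text{ on }\partial\Omega\}$. For $f\in L^1(\Omega)$, a solution of the weak Galerkin scheme is a $u_h\in B_{g,h}$ with $$\mathfrak{a}_s(u_h;u_h,v)=(f,v_0)\qquad\forall v=\{v_0,v_b\}\in V_h^0.$$ **Statement.** There is a constant $C>0$, depending only on $d$, $k$, $\Omega$, $\lambda$, $\Lambda$, $\rho$ and the shape regularity constants (hence neither on the mesh size or the mesh otherwise, nor on $a$, $f$, $g$), such that for every shape regular partition with these constants and every such $a$, $f$, $g$: the weak Galerkin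 scheme has at least one solution $u_h\in V_h$; and, if $f\in L^2(\Omega)$, every solution $u_h$ satisfies, for every $\phi\in V_h$ (in particular for $\phi=0$ and $\phi=u_h$), $$|||u_h|||_\phi\le C\Big(\|f\|_{L^2(\Omega)}+\inf_{\psi\in B_{g,h}}|||\psi|||\Big).$$ -/

import Mathlib

open MeasureTheory

namespace WG

/-- The Euclidean space `ℝ^d`. -/
abbrev Euc (d : ℕ) := EuclideanSpace ℝ (Fin d)

/-! ### Polytopal geometry -/

/-- Surface measure: the `(d-1)`-dimensional Hausdorff measure of `ℝ^d`, normalised so that it is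
Lebesgue measure on every hyperplane. -/
noncomputable abbrev surf (d : ℕ) : Measure (Euc d) := Measure.euclideanHausdorffMeasure (d - 1)

/-- An edge (`d = 2`) or flat face (`d = 3`): a connected finite union of nondegenerate
`(d-1)`-simplices, all lying in one hyperplane. -/
def IsFlatFace {d : ℕ} (e : Set (Euc d)) : Prop :=
  IsConnected e ∧
  (∃ F : Set (Fin d → Euc d), F.Finite ∧ (∀ s ∈ F, AffineIndependent ℝ s) ∧
    e = ⋃ s ∈ F, convexHull ℝ (Set.range s)) ∧
  ∃ n : Euc d, n ≠ 0 ∧ ∀ x ∈ e, ∀ y ∈ e, inner ℝ n (x - y) = 0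

/-- A polytopal domain: a bounded domain whose boundary consists of finitely many flat faces. -/
def IsPolytopalDomain {d : ℕ} (D : Set (Euc d)) : Prop :=
  IsOpen D ∧ IsConnected D ∧ Bornology.IsBounded D ∧
  ∃ F : Set (Set (Euc d)), F.Finite ∧ (∀ e ∈ F, IsFlatFace e) ∧ frontier D = ⋃₀ F

/-- A closed and simply connected polytopal element. -/
def IsElement {d : ℕ} (T : Set (Euc d)) : Prop :=
  IsPolytopalDomain (interior T) ∧ closure (interior T) = T ∧ SimplyConnectedSpace T

/-- `n` is the outward unit normal of `T` on its flat face `e`. -/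
def IsOutwardNormal {d : ℕ} (T e : Set (Euc d)) (n : Euc d) : Prop :=
  ‖n‖ = 1 ∧ (∀ x ∈ e, ∀ y ∈ e, inner ℝ n (x - y) = 0) ∧
  ∀ᵐ x ∂((surf d).restrict e), ∀ᶠ t : ℝ in nhdsWithin 0 (Set.Ioi 0),
    x - t • n ∈ T ∧ x + t • n ∉ T

/-- The outward unit normal of `T` on its flat face `e`. -/
noncomputable def outwardNormal {d : ℕ} (T e : Set (Euc d)) : Euc d :=
  Classical.epsilon (IsOutwardNormal T e)

/-- A finite element partition of `Ω` into polytopal elements, together with its set of edges or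
flat faces. The faces of an element `T` are the faces of the mesh contained in `∂T`; an edge with a
hanging node is thus split at that node. -/
structure PolytopalMesh {d : ℕ} (Ω : Set (Euc d)) where
  cells : Finset (Set (Euc d))
  faces : Finset (Set (Euc d))
  isElement : ∀ T ∈ cells, IsElement T
  isFlatFace : ∀ e ∈ faces, IsFlatFace e
  cover : ⋃ T ∈ cells, T = closure Ω
  disjoint_interior : ∀ T ∈ cells, ∀ T' ∈ cells, T ≠ T' → interior T ∩ interior T' = ∅
  frontier_cell : ∀ T ∈ cells, frontier T = ⋃ e ∈ {e | e ∈ faces ∧ e ⊆ frontier T}, e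
  frontier_domain : frontier Ω = ⋃ e ∈ {e | e ∈ faces ∧ e ⊆ frontier Ω}, e
  face_of_cell : ∀ e ∈ faces, ∃ T ∈ cells, e ⊆ frontier T
  faces_overlap : ∀ e ∈ faces, ∀ e' ∈ faces, e ≠ e' → surf d (e ∩ e') = 0
  exists_normal : ∀ T ∈ cells, ∀ e ∈ faces, e ⊆ frontier T → ∃ n, IsOutwardNormal T e n

/-- The constants of shape regularity. -/
structure ShapeConstants where
  (ϱv ϱe κ σ θ γ ϱS : ℝ)
  (nOverlap nFaces : ℕ)
  ϱv_pos : 0 < ϱv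
  ϱe_pos : 0 < ϱe
  κ_pos : 0 < κ
  σ_pos : 0 < σ
  θ_lt : θ < Real.pi / 2
  γ_pos : 0 < γ
  ϱS_pos : 0 < ϱS

section

variable {d : ℕ} {Ω : Set (Euc d)}

namespace PolytopalMesh

open Classical in
/-- The edges or flat faces of an element. -/
noncomputable def facesOf (M : PolytopalMesh Ω) (T : M.cells) : Finset M.faces :=
  Finset.univ.filter fun e => (e : Set (Euc d)) ⊆ frontier (T : Set (Euc d))

/-- Shape regularity of the mesh with given constants. -/
structure ShapeRegular (M : PolytopalMesh Ω) (c : ShapeConstants) : Prop where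
  cell_volume : ∀ T : M.cells, c.ϱv * Metric.diam (T : Set (Euc d)) ^ d ≤ volume.real (T : Set (Euc d))
  face_area : ∀ e : M.faces,
    c.ϱe * Metric.diam (e : Set (Euc d)) ^ (d - 1) ≤ (surf d).real (e : Set (Euc d))
  face_diam : ∀ T : M.cells, ∀ e ∈ M.facesOf T,
    c.κ * Metric.diam (T : Set (Euc d)) ≤ Metric.diam (e : Set (Euc d))
  /-- The pyramid with base `e` and apex `A` is contained in `T`, its height is at least
  `σ h_T`, and it stands up above `e`. -/
  pyramid : ∀ T : M.cells, ∀ e ∈ M.facesOf T, ∃ A ∈ (T : Set (Euc d)),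
    convexJoin ℝ {A} (e : Set (Euc d)) ⊆ T ∧
    ∀ x ∈ (e : Set (Euc d)),
      c.σ * Metric.diam (T : Set (Euc d)) ≤ inner ℝ (outwardNormal (T : Set (Euc d)) e) (x - A) ∧
      InnerProductGeometry.angle (x - A) (outwardNormal (T : Set (Euc d)) e) ≤ c.θ
  /-- Each element has a circumscribed shape regular simplex (it contains a ball of radius
  `ϱS` times its diameter) of diameter at most `γ h_T`, and each of these simplices meets only a
  fixed number of the others. -/
  circumscribed : ∃ S : M.cells → Fin (d + 1) → Euc d, ∀ T : M.cells,
    AffineIndependent ℝ (S T) ∧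
    (T : Set (Euc d)) ⊆ convexHull ℝ (Set.range (S T)) ∧
    (∃ z, Metric.ball z (c.ϱS * Metric.diam (convexHull ℝ (Set.range (S T)))) ⊆
      convexHull ℝ (Set.range (S T))) ∧
    Metric.diam (convexHull ℝ (Set.range (S T))) ≤ c.γ * Metric.diam (T : Set (Euc d)) ∧
    Set.ncard {T' : M.cells |
      (convexHull ℝ (Set.range (S T)) ∩ convexHull ℝ (Set.range (S T'))).Nonempty} ≤ c.nOverlap
  card_facesOf : ∀ T : M.cells, (M.facesOf T).card ≤ c.nFaces

end PolytopalMesh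

/-! ### Polynomial spaces -/

/-- Polynomials in `d` variables of total degree at most `r`. -/
noncomputable abbrev Poly (d r : ℕ) := MvPolynomial.restrictTotalDegree (Fin d) ℝ r

/-- Value of a polynomial at a point. -/
noncomputable def pval (p : MvPolynomial (Fin d) ℝ) (x : Euc d) : ℝ :=
  MvPolynomial.eval (fun i => x i) p

/-- `P_k(S)`: the restrictions to `S` of polynomials of degree at most `k`, regarded as functions
on `ℝ^d` that vanish outside `S`. -/
noncomputable def PolyOn (k : ℕ) (S : Set (Euc d)) : Submodule ℝ (Euc d → ℝ) where
  carrier := {u | ∃ p ∈ Poly d k, u = S.indicator (pval p)}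
  add_mem' := by
    rintro _ _ ⟨p, hp, rfl⟩ ⟨q, hq, rfl⟩
    refine ⟨p + q, Submodule.add_mem _ hp hq, ?_⟩
    rw [← Set.indicator_add']
    congr 1
    funext x
    simp [pval]
  zero_mem' := ⟨0, Submodule.zero_mem _, by funext x; simp [pval, Set.indicator]⟩
  smul_mem' := by
    rintro c _ ⟨p, hp, rfl⟩
    refine ⟨c • p, Submodule.smul_mem _ c hp, ?_⟩
    funext x
    by_cases hx : x ∈ S <;> simp [pval, hx]

/-- `[P_r]^d`: polynomial vector fields of degree at most `r`. -/
abbrev PolyVec (d r : ℕ) := Fin d → Poly d r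

/-- Value of a polynomial vector field at a point. -/
noncomputable def PolyVec.val {r : ℕ} (q : PolyVec d r) (x : Euc d) : Euc d :=
  WithLp.toLp 2 fun i => pval (q i : MvPolynomial (Fin d) ℝ) x

/-- Divergence of a polynomial vector field. -/
noncomputable def PolyVec.div {r : ℕ} (q : PolyVec d r) (x : Euc d) : ℝ :=
  pval (∑ i, MvPolynomial.pderiv i (q i : MvPolynomial (Fin d) ℝ)) x

/-! ### The nonlinear coefficient -/

/-- The matrix coefficient `a(x, η, p)` on `Ω`: symmetric, strictly elliptic with constant `lam`,
bounded by `Lam` in operator norm, measurable in `x` and continuous in `(η, p)`. -/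
structure IsCoefficient (Ω : Set (Euc d)) (lam Lam : ℝ)
    (a : Euc d → ℝ → Euc d → Matrix (Fin d) (Fin d) ℝ) : Prop where
  symm : ∀ x ∈ Ω, ∀ η p, (a x η p).IsSymm
  elliptic : ∀ x ∈ Ω, ∀ η p, ∀ ξ : Fin d → ℝ,
    lam * (ξ ⬝ᵥ ξ) ≤ ξ ⬝ᵥ (a x η p).mulVec ξ
  bounded : ∀ x ∈ Ω, ∀ η p, ‖Matrix.toEuclideanCLM (𝕜 := ℝ) (a x η p)‖ ≤ Lam
  measurable : ∀ η p, ∀ i j, AEMeasurable (fun x => a x η p i j) (volume.restrict Ω)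
  continuous : ∀ x ∈ Ω, Continuous fun z : ℝ × Euc d => a x z.1 z.2

namespace PolytopalMesh

variable (M : PolytopalMesh Ω) {k : ℕ}

/-! ### The weak Galerkin scheme -/

/-- The weak finite element space `V_h`: a function `v = {v₀, v_b}` with `v₀ ∈ P_k(T)` on each
element `T`, and single-valued `v_b ∈ P_k(e)` on each edge or flat face `e`. -/
abbrev V (k : ℕ) :=
  (∀ T : M.cells, PolyOn k (T : Set (Euc d))) × (∀ e : M.faces, PolyOn k (e : Set (Euc d)))

/-- The component `v₀` on the element `T`. -/
def v0 (v : M.V k) (T : M.cells) : Euc d → ℝ := v.1 T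

/-- The component `v_b` on the face `e`. -/
def vb (v : M.V k) (e : M.faces) : Euc d → ℝ := v.2 e

/-- The subspace `V_h⁰` of functions with `v_b = 0` on `∂Ω`. -/
def V0 (k : ℕ) : Set (M.V k) :=
  {v | ∀ e : M.faces, (e : Set (Euc d)) ⊆ frontier Ω → M.vb v e = 0}

/-- `B_{g,h}`: the functions of `V_h` whose boundary component on `∂Ω` is `Q_b g`, the `L²`
projection of `g` onto `P_k(e)` for every boundary edge or face `e`. -/
def B (k : ℕ) (g : Euc d → ℝ) : Set (M.V k) :=
  {v | ∀ e : M.faces, (e : Set (Euc d)) ⊆ frontier Ω → ∀ q ∈ PolyOn k (e : Set (Euc d)),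
    ∫ x in (e : Set (Euc d)), M.vb v e x * q x ∂(surf d) =
      ∫ x in (e : Set (Euc d)), g x * q x ∂(surf d)}

/-- `G` is the discrete weak gradient of `v` on `T` in `[P_{k-1}(T)]^d`. -/
def IsWeakGrad (v : M.V k) (T : M.cells) (G : PolyVec d (k - 1)) : Prop :=
  ∀ q : PolyVec d (k - 1),
    ∫ x in (T : Set (Euc d)), inner ℝ (G.val x) (q.val x) =
      -(∫ x in (T : Set (Euc d)), M.v0 v T x * q.div x) +
      ∑ e ∈ M.facesOf T, ∫ x in (e : Set (Euc d)),
        M.vb v e x * inner ℝ (q.val x) (outwardNormal (T : Set (Euc d)) e) ∂(surf d)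

/-- The discrete weak gradient of `v` on `T`. -/
noncomputable def weakGrad (v : M.V k) (T : M.cells) : PolyVec d (k - 1) :=
  Classical.epsilon (M.IsWeakGrad v T)

/-- The form `𝔞(φ; v, w)`. -/
noncomputable def formA (a : Euc d → ℝ → Euc d → Matrix (Fin d) (Fin d) ℝ) (φ v w : M.V k) : ℝ :=
  ∑ T : M.cells, ∫ x in (T : Set (Euc d)),
    inner ℝ (Matrix.toEuclideanCLM (𝕜 := ℝ) (a x (M.v0 φ T x) ((M.weakGrad φ T).val x))
      ((M.weakGrad v T).val x)) ((M.weakGrad w T).val x)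

/-- The stabilizer `s(v, w)`. -/
noncomputable def stab (ρ : ℝ) (v w : M.V k) : ℝ :=
  ρ * ∑ T : M.cells, (Metric.diam (T : Set (Euc d)))⁻¹ *
    ∑ e ∈ M.facesOf T, ∫ x in (e : Set (Euc d)),
      (M.v0 v T x - M.vb v e x) * (M.v0 w T x - M.vb w e x) ∂(surf d)

/-- The stabilized form `𝔞_s(φ; v, w)`. -/
noncomputable def formAs (ρ : ℝ) (a : Euc d → ℝ → Euc d → Matrix (Fin d) (Fin d) ℝ)
    (φ v w : M.V k) : ℝ :=
  M.formA a φ v w + M.stab ρ v w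

/-- The norm `|||v|||_φ`; the norm `|||v|||` is the case `φ = 0`. -/
noncomputable def tripleNorm (ρ : ℝ) (a : Euc d → ℝ → Euc d → Matrix (Fin d) (Fin d) ℝ)
    (φ v : M.V k) : ℝ :=
  √(M.formAs ρ a φ v v)

/-- `u` solves the (nonlinear) weak Galerkin scheme. -/
def IsSolution (ρ : ℝ) (a : Euc d → ℝ → Euc d → Matrix (Fin d) (Fin d) ℝ) (f g : Euc d → ℝ)
    (u : M.V k) : Prop :=
  u ∈ M.B k g ∧ ∀ v ∈ M.V0 k,
    M.formAs ρ a u u v = ∑ T : M.cells, ∫ x in (T : Set (Euc d)), f x * M.v0 v T x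

end PolytopalMesh

end

end WG

/-! Everything is measured in the energy E(v) = Σ_T (‖∇_w v‖²_T + h_T⁻¹‖v₀ − v_b‖²_∂T). Ellipticity
and boundedness of a make 𝔞_s(φ; ·, ·) coercive and bounded with respect to E, with constants min(λ,
ρ) and max(|Λ|, ρ) that do not see φ (`le_formAs`, `abs_formAs_le`). The only ingredient sensitive
to the mesh is the discrete Poincaré inequality ‖v₀‖² ≤ C E(v) on V_h⁰ (`exists_poincare`), with C
depending only on k, Ω and the shape constants.

Poincaré comes from applying the divergence theorem on each element to the field v₀² x₁ e₁, whose
divergence is v₀² + 2 v₀ ∂₁v₀ x₁. On the faces v₀² is replaced by v_b² at the cost of jumps; the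
fluxes of the single-valued v_b² x₁ cancel across interior faces and vanish on ∂Ω
(`sum_flux_eq_zero`). The remaining terms are ∇v₀, controlled by the weak gradient and the jumps
through integration by parts (`grad_le`), and the trace of v₀, absorbed by a polynomial trace
inequality (`exists_trace`). That inequality is a one-dimensional estimate along the rays of the
pyramid of (A3). The elements need not be convex, so the divergence theorem is proved by slicing:
almost every line in a fixed direction meets an element in a set with finitely many end points, all
of them regular points of faces, and the one-dimensional fundamental theorem is integrated over the
lines (`integral_directional_deriv`).

Existence is a finite-dimensional argument of Brouwer type. On ψ + V_h⁰ the residual of the scheme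
is a continuous vector field, by dominated convergence in the coefficient. Coercivity, uniform in φ,
makes it point outwards on a large sphere, so it has a zero (`exists_zero_of_continuous`). The
topological input is that a ball does not retract onto its sphere, proved by a volume computation
(`no_retraction`).

Stability follows by testing with u − ψ for an arbitrary ψ ∈ B_{g,h}: coercivity, Poincaré for the
load and Young's inequality bound E(u) by ‖f‖² and E(ψ). The equivalence of E with every |||·|||_φ²
and the infimum over ψ finish the proof. -/

namespace WG

/-! ### Hyperplanes, surface measure and Fubini -/

/-- The orthogonal complement of a vector. -/
noncomputable abbrev Perp {d : ℕ} (n : Euc d) : Submodule ℝ (Euc d) := (ℝ ∙ n)ᗮ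

theorem finrank_perp {d : ℕ} {n : Euc d} (hn : ‖n‖ = 1) :
    Module.finrank ℝ (Perp n) = d - 1 := by
  have h := (ℝ ∙ n).finrank_add_finrank_orthogonal
  have hn0 : n ≠ 0 := by rintro rfl; simp at hn
  rw [finrank_span_singleton hn0, finrank_euclideanSpace_fin] at h
  exact (Nat.sub_eq_of_eq_add' h.symm).symm

theorem inner_perp {d : ℕ} (n : Euc d) (z : Perp n) : inner ℝ n (z : Euc d) = 0 :=
  Submodule.mem_orthogonal_singleton_iff_inner_right.1 z.2

theorem range_add_perp {d : ℕ} (n x₀ : Euc d) :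
    Set.range (fun z : Perp n => x₀ + (z : Euc d)) = {x | inner ℝ n (x - x₀) = 0} := by
  ext x
  constructor
  · rintro ⟨z, rfl⟩
    simp [inner_perp]
  · intro hx
    exact ⟨⟨x - x₀, Submodule.mem_orthogonal_singleton_iff_inner_right.2 hx⟩, by simp⟩

/-- Isometries preserve the normalised Hausdorff measure, which is the volume on an inner product
space of matching dimension. This is the coordinate form in which surface integrals over a
hyperplane are computed. -/
theorem map_perp_eq_surf {d : ℕ} {n : Euc d} (hn : ‖n‖ = 1) (x₀ : Euc d) :
    (volume : Measure (Perp n)).map (fun z : Perp n => x₀ + (z : Euc d)) =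
      (surf d).restrict {x | inner ℝ n (x - x₀) = 0} := by
  have hi : Isometry (fun z : Perp n => x₀ + (z : Euc d)) :=
    (isometry_add_left x₀).comp isometry_subtype_coe
  rw [← InnerProductSpace.euclideanHausdorffMeasure_eq_volume, finrank_perp hn,
    hi.map_euclideanHausdorffMeasure, range_add_perp]

/-- Orthogonal splitting of the space along the line of `n`; because `n` has norm one, t ↦ t n
carries Lebesgue measure to the volume of that line. -/
theorem measurePreserving_perp {d : ℕ} {n : Euc d} (hn : ‖n‖ = 1) (x₀ : Euc d) :
    MeasurePreserving (fun p : ℝ × Perp n => x₀ + p.1 • n + (p.2 : Euc d))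
      (volume.prod volume) volume := by
  have hn0 : n ≠ 0 := by rintro rfl; simp at hn
  let f : ℝ ≃L[ℝ] (ℝ ∙ n) := ContinuousLinearEquiv.toSpanNonzeroSingleton ℝ n hn0
  have hf : MeasurePreserving f volume volume := by
    refine ⟨f.continuous.measurable, ?_⟩
    let v' : (ℝ ∙ n) := ⟨n, Submodule.mem_span_singleton_self n⟩
    have := volume_eq_of_finrank_eq_one (finrank_span_singleton (K := ℝ) hn0)
      (v := v') (by simpa [v'] using hn0)
    have h1 : ‖v'‖ₑ = 1 := by
      rw [← ofReal_norm]; simp [v', hn]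
    rw [this, h1, one_smul]
    rfl
  have h2 := ((ℝ ∙ n).measurePreserving_measurableEquivProd x₀).symm
  rw [finrank_euclideanSpace_fin, EuclideanSpace.euclideanHausdorffMeasure_eq_volume] at h2
  have h3 : MeasurePreserving (Prod.map f (id : Perp n → Perp n)) (volume.prod volume)
      (volume.prod volume) := hf.prod (MeasurePreserving.id _)
  have h4 := h2.comp h3
  have h5 : (fun p : ℝ × Perp n => x₀ + p.1 • n + (p.2 : Euc d)) =
      ((ℝ ∙ n).measurableEquivProd x₀).symm ∘ Prod.map f (id : Perp n → Perp n) := by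
    funext p
    simp [f]
    abel
  rw [h5]
  exact h4

theorem lintegral_eq_perp {d : ℕ} {n : Euc d} (hn : ‖n‖ = 1) (x₀ : Euc d)
    {G : Euc d → ENNReal} (hG : Measurable G) :
    ∫⁻ x, G x = ∫⁻ s : ℝ, ∫⁻ z : Perp n, G (x₀ + s • n + (z : Euc d)) := by
  have h := measurePreserving_perp hn x₀
  rw [← h.lintegral_comp hG, lintegral_prod]
  exact (hG.comp h.measurable).aemeasurable

/-- With c = ⟨n, ν⟩, the point z + t ν has height c t over the hyperplane and is displaced inside it
by t w, where w = ν − c n. Translation by t w preserves each slice, so only the rescaling of the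
height contributes a Jacobian. -/
theorem lintegral_eq_shear {d : ℕ} {n : Euc d} (hn : ‖n‖ = 1) (x₀ ν : Euc d)
    (hν : inner ℝ n ν ≠ 0) {G : Euc d → ENNReal} (hG : Measurable G) :
    ∫⁻ x, G x = ENNReal.ofReal |inner ℝ n ν| *
      ∫⁻ z : Perp n, ∫⁻ t : ℝ, G (x₀ + (z : Euc d) + t • ν) := by
  set c : ℝ := inner ℝ n ν with hc
  let w : Perp n := ⟨ν - c • n, Submodule.mem_orthogonal_singleton_iff_inner_right.2 (by
    rw [inner_sub_right, inner_smul_right, real_inner_self_eq_norm_sq, hn]; simp [hc])⟩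
  have hmeas : Measurable (fun p : ℝ × Perp n => G (x₀ + p.1 • n + (p.2 : Euc d))) :=
    hG.comp (measurePreserving_perp hn x₀).measurable
  have hmeas' : Measurable (fun p : Perp n × ℝ => G (x₀ + (p.1 : Euc d) + p.2 • ν)) := by
    apply hG.comp
    fun_prop
  rw [lintegral_lintegral_swap hmeas'.aemeasurable]
  have hstep : ∀ t : ℝ, ∫⁻ z : Perp n, G (x₀ + (z : Euc d) + t • ν) =
      ∫⁻ z : Perp n, G (x₀ + (c * t) • n + (z : Euc d)) := by
    intro t
    rw [← lintegral_add_right_eq_self (fun z : Perp n => G (x₀ + (c * t) • n + (z : Euc d))) (t • w)]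
    refine lintegral_congr fun z => ?_
    congr 1
    simp only [w, Submodule.coe_add, Submodule.coe_smul, smul_sub, smul_smul]
    rw [mul_comm c t]; abel
  simp_rw [hstep]
  rw [lintegral_eq_perp hn x₀ hG]
  set g : ℝ → ENNReal := fun s => ∫⁻ z : Perp n, G (x₀ + s • n + (z : Euc d)) with hg
  have hgm : Measurable g := hmeas.lintegral_prod_right'
  have hmap := Real.map_volume_mul_left hν
  have : ∫⁻ t, g (c * t) = ENNReal.ofReal |c⁻¹| * ∫⁻ s, g s := by
    rw [← lintegral_map hgm (measurable_const_mul c), hmap, lintegral_smul_measure, smul_eq_mul]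
  rw [show (∫⁻ t : ℝ, ∫⁻ z : Perp n, G (x₀ + (c * t) • n + (z : Euc d))) = ∫⁻ t, g (c * t) from rfl,
    this, ← mul_assoc, ← ENNReal.ofReal_mul (abs_nonneg _), ← abs_mul, mul_inv_cancel₀ hν]
  simp

/-- The projection along `ν` onto the hyperplane through `x₀` with normal `n`. -/
noncomputable def hit {d : ℕ} (n x₀ ν : Euc d) (x : Euc d) : Euc d :=
  x + (inner ℝ n (x₀ - x) / inner ℝ n ν) • ν

@[fun_prop]
theorem continuous_hit {d : ℕ} (n x₀ ν : Euc d) : Continuous (hit n x₀ ν) := by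
  unfold hit
  fun_prop

theorem hit_add_smul {d : ℕ} {n x₀ ν : Euc d} (hν : inner ℝ n ν ≠ 0) (x : Euc d) (t : ℝ) :
    hit n x₀ ν (x + t • ν) = hit n x₀ ν x := by
  simp only [hit]
  have : inner ℝ n (x₀ - (x + t • ν)) / inner ℝ n ν = inner ℝ n (x₀ - x) / inner ℝ n ν - t := by
    rw [sub_add_eq_sub_sub, inner_sub_right _ (x₀ - x), inner_smul_right]
    field_simp
  rw [this, sub_smul]; abel

theorem hit_of_mem {d : ℕ} {n x₀ ν x : Euc d} (hx : inner ℝ n (x - x₀) = 0) :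
    hit n x₀ ν x = x := by
  have : inner ℝ n (x₀ - x) = 0 := by rw [← neg_sub, inner_neg_right, hx, neg_zero]
  simp [hit, this]

/-- The volume of the oblique cylinder over `E`, with generators of length one along `ν`, is
computed twice: by Fubini over ν^⊥, and by the shear formula over the hyperplane. The factor |⟨n,
ν⟩| is the cosine relating an area to its projection. -/
theorem map_hit {d : ℕ} {n ν : Euc d} (hn : ‖n‖ = 1) (hν1 : ‖ν‖ = 1) (x₀ : Euc d)
    (hν : inner ℝ n ν ≠ 0) :
    (volume : Measure (Perp ν)).map (fun z : Perp ν => hit n x₀ ν (z : Euc d)) =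
      ENNReal.ofReal |inner ℝ n ν| • (surf d).restrict {x | inner ℝ n (x - x₀) = 0} := by
  have hνν : inner ℝ ν ν = (1 : ℝ) := by rw [real_inner_self_eq_norm_sq, hν1]; simp
  ext E hE
  rw [← map_perp_eq_surf hn x₀, Measure.smul_apply, smul_eq_mul,
    Measure.map_apply (by fun_prop) hE, Measure.map_apply (by fun_prop) hE]
  let τ : Euc d → ℝ := fun x => inner ℝ n (x - x₀) / inner ℝ n ν
  have hτ : ∀ x (t : ℝ), τ (x + t • ν) = τ x + t := by
    intro x t
    simp only [τ]
    rw [add_sub_right_comm, inner_add_right, inner_smul_right]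
    field_simp
  have hτm : Measurable τ := by
    apply Continuous.measurable
    fun_prop
  let G : Euc d → ENNReal := fun x =>
    E.indicator 1 (hit n x₀ ν x) * (Set.Icc (0 : ℝ) 1).indicator 1 (τ x)
  have hG : Measurable G := by
    apply Measurable.mul
    · exact (measurable_one.indicator hE).comp (continuous_hit n x₀ ν).measurable
    · exact (measurable_one.indicator measurableSet_Icc).comp hτm
  have hI : ∀ a : ℝ, ∫⁻ t : ℝ, (Set.Icc (0 : ℝ) 1).indicator (1 : ℝ → ENNReal) (a + t) = 1 := by
    intro a
    rw [lintegral_add_left_eq_self (fun t => (Set.Icc (0 : ℝ) 1).indicator (1 : ℝ → ENNReal) t) a]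
    simp
  have hinner : ∀ x : Euc d, ∫⁻ t : ℝ, G (x + t • ν) = E.indicator 1 (hit n x₀ ν x) := by
    intro x
    simp only [G, hit_add_smul hν, hτ]
    rw [lintegral_const_mul, hI, mul_one]
    exact (measurable_one.indicator measurableSet_Icc).comp (measurable_const_add _)
  have h1 := lintegral_eq_shear hν1 0 ν (by rw [hνν]; norm_num) hG
  have h2 := lintegral_eq_shear hn x₀ ν hν hG
  rw [h1, hνν] at h2
  simp only [hinner, zero_add, abs_one, ENNReal.ofReal_one, one_mul] at h2
  have e1 : ∫⁻ z : Perp ν, E.indicator (1 : Euc d → ENNReal) (hit n x₀ ν (z : Euc d)) =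
      volume ((fun z : Perp ν => hit n x₀ ν (z : Euc d)) ⁻¹' E) := by
    rw [← lintegral_indicator_one (by exact (show Measurable _ by fun_prop) hE)]
    rfl
  have e2 : ∫⁻ z : Perp n, E.indicator (1 : Euc d → ENNReal) (hit n x₀ ν (x₀ + (z : Euc d))) =
      volume ((fun z : Perp n => x₀ + (z : Euc d)) ⁻¹' E) := by
    rw [← lintegral_indicator_one (by exact (show Measurable _ by fun_prop) hE)]
    refine lintegral_congr fun z => ?_
    rw [hit_of_mem (by simp [inner_perp])]
    rfl
  rw [e1, e2] at h2
  exact h2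

end WG

namespace WG

/-! ### The fundamental theorem of calculus on a set of reals with finitely many end points -/

-- The function 1_S − Σ ε_i 1_{(−∞, τ_i)} is constant on a punctured neighbourhood of every point.
-- Neighbouring constants agree since the punctured neighbourhoods overlap, so by connectedness
-- there is only one constant, and it is 0 because everything vanishes far to the right. Hence 1_S
-- is a signed sum of half-line indicators off the τ_i, and each is integrated by the fundamental
-- theorem. No decomposition of `S` into intervals is needed.
open Filter Topology in
theorem integral_deriv_eq_sum_endpoints {ι : Type*} (S : Set ℝ)
    (I : Finset ι) (τ ε : ι → ℝ) (hτ : Set.InjOn τ I) {R : ℝ} (hR : S ⊆ Set.Icc (-R) R)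
    (h1 : ∀ t, (∀ i ∈ I, τ i ≠ t) → (∀ᶠ s in 𝓝 t, s ∈ S) ∨ (∀ᶠ s in 𝓝 t, s ∉ S))
    (h2 : ∀ i ∈ I,
      (ε i = 1 ∧ (∀ᶠ s in 𝓝[<] (τ i), s ∈ S) ∧ (∀ᶠ s in 𝓝[>] (τ i), s ∉ S)) ∨
      (ε i = -1 ∧ (∀ᶠ s in 𝓝[<] (τ i), s ∉ S) ∧ (∀ᶠ s in 𝓝[>] (τ i), s ∈ S)))
    {F F' : ℝ → ℝ} (hF : ∀ t, HasDerivAt F (F' t) t) (hF' : Continuous F') :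
    ∫ t, S.indicator F' t = ∑ i ∈ I, ε i * F (τ i) := by
  classical
  let χ : ℝ → ℝ := fun s => if s ∈ S then 1 else 0
  let g : ℝ → ℝ := fun s => χ s - ∑ i ∈ I, ε i * (if s < τ i then 1 else 0)
  have hconst : ∀ (J : Finset ι) (x : ℝ), (∀ i ∈ J, τ i ≠ x) → ∀ᶠ s in 𝓝 x,
      ∑ i ∈ J, ε i * (if s < τ i then (1 : ℝ) else 0) =
        ∑ i ∈ J, ε i * (if x < τ i then (1 : ℝ) else 0) := by
    intro J x hJ
    have : ∀ᶠ s in 𝓝 x, ∀ i ∈ J, (s < τ i ↔ x < τ i) := by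
      rw [Filter.eventually_all_finset]
      intro i hi
      rcases lt_or_gt_of_ne (hJ i hi) with h | h
      · filter_upwards [lt_mem_nhds h] with s hs
        exact ⟨fun h' => absurd h' (not_lt.2 hs.le), fun h' => absurd h' (not_lt.2 h.le)⟩
      · filter_upwards [gt_mem_nhds h] with s hs
        exact ⟨fun _ => h, fun _ => hs⟩
    filter_upwards [this] with s hs
    exact Finset.sum_congr rfl fun i hi => by simp only [hs i hi]
  have hreg : ∀ x, (∀ i ∈ I, τ i ≠ x) → ∃ c, ∀ᶠ s in 𝓝 x, g s = c := by
    intro x hx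
    rcases h1 x hx with h | h
    · refine ⟨1 - ∑ i ∈ I, ε i * (if x < τ i then (1 : ℝ) else 0), ?_⟩
      filter_upwards [h, hconst I x hx] with s hs hs'
      simp only [g, χ, hs, hs', if_true]
    · refine ⟨0 - ∑ i ∈ I, ε i * (if x < τ i then (1 : ℝ) else 0), ?_⟩
      filter_upwards [h, hconst I x hx] with s hs hs'
      simp only [g, χ, hs, hs', if_false]
  -- At an end point the jump of 1_S is cancelled by the jump of the corresponding signed half-line;
  -- injectivity of `τ` ensures that no other term jumps there.
  have hpun : ∀ x, ∃ c, ∀ᶠ s in 𝓝[≠] x, g s = c := by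
    intro x
    by_cases hx : ∀ i ∈ I, τ i ≠ x
    · obtain ⟨c, hc⟩ := hreg x hx
      exact ⟨c, hc.filter_mono nhdsWithin_le_nhds⟩
    · push Not at hx
      obtain ⟨i, hi, rfl⟩ := hx
      have hJ : ∀ j ∈ I.erase i, τ j ≠ τ i := fun j hj h =>
        (Finset.mem_erase.1 hj).1 (hτ (Finset.mem_erase.1 hj).2 hi h)
      have hk := hconst (I.erase i) (τ i) hJ
      have hg : ∀ s, g s = χ s - ε i * (if s < τ i then 1 else 0) -
          ∑ j ∈ I.erase i, ε j * (if s < τ j then (1 : ℝ) else 0) := by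
        intro s
        simp only [g]
        rw [← Finset.add_sum_erase I _ hi]; ring
      rw [← Set.Iio_union_Ioi, nhdsWithin_union]
      simp only [eventually_sup]
      rcases h2 i hi with ⟨he, hl, hr⟩ | ⟨he, hl, hr⟩
      · refine ⟨0 - ∑ j ∈ I.erase i, ε j * (if τ i < τ j then (1 : ℝ) else 0), ?_, ?_⟩
        · filter_upwards [hl, hk.filter_mono nhdsWithin_le_nhds, self_mem_nhdsWithin] with s a b c
          have c' : s < τ i := c
          rw [hg, b, he]; simp [χ, a, c']
        · filter_upwards [hr, hk.filter_mono nhdsWithin_le_nhds, self_mem_nhdsWithin] with s a b c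
          have c' : ¬ s < τ i := not_lt.2 (le_of_lt c)
          rw [hg, b, he]; simp [χ, a, c']
      · refine ⟨1 - ∑ j ∈ I.erase i, ε j * (if τ i < τ j then (1 : ℝ) else 0), ?_, ?_⟩
        · filter_upwards [hl, hk.filter_mono nhdsWithin_le_nhds, self_mem_nhdsWithin] with s a b c
          have c' : s < τ i := c
          rw [hg, b, he]; simp [χ, a, c']
        · filter_upwards [hr, hk.filter_mono nhdsWithin_le_nhds, self_mem_nhdsWithin] with s a b c
          have c' : ¬ s < τ i := not_lt.2 (le_of_lt c)
          rw [hg, b, he]; simp [χ, a, c']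
  choose L hL using hpun
  have hLc : IsLocallyConstant L := by
    rw [IsLocallyConstant.iff_eventually_eq]
    intro x
    have h := eventually_nhdsWithin_iff.1 (hL x)
    filter_upwards [h.eventually_nhds] with y hy
    by_cases hyx : y = x
    · rw [hyx]
    · have h3 : ∀ᶠ s in 𝓝[≠] y, g s = L x := by
        filter_upwards [hy.filter_mono nhdsWithin_le_nhds,
          (isOpen_ne.mem_nhds hyx : {s | s ≠ x} ∈ 𝓝 y) |> mem_nhdsWithin_of_mem_nhds] with s hs hs'
        exact hs hs'
      obtain ⟨s, hs, hs'⟩ := (h3.and (hL y)).exists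
      rw [← hs, ← hs']
  obtain ⟨M, hM⟩ : ∃ M : ℝ, R < M ∧ ∀ i ∈ I, |τ i| < M := by
    refine ⟨|R| + ∑ i ∈ I, |τ i| + 1, ?_, ?_⟩
    · have := Finset.sum_nonneg (fun i (_ : i ∈ I) => abs_nonneg (τ i))
      linarith [le_abs_self R]
    · intro i hi
      have := Finset.single_le_sum (fun i (_ : i ∈ I) => abs_nonneg (τ i)) hi
      linarith [abs_nonneg R]
  have hgM : ∀ s, M < s → g s = 0 := by
    intro s hs
    have hsS : s ∉ S := fun h => by linarith [(hR h).2, hM.1]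
    simp only [g, χ, hsS, if_false]
    rw [Finset.sum_eq_zero, sub_zero]
    intro i hi
    have : ¬ s < τ i := by linarith [(abs_lt.1 (hM.2 i hi)).2]
    simp [this]
  have hL0 : ∀ x, L x = 0 := by
    intro x
    rw [hLc.apply_eq_of_preconnectedSpace x (M + 1)]
    have h3 : ∀ᶠ s in 𝓝[≠] (M + 1), g s = 0 := by
      filter_upwards [(Ioi_mem_nhds (by linarith : M < M + 1)) |> mem_nhdsWithin_of_mem_nhds]
        with s hs using hgM s hs
    obtain ⟨s, hs, hs'⟩ := (h3.and (hL (M + 1))).exists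
    rw [← hs, ← hs']
  have hg0 : ∀ x, (∀ i ∈ I, τ i ≠ x) → g x = 0 := by
    intro x hx
    obtain ⟨c, hc⟩ := hreg x hx
    obtain ⟨s, hs, hs'⟩ := ((hc.filter_mono nhdsWithin_le_nhds).and (hL x)).exists
    rw [hc.self_of_nhds, ← hs, hs', hL0]
  -- At −M, to the left of `S` and of all end points, the identity reduces to the vanishing of the
  -- total sign. This later removes the terms ε_i F(−M).
  have hsum : ∑ i ∈ I, ε i = 0 := by
    have h := hg0 (-M) (fun i hi h => by
      have := hM.2 i hi
      rw [h] at this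
      linarith [(abs_lt.1 this).1])
    have hsS : -M ∉ S := fun h => by linarith [(hR h).1, hM.1]
    simp only [g, χ, hsS, if_false] at h
    rw [← neg_eq_zero, ← h, zero_sub]
    congr 1
    refine Finset.sum_congr rfl fun i hi => ?_
    rw [if_pos (by linarith [(abs_lt.1 (hM.2 i hi)).1]), mul_one]
  have hae : S.indicator F' =ᵐ[volume]
      fun t => ∑ i ∈ I, ε i * (Set.Ioc (-M) (τ i)).indicator F' t := by
    have hfin : ((I.image τ : Finset ℝ) : Set ℝ)ᶜ ∈ ae (volume : Measure ℝ) :=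
      compl_mem_ae_iff.2 ((Finset.finite_toSet _).measure_zero _)
    filter_upwards [hfin] with t ht
    have ht' : ∀ i ∈ I, τ i ≠ t := fun i hi h => ht (by simpa using ⟨i, hi, h⟩)
    have hg := hg0 t ht'
    have hχ : χ t = ∑ i ∈ I, ε i * (if t < τ i then 1 else 0) := by linarith
    by_cases htM : -M < t
    · have : S.indicator F' t = χ t * F' t := by
        by_cases h : t ∈ S <;> simp [χ, h]
      rw [this, hχ, Finset.sum_mul]
      refine Finset.sum_congr rfl fun i hi => ?_
      have := ht' i hi
      by_cases h : t < τ i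
      · rw [Set.indicator_of_mem (show t ∈ Set.Ioc (-M) (τ i) from ⟨htM, h.le⟩)]; simp [h]
      · rw [Set.indicator_of_notMem (fun h' : t ∈ Set.Ioc (-M) (τ i) =>
          h (lt_of_le_of_ne h'.2 this.symm))]; simp [h]
    · have : t ∉ S := fun h => by linarith [(hR h).1, hM.1]
      rw [Set.indicator_of_notMem this, Finset.sum_eq_zero]
      intro i hi
      rw [Set.indicator_of_notMem (fun h => htM h.1), mul_zero]
  rw [integral_congr_ae hae, integral_finsetSum]
  · have : ∀ i ∈ I, ∫ t, ε i * (Set.Ioc (-M) (τ i)).indicator F' t =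
        ε i * F (τ i) - ε i * F (-M) := by
      intro i hi
      rw [integral_const_mul, integral_indicator measurableSet_Ioc,
        ← intervalIntegral.integral_of_le (by linarith [(abs_lt.1 (hM.2 i hi)).1]),
        intervalIntegral.integral_eq_sub_of_hasDerivAt (fun t _ => hF t)
          (hF'.intervalIntegrable _ _)]
      ring
    rw [Finset.sum_congr rfl this, Finset.sum_sub_distrib, ← Finset.sum_mul, hsum]
    ring
  · intro i hi
    refine Integrable.const_mul ?_ _
    rw [integrable_indicator_iff measurableSet_Ioc]
    exact (hF'.integrableOn_Icc (a := -M) (b := τ i)).mono_set Set.Ioc_subset_Icc_self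

end WG

namespace WG

/-! ### The divergence theorem on polytopal elements -/

open Filter Topology

/-- `x` lies on the face `E i` and on no other face, and the normal `n` points out of `T` there. -/
def IsRegularPoint {d : ℕ} {ι : Type*} (T : Set (Euc d)) (𝓕 : Finset ι) (E : ι → Set (Euc d))
    (i : ι) (n x : Euc d) : Prop :=
  x ∈ E i ∧ (∀ j ∈ 𝓕, j ≠ i → x ∉ E j) ∧
    ∀ᶠ t : ℝ in 𝓝[>] 0, x - t • n ∈ T ∧ x + t • n ∉ T

theorem subset_interior_or_subset_compl {d : ℕ} {T H : Set (Euc d)} (hT : IsClosed T)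
    (hH : IsPreconnected H) (hd : ∀ y ∈ H, y ∉ frontier T) : H ⊆ interior T ∨ H ⊆ Tᶜ := by
  have hsub : H ⊆ interior T ∪ Tᶜ := by
    intro y hy
    by_cases hyT : y ∈ T
    · left
      by_contra h
      exact hd y hy (by rw [hT.frontier_eq]; exact ⟨hyT, h⟩)
    · exact Or.inr hyT
  rcases H.eq_empty_or_nonempty with rfl | ⟨y, hy⟩
  · simp
  · have hdis : Disjoint (interior T) Tᶜ :=
      Set.disjoint_compl_right_iff_subset.2 interior_subset
    rcases hsub hy with h | h
    · exact Or.inl (hH.subset_left_of_subset_union isOpen_interior hT.isOpen_compl hdis hsub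
        ⟨y, hy, h⟩)
    · exact Or.inr (hH.subset_right_of_subset_union isOpen_interior hT.isOpen_compl hdis hsub
        ⟨y, hy, h⟩)

theorem convex_halfBall {d : ℕ} (n x : Euc d) (r : ℝ) :
    Convex ℝ {y | y ∈ Metric.ball x r ∧ inner ℝ n (y - x) < 0} := by
  have h : {y | y ∈ Metric.ball x r ∧ inner ℝ n (y - x) < 0} =
      Metric.ball x r ∩ {y | (innerSL ℝ n) y < inner ℝ n x} := by
    ext y; simp [inner_sub_right]
  rw [h]
  exact (convex_ball x r).inter (convex_halfSpace_lt (innerSL ℝ n).isLinear _)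

theorem eventually_half_ball {d : ℕ} (x n : Euc d) {r : ℝ} (hr : 0 < r) (hn : ‖n‖ = 1) :
    ∀ᶠ t : ℝ in 𝓝[>] 0, (x - t • n ∈ Metric.ball x r ∧ inner ℝ n (x - t • n - x) < 0) ∧
      (x + t • n ∈ Metric.ball x r ∧ inner ℝ (-n) (x + t • n - x) < 0) := by
  filter_upwards [Ioo_mem_nhdsGT hr] with t ht
  refine ⟨⟨?_, ?_⟩, ?_, ?_⟩
  · simp [norm_smul, hn, abs_of_pos ht.1, ht.2]
  · simp [inner_smul_right, hn, ht.1]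
  · simp [norm_smul, hn, abs_of_pos ht.1, ht.2]
  · simp [inner_smul_right, hn, ht.1]

/-- The other faces are closed and miss `x`, so in a small ball the frontier lies in the hyperplane
of `E i`. Each open half ball is then connected and free of frontier points, hence wholly inside or
wholly outside; the behaviour of `T` along the normal decides which. -/
theorem IsRegularPoint.exists_ball {d : ℕ} {ι : Type*} {T : Set (Euc d)} (hT : IsClosed T)
    {𝓕 : Finset ι} {E : ι → Set (Euc d)} (hE : ∀ i ∈ 𝓕, IsClosed (E i))
    (hfr : frontier T = ⋃ i ∈ 𝓕, E i) {i : ι} {n x : Euc d} (hn : ‖n‖ = 1)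
    (horth : ∀ x ∈ E i, ∀ y ∈ E i, inner ℝ n (x - y) = 0)
    (hx : IsRegularPoint T 𝓕 E i n x) :
    ∃ r > 0, ∀ y ∈ Metric.ball x r,
      (inner ℝ n (y - x) < 0 → y ∈ interior T) ∧ (0 < inner ℝ n (y - x) → y ∉ T) := by
  classical
  obtain ⟨hxE, hxj, hev⟩ := hx
  have hU : IsClosed (⋃ j ∈ 𝓕.erase i, E j) :=
    Set.Finite.isClosed_biUnion (Finset.finite_toSet _)
      (fun j hj => hE j (Finset.mem_of_mem_erase hj))
  have hxU : x ∉ ⋃ j ∈ 𝓕.erase i, E j := by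
    simp only [Set.mem_iUnion, not_exists]
    intro j hj
    exact hxj j (Finset.mem_of_mem_erase hj) (Finset.ne_of_mem_erase hj)
  obtain ⟨r, hr, hball⟩ := Metric.isOpen_iff.1 hU.isOpen_compl x hxU
  have hfrE : ∀ y ∈ Metric.ball x r, y ∈ frontier T → inner ℝ n (y - x) = 0 := by
    intro y hy hyf
    rw [hfr] at hyf
    simp only [Set.mem_iUnion] at hyf
    obtain ⟨j, hj, hyj⟩ := hyf
    by_cases hji : j = i
    · subst hji
      exact horth y hyj x hxE
    · exfalso
      refine hball hy ?_
      simp only [Set.mem_iUnion]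
      exact ⟨j, Finset.mem_erase.2 ⟨hji, hj⟩, hyj⟩
  obtain ⟨t, ⟨ht1, ht2⟩, ht3, ht4⟩ := (hev.and (eventually_half_ball x n hr hn)).exists
  refine ⟨r, hr, fun y hy => ⟨fun hyn => ?_, fun hyn => ?_⟩⟩
  · rcases subset_interior_or_subset_compl hT (convex_halfBall n x r).isPreconnected
      (fun y hy h => hy.2.ne (hfrE y hy.1 h)) with h | h
    · exact h ⟨hy, hyn⟩
    · exact absurd ht1 (h ht3)
  · have hyn' : inner ℝ (-n) (y - x) < 0 := by rw [inner_neg_left]; linarith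
    rcases subset_interior_or_subset_compl hT (convex_halfBall (-n) x r).isPreconnected
      (fun y hy h => by
        have := hy.2.ne
        rw [inner_neg_left, hfrE y hy.1 h] at this
        simp at this) with h | h
    · exact absurd (interior_subset (h ht4)) ht2
    · exact h ⟨hy, hyn'⟩

theorem surf_lt_top {d : ℕ} {e : Set (Euc d)} (he : IsCompact e) {n : Euc d} (hn : ‖n‖ = 1)
    (horth : ∀ x ∈ e, ∀ y ∈ e, inner ℝ n (x - y) = 0) : surf d e < ⊤ := by
  rcases e.eq_empty_or_nonempty with rfl | ⟨x₀, hx₀⟩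
  · simp
  have hsub : e ⊆ {x | inner ℝ n (x - x₀) = 0} := fun x hx => horth x hx x₀ hx₀
  have h1 : surf d e = (surf d).restrict {x | inner ℝ n (x - x₀) = 0} e := by
    rw [Measure.restrict_apply he.measurableSet, Set.inter_eq_left.2 hsub]
  rw [h1, ← map_perp_eq_surf hn, Measure.map_apply (by fun_prop) he.measurableSet]
  have hi : Isometry (fun z : Perp n => x₀ + (z : Euc d)) :=
    (isometry_add_left x₀).comp isometry_subtype_coe
  exact (hi.isClosedEmbedding.isCompact_preimage he).measure_lt_top

theorem volume_hyperplane {d : ℕ} {n : Euc d} (hn : ‖n‖ = 1) (x₀ : Euc d) :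
    volume {x : Euc d | inner ℝ n (x - x₀) = 0} = 0 := by
  have hm : MeasurableSet {x : Euc d | inner ℝ n (x - x₀) = 0} :=
    (isClosed_singleton.preimage
      (by fun_prop : Continuous fun x : Euc d => (inner ℝ n (x - x₀) : ℝ))).measurableSet
  have hn1 : inner ℝ n n = (1 : ℝ) := by rw [real_inner_self_eq_norm_sq, hn]; simp
  rw [← lintegral_indicator_one hm, lintegral_eq_perp hn x₀ (measurable_one.indicator hm),
    lintegral_eq_zero_iff']
  · have h0 : ({0} : Set ℝ)ᶜ ∈ ae (volume : Measure ℝ) := compl_mem_ae_iff.2 (by simp)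
    filter_upwards [h0] with s hs
    have : ∀ z : Perp n, ({x : Euc d | inner ℝ n (x - x₀) = 0}.indicator 1
        (x₀ + s • n + (z : Euc d)) : ENNReal) = 0 := by
      intro z
      refine Set.indicator_of_notMem ?_ _
      have hs' : s ≠ 0 := hs
      rw [Set.mem_ofPred_eq, show x₀ + s • n + (z : Euc d) - x₀ = s • n + z by abel,
        inner_add_right, inner_perp, inner_smul_right, hn1]
      simpa using hs'
    simp [this]
  · exact (((measurable_one.indicator hm).comp
      (measurePreserving_perp hn x₀).measurable).lintegral_prod_right').aemeasurable

/-- Almost every line in direction `ν` misses a hyperplane parallel to `ν`. -/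
theorem ae_line_notMem_hyperplane {d : ℕ} {n ν : Euc d} (hn : ‖n‖ = 1) (hν : ‖ν‖ = 1)
    (x₀ : Euc d) (h : inner ℝ n ν = 0) :
    ∀ᵐ z : Perp ν, inner ℝ n ((z : Euc d) - x₀) ≠ 0 := by
  have h1 : ∀ᵐ x : Euc d, inner ℝ n (x - x₀) ≠ 0 := by
    have := measure_eq_zero_iff_ae_notMem.1 (volume_hyperplane hn x₀)
    simpa using this
  have h2 := (measurePreserving_perp hν 0).quasiMeasurePreserving.ae h1
  have h3 := (Measure.measurePreserving_swap (μ := (volume : Measure (Perp ν)))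
    (ν := (volume : Measure ℝ))).quasiMeasurePreserving.ae h2
  have h4 := Measure.ae_ae_of_ae_prod h3
  filter_upwards [h4] with z hz
  obtain ⟨t, ht⟩ := hz.exists
  intro h0
  apply ht
  simp only [Prod.swap, zero_add]
  rw [add_sub_assoc, inner_add_right, h0, inner_smul_right, h]
  simp

theorem measure_frontier_eq_zero {d : ℕ} {ι : Type*} {T : Set (Euc d)} {𝓕 : Finset ι}
    {E : ι → Set (Euc d)} {N : ι → Euc d} (hN : ∀ i ∈ 𝓕, ‖N i‖ = 1)
    (horth : ∀ i ∈ 𝓕, ∀ x ∈ E i, ∀ y ∈ E i, inner ℝ (N i) (x - y) = 0)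
    (hfr : frontier T = ⋃ i ∈ 𝓕, E i) : volume (frontier T) = 0 := by
  rw [hfr]
  refine (measure_biUnion_null_iff 𝓕.countable_toSet).2 fun i hi => ?_
  rcases (E i).eq_empty_or_nonempty with h | ⟨x₀, hx₀⟩
  · rw [h]; simp
  · exact measure_mono_null (fun x hx => horth i hi x hx x₀ hx₀) (volume_hyperplane (hN i hi) x₀)

theorem ae_isRegularPoint {d : ℕ} {ι : Type*} {T : Set (Euc d)} {𝓕 : Finset ι}
    {E : ι → Set (Euc d)} (hE : ∀ i ∈ 𝓕, IsCompact (E i))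
    (hov : ∀ i ∈ 𝓕, ∀ j ∈ 𝓕, i ≠ j → surf d (E i ∩ E j) = 0)
    {N : ι → Euc d} (hN : ∀ i ∈ 𝓕, IsOutwardNormal T (E i) (N i)) {i : ι} (hi : i ∈ 𝓕) :
    ∀ᵐ x ∂(surf d), x ∈ E i → IsRegularPoint T 𝓕 E i (N i) x := by
  have h1 := (ae_restrict_iff' (hE i hi).measurableSet).1 (hN i hi).2.2
  have h2 : ∀ᵐ x ∂(surf d), ∀ j ∈ 𝓕, j ≠ i → x ∉ E i ∩ E j := by
    refine (Filter.eventually_all_finset _).2 fun j hj => ?_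
    by_cases hji : j = i
    · simp [hji]
    · filter_upwards [measure_eq_zero_iff_ae_notMem.1 (hov i hi j hj (Ne.symm hji))] with x hx _
      exact hx
  filter_upwards [h1, h2] with x hx1 hx2 hx
  exact ⟨hx, fun j hj hji hxj => hx2 j hj hji ⟨hx, hxj⟩, hx1 hx⟩

theorem integral_hit_indicator {d : ℕ} {n ν x₀ : Euc d} (hn : ‖n‖ = 1) (hν1 : ‖ν‖ = 1)
    (hν : inner ℝ n ν ≠ 0) {e : Set (Euc d)} (he : IsCompact e)
    (horth : ∀ x ∈ e, inner ℝ n (x - x₀) = 0) {F : Euc d → ℝ} (hF : Continuous F) :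
    Integrable (fun z : Perp ν => e.indicator F (hit n x₀ ν (z : Euc d))) ∧
    ∫ z : Perp ν, e.indicator F (hit n x₀ ν (z : Euc d)) =
      |inner ℝ n ν| * ∫ x in e, F x ∂(surf d) := by
  have hhit : Measurable (fun z : Perp ν => hit n x₀ ν (z : Euc d)) := by fun_prop
  have hind : Measurable (e.indicator F) := hF.measurable.indicator he.measurableSet
  have horth' : ∀ x ∈ e, ∀ y ∈ e, inner ℝ n (x - y) = 0 := by
    intro x hx y hy
    rw [← sub_sub_sub_cancel_right x y x₀, inner_sub_right, horth x hx, horth y hy, sub_zero]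
  have hsub : e ⊆ {x | inner ℝ n (x - x₀) = 0} := fun x hx => horth x hx
  have hfin : IntegrableOn F e (surf d) := by
    have : IsFiniteMeasure ((surf d).restrict e) :=
      ⟨by rw [Measure.restrict_apply_univ]; exact surf_lt_top he hn horth'⟩
    obtain ⟨C, hC⟩ := he.exists_bound_of_continuousOn hF.continuousOn
    refine Integrable.of_bound (C := C) hF.aestronglyMeasurable ?_
    exact (ae_restrict_iff' he.measurableSet).2 (Filter.Eventually.of_forall hC)
  have hint : Integrable (e.indicator F)
      (ENNReal.ofReal |inner ℝ n ν| • (surf d).restrict {x | inner ℝ n (x - x₀) = 0}) := by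
    refine Integrable.smul_measure ?_ ENNReal.ofReal_ne_top
    rw [integrable_indicator_iff he.measurableSet, IntegrableOn,
      Measure.restrict_restrict he.measurableSet, Set.inter_eq_left.2 hsub]
    exact hfin
  rw [← map_hit hn hν1 x₀ hν] at hint
  refine ⟨(integrable_map_measure hind.aestronglyMeasurable hhit.aemeasurable).1 hint, ?_⟩
  rw [← integral_map hhit.aemeasurable hind.aestronglyMeasurable, map_hit hn hν1 x₀ hν,
    integral_smul_measure, integral_indicator he.measurableSet,
    Measure.restrict_restrict he.measurableSet, Set.inter_eq_left.2 hsub,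
    ENNReal.toReal_ofReal (abs_nonneg _), smul_eq_mul]

theorem hit_apply {d : ℕ} {n x₀ ν : Euc d} (x : Euc d) :
    hit n x₀ ν x = x + (inner ℝ n (x₀ - x) / inner ℝ n ν) • ν := rfl

theorem eq_div_of_inner_eq_zero {d : ℕ} {n x₀ ν x : Euc d} {t : ℝ} (hν : inner ℝ n ν ≠ 0)
    (h : inner ℝ n (x + t • ν - x₀) = 0) : t = inner ℝ n (x₀ - x) / inner ℝ n ν := by
  rw [eq_div_iff hν]
  rw [inner_sub_right, inner_add_right, inner_smul_right] at h
  rw [inner_sub_right]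
  linarith

/-- Behaviour of a polytopal set along a line through a regular point of one of its faces. -/
theorem IsRegularPoint.eventually_line {d : ℕ} {ι : Type*} {T : Set (Euc d)} (hT : IsClosed T)
    {𝓕 : Finset ι} {E : ι → Set (Euc d)} (hE : ∀ i ∈ 𝓕, IsClosed (E i))
    (hfr : frontier T = ⋃ i ∈ 𝓕, E i) {i : ι} {n z ν : Euc d} {τ : ℝ} (hn : ‖n‖ = 1)
    (horth : ∀ x ∈ E i, ∀ y ∈ E i, inner ℝ n (x - y) = 0)
    (hx : IsRegularPoint T 𝓕 E i n (z + τ • ν)) :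
    (0 < inner ℝ n ν → (∀ᶠ s in 𝓝[<] τ, z + s • ν ∈ T) ∧ (∀ᶠ s in 𝓝[>] τ, z + s • ν ∉ T)) ∧
    (inner ℝ n ν < 0 → (∀ᶠ s in 𝓝[<] τ, z + s • ν ∉ T) ∧ (∀ᶠ s in 𝓝[>] τ, z + s • ν ∈ T)) := by
  obtain ⟨r, hr, hball⟩ := hx.exists_ball hT hE hfr hn horth
  have hc : Continuous fun s : ℝ => z + s • ν := by fun_prop
  have hnear : ∀ᶠ s in 𝓝 τ, z + s • ν ∈ Metric.ball (z + τ • ν) r :=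
    hc.continuousAt.eventually (Metric.ball_mem_nhds _ hr)
  have hin : ∀ s : ℝ, inner ℝ n (z + s • ν - (z + τ • ν)) = (s - τ) * inner ℝ n ν := by
    intro s
    rw [add_sub_add_left_eq_sub, ← sub_smul, inner_smul_right]
  refine ⟨fun h => ⟨?_, ?_⟩, fun h => ⟨?_, ?_⟩⟩
  · filter_upwards [hnear.filter_mono nhdsWithin_le_nhds, self_mem_nhdsWithin] with s hs hlt
    have hlt' : s < τ := hlt
    exact interior_subset ((hball _ hs).1 (by rw [hin]; nlinarith))
  · filter_upwards [hnear.filter_mono nhdsWithin_le_nhds, self_mem_nhdsWithin] with s hs hlt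
    have hlt' : τ < s := hlt
    exact (hball _ hs).2 (by rw [hin]; nlinarith)
  · filter_upwards [hnear.filter_mono nhdsWithin_le_nhds, self_mem_nhdsWithin] with s hs hlt
    have hlt' : s < τ := hlt
    exact (hball _ hs).2 (by rw [hin]; nlinarith)
  · filter_upwards [hnear.filter_mono nhdsWithin_le_nhds, self_mem_nhdsWithin] with s hs hlt
    have hlt' : τ < s := hlt
    exact interior_subset ((hball _ hs).1 (by rw [hin]; nlinarith))

/-- The divergence theorem for the vector field `F ν`, with a constant unit vector `ν`. -/
theorem integral_directional_deriv {d : ℕ} {ι : Type*} {T : Set (Euc d)} (hT : IsCompact T)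
    {𝓕 : Finset ι} {E : ι → Set (Euc d)} (hE : ∀ i ∈ 𝓕, IsCompact (E i))
    (hne : ∀ i ∈ 𝓕, (E i).Nonempty) (hfr : frontier T = ⋃ i ∈ 𝓕, E i)
    (hov : ∀ i ∈ 𝓕, ∀ j ∈ 𝓕, i ≠ j → surf d (E i ∩ E j) = 0)
    {N : ι → Euc d} (hN : ∀ i ∈ 𝓕, IsOutwardNormal T (E i) (N i))
    {ν : Euc d} (hν : ‖ν‖ = 1) {F F' : Euc d → ℝ} (hF : Continuous F) (hF' : Continuous F')
    (hder : ∀ x (t : ℝ), HasDerivAt (fun s => F (x + s • ν)) (F' (x + t • ν)) t) :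
    ∫ x in T, F' x = ∑ i ∈ 𝓕, ∫ x in E i, F x * inner ℝ (N i) ν ∂(surf d) := by
  classical
  choose! x₀ hx₀ using hne
  have hP : ∀ i ∈ 𝓕, ∀ x ∈ E i, inner ℝ (N i) (x - x₀ i) = 0 := fun i hi x hx =>
    (hN i hi).2.1 x hx _ (hx₀ i hi)
  -- Faces parallel to `ν` carry no flux of F ν; only the transversal ones are kept.
  let J : Finset ι := 𝓕.filter fun i => inner ℝ (N i) ν ≠ 0
  have hJ : ∀ {i}, i ∈ J → i ∈ 𝓕 ∧ inner ℝ (N i) ν ≠ 0 := fun h => Finset.mem_filter.1 h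
  let sg : ι → ℝ := fun i => if 0 < inner ℝ (N i) ν then 1 else -1
  let term : ι → Euc d → ℝ := fun i z => sg i * (E i).indicator F (hit (N i) (x₀ i) ν z)
  have hmp := measurePreserving_perp hν 0
  -- The hyperplanes of the parallel faces project onto null sets of ν^⊥, so almost every line
  -- avoids those faces altogether.
  have hmiss : ∀ᵐ z : Perp ν, ∀ i ∈ 𝓕, inner ℝ (N i) ν = 0 →
      inner ℝ (N i) ((z : Euc d) - x₀ i) ≠ 0 := by
    refine (Filter.eventually_all_finset _).2 fun i hi => ?_
    by_cases h : inner ℝ (N i) ν = 0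
    · filter_upwards [ae_line_notMem_hyperplane (hN i hi).1 hν (x₀ i) h] with z hz _ using hz
    · simp [h]
  -- Irregular points of a face are surface-null, and by `map_hit` a null set of a transversal face
  -- is met by almost no line.
  have hreg : ∀ᵐ z : Perp ν, ∀ i ∈ J, hit (N i) (x₀ i) ν (z : Euc d) ∈ E i →
      IsRegularPoint T 𝓕 E i (N i) (hit (N i) (x₀ i) ν (z : Euc d)) := by
    refine (Filter.eventually_all_finset _).2 fun i hi => ?_
    have h1 := ae_isRegularPoint hE hov hN (hJ hi).1
    have h2 : ∀ᵐ x ∂(ENNReal.ofReal |inner ℝ (N i) ν| •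
        (surf d).restrict {x | inner ℝ (N i) (x - x₀ i) = 0}),
        x ∈ E i → IsRegularPoint T 𝓕 E i (N i) x :=
      Measure.ae_smul_measure (ae_restrict_of_ae h1) _
    rw [← map_hit (hN i (hJ hi).1).1 hν (x₀ i) (hJ hi).2] at h2
    exact ae_of_ae_map (by fun_prop) h2
  obtain ⟨R, hR⟩ : ∃ R, ∀ x ∈ T, ‖x‖ ≤ R := hT.isBounded.exists_norm_le
  have hline : ∀ᵐ z : Perp ν, ∫ t : ℝ, T.indicator F' ((z : Euc d) + t • ν) =
      ∑ i ∈ J, term i (z : Euc d) := by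
    filter_upwards [hmiss, hreg] with z hz1 hz2
    let τ : ι → ℝ := fun i => inner ℝ (N i) (x₀ i - (z : Euc d)) / inner ℝ (N i) ν
    let I : Finset ι := J.filter fun i => hit (N i) (x₀ i) ν (z : Euc d) ∈ E i
    have hI : ∀ {i}, i ∈ I → i ∈ J ∧ (z : Euc d) + τ i • ν ∈ E i := fun h => Finset.mem_filter.1 h
    have hlc : Continuous fun s : ℝ => (z : Euc d) + s • ν := by fun_prop
    have hbd : {t : ℝ | (z : Euc d) + t • ν ∈ T} ⊆ Set.Icc (-R) R := by
      intro t ht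
      have h1 := hR _ ht
      have h2 : inner ℝ ν ((z : Euc d) + t • ν) = t := by
        rw [inner_add_right, inner_perp, inner_smul_right, real_inner_self_eq_norm_sq, hν]; simp
      have h3 := abs_real_inner_le_norm ν ((z : Euc d) + t • ν)
      rw [h2, hν, one_mul] at h3
      exact abs_le.1 (h3.trans h1)
    -- The end points are the parameters at which the line hits a transversal face. Two faces hit at
    -- the same parameter would share a point, contrary to regularity; away from all hits the line
    -- is off the frontier.
    have key := integral_deriv_eq_sum_endpoints {t : ℝ | (z : Euc d) + t • ν ∈ T} I τ sg
      (by
        intro i hi j hj hij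
        by_contra hne
        have h1 := hI (Finset.mem_coe.1 hi)
        have h2 := hI (Finset.mem_coe.1 hj)
        have h3 := (hz2 i h1.1 h1.2).2.1 j (hJ h2.1).1 (Ne.symm hne)
        apply h3
        rw [hit_apply]
        change (z : Euc d) + τ i • ν ∈ E j
        rw [hij]; exact h2.2)
      hbd
      (by
        intro t ht
        have hnf : (z : Euc d) + t • ν ∉ frontier T := by
          rw [hfr]
          simp only [Set.mem_iUnion, not_exists]
          intro i hi hmem
          by_cases hc : inner ℝ (N i) ν = 0
          · apply hz1 i hi hc
            have := hP i hi _ hmem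
            rwa [add_sub_right_comm, inner_add_right, inner_smul_right, hc, mul_zero,
              add_zero] at this
          · have htτ : t = τ i := eq_div_of_inner_eq_zero hc (hP i hi _ hmem)
            refine ht i (Finset.mem_filter.2 ⟨Finset.mem_filter.2 ⟨hi, hc⟩, ?_⟩) htτ.symm
            rw [htτ] at hmem
            exact hmem
        by_cases hmem : (z : Euc d) + t • ν ∈ T
        · left
          have hint : (z : Euc d) + t • ν ∈ interior T := by
            by_contra h
            exact hnf (by rw [hT.isClosed.frontier_eq]; exact ⟨hmem, h⟩)
          filter_upwards [hlc.continuousAt.eventually (isOpen_interior.mem_nhds hint)] with s hs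
          exact interior_subset hs
        · right
          filter_upwards [hlc.continuousAt.eventually (hT.isClosed.isOpen_compl.mem_nhds hmem)]
            with s hs
          exact hs)
      (by
        intro i hi
        have h1 := hI hi
        have h2 := (hJ h1.1)
        have h3 := (hz2 i h1.1 h1.2).eventually_line (z := (z : Euc d)) (ν := ν) (τ := τ i)
          hT.isClosed (fun i hi => (hE i hi).isClosed) hfr
          (hN i h2.1).1 (hN i h2.1).2.1
        rcases lt_or_gt_of_ne h2.2 with h | h
        · right
          refine ⟨by simp [sg, not_lt.2 h.le], h3.2 h⟩
        · left
          refine ⟨by simp [sg, h], h3.1 h⟩)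
      (F := fun s => F ((z : Euc d) + s • ν)) (F' := fun s => F' ((z : Euc d) + s • ν))
      (fun t => hder _ t) (by fun_prop)
    have e1 : ∀ t : ℝ, T.indicator F' ((z : Euc d) + t • ν) =
        {t : ℝ | (z : Euc d) + t • ν ∈ T}.indicator (fun s => F' ((z : Euc d) + s • ν)) t := by
      intro t
      by_cases h : (z : Euc d) + t • ν ∈ T
      · rw [Set.indicator_of_mem h, Set.indicator_of_mem (by exact h)]
      · rw [Set.indicator_of_notMem h, Set.indicator_of_notMem (by exact h)]
    simp_rw [e1]
    rw [key, Finset.sum_filter]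
    refine Finset.sum_congr rfl fun i hi => ?_
    by_cases h : hit (N i) (x₀ i) ν (z : Euc d) ∈ E i
    · simp only [term, if_pos h, Set.indicator_of_mem h]
      rfl
    · simp only [term, if_neg h, Set.indicator_of_notMem h, mul_zero]
  have hintT : Integrable (T.indicator F') := by
    rw [integrable_indicator_iff hT.measurableSet]
    exact hF'.continuousOn.integrableOn_compact hT
  have hint2 : Integrable (fun p : ℝ × Perp ν => T.indicator F' (0 + p.1 • ν + (p.2 : Euc d)))
      (volume.prod volume) := (hmp.integrable_comp hintT.aestronglyMeasurable).2 hintT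
  have hemb : MeasurableEmbedding fun p : ℝ × Perp ν => 0 + p.1 • ν + (p.2 : Euc d) := by
    refine Measurable.measurableEmbedding hmp.measurable ?_
    rintro ⟨s, z⟩ ⟨s', z'⟩ h
    have h' : 0 + s • ν + (z : Euc d) = 0 + s' • ν + (z' : Euc d) := h
    have h1 := congrArg (fun y => (inner ℝ ν y : ℝ)) h'
    simp only [inner_add_right, inner_smul_right, inner_perp, real_inner_self_eq_norm_sq, hν] at h1
    have hs : s = s' := by simpa using h1
    subst hs
    have hz : z = z' := by simpa using h'
    rw [hz]
  rw [← integral_indicator hT.measurableSet, ← hmp.integral_comp hemb,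
    integral_prod_symm _ hint2]
  have e2 : ∀ᵐ z : Perp ν, ∫ t : ℝ, T.indicator F' (0 + t • ν + (z : Euc d)) =
      ∑ i ∈ J, term i (z : Euc d) := by
    filter_upwards [hline] with z hz
    rw [← hz]
    refine integral_congr_ae (Filter.Eventually.of_forall fun t => ?_)
    change T.indicator F' (0 + t • ν + (z : Euc d)) = T.indicator F' ((z : Euc d) + t • ν)
    rw [zero_add, add_comm (t • ν)]
  rw [integral_congr_ae e2, integral_finsetSum]
  · rw [← Finset.sum_subset (Finset.filter_subset _ 𝓕 : J ⊆ 𝓕)]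
    · refine Finset.sum_congr rfl fun i hi => ?_
      have h2 := (hJ hi)
      simp only [term]
      rw [integral_const_mul, (integral_hit_indicator (hN i h2.1).1 hν h2.2 (hE i h2.1)
        (hP i h2.1) hF).2, integral_mul_const, ← mul_assoc, mul_comm]
      congr 1
      -- The sign of the end point times the projection factor |⟨N i, ν⟩| restores ⟨N i, ν⟩.
      rcases lt_or_gt_of_ne h2.2 with h | h
      · simp [sg, not_lt.2 h.le, abs_of_neg h]
      · simp [sg, h, abs_of_pos h]
    · intro i hi hiJ
      have : inner ℝ (N i) ν = 0 := by
        by_contra h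
        exact hiJ (Finset.mem_filter.2 ⟨hi, h⟩)
      simp [this]
  · intro i hi
    have h2 := (hJ hi)
    exact (integral_hit_indicator (hN i h2.1).1 hν h2.2 (hE i h2.1) (hP i h2.1) hF).1.const_mul _

end WG

namespace WG

/-! ### Flat faces -/

open Filter Topology

theorem IsFlatFace.nonempty {d : ℕ} {e : Set (Euc d)} (h : IsFlatFace e) : e.Nonempty := h.1.1

theorem IsFlatFace.isCompact {d : ℕ} {e : Set (Euc d)} (h : IsFlatFace e) : IsCompact e := by
  obtain ⟨F, hF, -, rfl⟩ := h.2.1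
  exact hF.isCompact_biUnion fun s _ => (Set.finite_range s).isCompact_convexHull ℝ

theorem IsFlatFace.exists_unit_normal {d : ℕ} {e : Set (Euc d)} (h : IsFlatFace e) :
    ∃ n : Euc d, ‖n‖ = 1 ∧ ∀ x ∈ e, ∀ y ∈ e, inner ℝ n (x - y) = 0 := by
  obtain ⟨n, hn, ho⟩ := h.2.2
  refine ⟨‖n‖⁻¹ • n, by simp [norm_smul, hn], fun x hx y hy => ?_⟩
  rw [inner_smul_left, ho x hx y hy, mul_zero]

theorem IsFlatFace.surf_lt_top {d : ℕ} {e : Set (Euc d)} (h : IsFlatFace e) :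
    surf d e < ⊤ := by
  obtain ⟨n, hn, ho⟩ := h.exists_unit_normal
  exact WG.surf_lt_top h.isCompact hn ho

theorem surf_eq_volume_perp {d : ℕ} {e : Set (Euc d)} (he : MeasurableSet e) {n x₀ : Euc d}
    (hn : ‖n‖ = 1) (ho : ∀ x ∈ e, inner ℝ n (x - x₀) = 0) :
    surf d e = volume ((fun z : Perp n => x₀ + (z : Euc d)) ⁻¹' e) := by
  have hsub : e ⊆ {x | inner ℝ n (x - x₀) = 0} := fun x hx => ho x hx
  have h1 : surf d e = (surf d).restrict {x | inner ℝ n (x - x₀) = 0} e := by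
    rw [Measure.restrict_apply he, Set.inter_eq_left.2 hsub]
  rw [h1, ← map_perp_eq_surf hn, Measure.map_apply (by fun_prop) he]

/-- Every point of a flat face lies in its surface-measure support. -/
theorem IsFlatFace.surf_inter_ball_pos {d : ℕ} (hd : 1 ≤ d) {e : Set (Euc d)}
    (h : IsFlatFace e) {x : Euc d} (hx : x ∈ e) {r : ℝ} (hr : 0 < r) :
    0 < surf d (e ∩ Metric.ball x r) := by
  obtain ⟨n, hn, ho⟩ := h.exists_unit_normal
  have hm := h.isCompact.measurableSet
  obtain ⟨F, hF, hind, heq⟩ := h.2.1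
  obtain ⟨s, hs, hxs⟩ : ∃ s ∈ F, x ∈ convexHull ℝ (Set.range s) := by
    rw [heq] at hx; simpa using hx
  have hse : convexHull ℝ (Set.range s) ⊆ e := by
    rw [heq]; exact Set.subset_biUnion_of_mem (u := fun s => convexHull ℝ (Set.range s)) hs
  have hsi : ∀ i, s i ∈ e := fun i => hse (subset_convexHull ℝ _ ⟨i, rfl⟩)
  rw [surf_eq_volume_perp (hm.inter measurableSet_ball) hn (x₀ := x)
    (fun y hy => ho y hy.1 x hx)]
  let f : Perp n →ᵃ[ℝ] Euc d :=
    { toFun := fun z => x + (z : Euc d)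
      linear := (Perp n).subtype
      map_vadd' := fun p v => by simp; abel }
  have hf : ∀ z, f z = x + (z : Euc d) := fun z => rfl
  -- Moved into n^⊥, which has dimension d − 1, the d affinely independent vertices span affinely,
  -- so the simplex has interior. By convexity it lies in the closure of that interior, which
  -- therefore meets every ball about `x`.
  let s' : Fin d → Perp n := fun i =>
    ⟨s i - x, Submodule.mem_orthogonal_singleton_iff_inner_right.2 (ho _ (hsi i) x hx)⟩
  have hfs : f ∘ s' = s := by
    funext i; simp [hf, s']
  have hind' : AffineIndependent ℝ s' := AffineIndependent.of_comp f (by rw [hfs]; exact hind s hs)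
  have hspan : affineSpan ℝ (Set.range s') = ⊤ := by
    rw [hind'.affineSpan_eq_top_iff_card_eq_finrank_add_one, finrank_perp hn, Fintype.card_fin]
    omega
  have himg : f '' convexHull ℝ (Set.range s') = convexHull ℝ (Set.range s) := by
    rw [AffineMap.image_convexHull, ← Set.range_comp, hfs]
  have hK : (interior (convexHull ℝ (Set.range s'))).Nonempty :=
    interior_convexHull_nonempty_iff_affineSpan_eq_top.2 hspan
  have h0 : (0 : Perp n) ∈ closure (interior (convexHull ℝ (Set.range s'))) := by
    rw [(convex_convexHull ℝ _).closure_interior_eq_closure_of_nonempty_interior hK]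
    apply subset_closure
    rw [← himg] at hxs
    obtain ⟨z, hz, hzx⟩ := hxs
    have : z = 0 := by
      have : x + (z : Euc d) = x := hzx
      simpa using this
    rwa [← this]
  have hne := mem_closure_iff.1 h0 (Metric.ball 0 r) Metric.isOpen_ball (Metric.mem_ball_self hr)
  refine lt_of_lt_of_le ((Metric.isOpen_ball.inter isOpen_interior).measure_pos volume hne)
    (measure_mono ?_)
  rintro z ⟨hz1, hz2⟩
  refine ⟨hse ?_, ?_⟩
  · rw [← himg]
    exact ⟨z, interior_subset hz2, rfl⟩
  · simpa using hz1

theorem IsFlatFace.surf_pos {d : ℕ} (hd : 1 ≤ d) {e : Set (Euc d)} (h : IsFlatFace e) :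
    0 < surf d e := by
  obtain ⟨x, hx⟩ := h.nonempty
  exact (h.surf_inter_ball_pos hd hx one_pos).trans_le (measure_mono Set.inter_subset_left)

theorem IsFlatFace.eqOn_zero_of_ae {d : ℕ} (hd : 1 ≤ d) {e : Set (Euc d)} (h : IsFlatFace e)
    {F : Euc d → ℝ} (hF : Continuous F) (h0 : ∀ᵐ x ∂(surf d).restrict e, F x = 0) :
    ∀ x ∈ e, F x = 0 := by
  intro x hx
  by_contra hne
  obtain ⟨r, hr, hball⟩ := Metric.isOpen_iff.1 (isOpen_ne.preimage hF) x hne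
  have h1 := h.surf_inter_ball_pos hd hx hr
  rw [ae_restrict_iff' h.isCompact.measurableSet] at h0
  refine h1.ne' (measure_mono_null ?_ h0)
  rintro y ⟨hy1, hy2⟩ hy
  exact hball hy2 (hy hy1)

/-! ### Elements of a mesh -/

section Mesh

variable {d : ℕ} {Ω : Set (Euc d)} (M : PolytopalMesh Ω)

theorem IsElement.isCompact {T : Set (Euc d)} (h : IsElement T) : IsCompact T := by
  rw [← h.2.1]
  exact h.1.2.2.1.isCompact_closure

theorem IsElement.interior_nonempty {T : Set (Euc d)} (h : IsElement T) :
    (interior T).Nonempty := h.1.2.1.1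

theorem IsElement.diam_pos (hd : 1 ≤ d) {T : Set (Euc d)} (h : IsElement T) :
    0 < Metric.diam T := by
  obtain ⟨x, hx⟩ := h.interior_nonempty
  obtain ⟨r, hr, hb⟩ := Metric.isOpen_iff.1 isOpen_interior x hx
  let v : Euc d := EuclideanSpace.single ⟨0, hd⟩ (r / 2)
  have hv : ‖v‖ = r / 2 := by simp [v, abs_of_pos hr]
  have hy : x + v ∈ T := interior_subset (hb (by simp [hv]; linarith))
  have := Metric.dist_le_diam_of_mem h.isCompact.isBounded hy (interior_subset hx)
  rw [dist_eq_norm, add_sub_cancel_left, hv] at this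
  linarith

namespace PolytopalMesh

theorem isElement' (T : M.cells) : IsElement (T : Set (Euc d)) := M.isElement T T.2

theorem isFlatFace' (e : M.faces) : IsFlatFace (e : Set (Euc d)) := M.isFlatFace e e.2

theorem mem_facesOf {T : M.cells} {e : M.faces} :
    e ∈ M.facesOf T ↔ (e : Set (Euc d)) ⊆ frontier (T : Set (Euc d)) := by
  simp [facesOf]

theorem isCompact_cell (T : M.cells) : IsCompact (T : Set (Euc d)) := (M.isElement' T).isCompact

theorem isCompact_face (e : M.faces) : IsCompact (e : Set (Euc d)) := (M.isFlatFace' e).isCompact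

theorem frontier_eq (T : M.cells) :
    frontier (T : Set (Euc d)) = ⋃ e ∈ M.facesOf T, (e : Set (Euc d)) := by
  rw [M.frontier_cell T T.2]
  ext x
  simp only [Set.mem_iUnion, mem_facesOf]
  constructor
  · rintro ⟨e, ⟨he, hs⟩, hx⟩
    exact ⟨⟨e, he⟩, hs, hx⟩
  · rintro ⟨e, hs, hx⟩
    exact ⟨e, ⟨e.2, hs⟩, hx⟩

theorem overlap (e e' : M.faces) (h : e ≠ e') :
    surf d ((e : Set (Euc d)) ∩ (e' : Set (Euc d))) = 0 :=
  M.faces_overlap e e.2 e' e'.2 (fun h' => h (Subtype.ext h'))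

theorem isOutwardNormal {T : M.cells} {e : M.faces} (h : e ∈ M.facesOf T) :
    IsOutwardNormal (T : Set (Euc d)) e (outwardNormal (T : Set (Euc d)) e) :=
  Classical.epsilon_spec (M.exists_normal T T.2 e e.2 (M.mem_facesOf.1 h))

theorem volume_frontier (T : M.cells) : volume (frontier (T : Set (Euc d))) = 0 :=
  measure_frontier_eq_zero (fun _ h => (M.isOutwardNormal h).1)
    (fun _ h => (M.isOutwardNormal h).2.1) (M.frontier_eq T)

theorem cell_subset (T : M.cells) : (T : Set (Euc d)) ⊆ closure Ω := by
  rw [← M.cover]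
  exact Set.subset_biUnion_of_mem (u := fun T : Set (Euc d) => T) T.2

theorem aedisjoint (T T' : M.cells) (h : T ≠ T') :
    AEDisjoint volume (T : Set (Euc d)) (T' : Set (Euc d)) := by
  refine measure_mono_null ?_ (measure_union_null (M.volume_frontier T) (M.volume_frontier T'))
  rintro x ⟨hx, hx'⟩
  rw [(M.isCompact_cell T).isClosed.frontier_eq, (M.isCompact_cell T').isClosed.frontier_eq]
  by_contra hc
  simp only [Set.mem_union, Set.mem_sdiff, not_or, not_and, not_not] at hc
  have h1 := M.disjoint_interior T T.2 T' T'.2 (fun h' => h (Subtype.ext h'))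
  exact Set.eq_empty_iff_forall_notMem.1 h1 x ⟨hc.1 hx, hc.2 hx'⟩

theorem volume_frontier_domain (M : PolytopalMesh Ω) : volume (frontier Ω) = 0 := by
  rw [M.frontier_domain]
  have hf : {e | e ∈ M.faces ∧ e ⊆ frontier Ω}.Finite :=
    M.faces.finite_toSet.subset fun e he => he.1
  refine (measure_biUnion_null_iff hf.countable).2 fun e he => ?_
  obtain ⟨n, hn, ho⟩ := (M.isFlatFace e he.1).exists_unit_normal
  obtain ⟨x₀, hx₀⟩ := (M.isFlatFace e he.1).nonempty
  exact measure_mono_null (fun x hx => ho x hx x₀ hx₀) (volume_hyperplane hn x₀)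

theorem closure_ae_eq (M : PolytopalMesh Ω) : (closure Ω : Set (Euc d)) =ᵐ[volume] Ω := by
  have h : closure Ω = Ω ∪ frontier Ω := closure_eq_self_union_frontier Ω
  rw [h]
  have h2 := (ae_eq_empty (μ := volume)).2 M.volume_frontier_domain
  simpa using (ae_eq_refl (μ := (volume : Measure (Euc d))) Ω).union h2

/-- The coefficient is controlled only on Ω, while the elements cover its closure. The boundary is
null, so nothing is lost under the integral. -/
theorem ae_mem_domain (T : M.cells) :
    ∀ᵐ x ∂volume.restrict (T : Set (Euc d)), x ∈ Ω := by
  rw [ae_restrict_iff' (M.isCompact_cell T).measurableSet]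
  filter_upwards [(M.closure_ae_eq).mem_iff] with x hx hxT
  exact hx.1 (M.cell_subset T hxT)

theorem restrict_cell_le (T : M.cells) :
    volume.restrict (T : Set (Euc d)) ≤ volume.restrict Ω := by
  rw [← Measure.restrict_congr_set (M.closure_ae_eq)]
  exact Measure.restrict_mono (M.cell_subset T) le_rfl

theorem integral_domain {f : Euc d → ℝ} (hf : IntegrableOn f Ω) :
    ∫ x in Ω, f x = ∑ T : M.cells, ∫ x in (T : Set (Euc d)), f x := by
  have hc : (⋃ T : M.cells, (T : Set (Euc d))) = closure Ω := by
    rw [← M.cover]; ext x; simp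
  have hf' : IntegrableOn f (closure Ω) := hf.congr_set_ae (M.closure_ae_eq)
  rw [← setIntegral_congr_set (M.closure_ae_eq), ← hc,
    integral_iUnion_ae (fun T => (M.isCompact_cell T).measurableSet.nullMeasurableSet)
      (fun T T' h => M.aedisjoint T T' h) (by rw [hc]; exact hf'), tsum_fintype]

end PolytopalMesh

end Mesh

end WG

/-! ### Neighbouring elements across a face and cancellation of fluxes -/

namespace WG
open Filter Topology

section Mesh

variable {d : ℕ} {Ω : Set (Euc d)} (M : PolytopalMesh Ω)

namespace PolytopalMesh

theorem isRegularPoint_ball {T : M.cells} {e : M.faces} (he : e ∈ M.facesOf T) {x : Euc d}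
    (hx : IsRegularPoint (T : Set (Euc d)) (M.facesOf T) (fun e : M.faces => (e : Set (Euc d))) e
      (outwardNormal (T : Set (Euc d)) e) x) :
    ∃ r > 0, ∀ y ∈ Metric.ball x r,
      (inner ℝ (outwardNormal (T : Set (Euc d)) e) (y - x) < 0 → y ∈ interior (T : Set (Euc d))) ∧
      (0 < inner ℝ (outwardNormal (T : Set (Euc d)) e) (y - x) → y ∉ (T : Set (Euc d))) :=
  hx.exists_ball (M.isCompact_cell T).isClosed (fun e _ => (M.isCompact_face e).isClosed)
    (M.frontier_eq T) (M.isOutwardNormal he).1 (M.isOutwardNormal he).2.1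

/-- A face has positive area, whereas each of the finitely many exceptional sets is surface-null.
One point can thus serve all elements adjacent to `e` at once. -/
theorem exists_regular_point (hd : 1 ≤ d) (e : M.faces) :
    ∃ x ∈ (e : Set (Euc d)), (∀ e' : M.faces, e' ≠ e → x ∉ (e' : Set (Euc d))) ∧
      ∀ T : M.cells, e ∈ M.facesOf T →
        IsRegularPoint (T : Set (Euc d)) (M.facesOf T) (fun e : M.faces => (e : Set (Euc d))) e
          (outwardNormal (T : Set (Euc d)) e) x := by
  have h1 : ∀ᵐ x ∂(surf d), ∀ e' : M.faces, e' ≠ e → x ∉ (e : Set (Euc d)) ∩ e' := by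
    rw [ae_all_iff]
    intro e'
    by_cases h : e' = e
    · simp [h]
    · filter_upwards [measure_eq_zero_iff_ae_notMem.1 (M.overlap e e' (Ne.symm h))] with x hx _ using hx
  have h2 : ∀ᵐ x ∂(surf d), ∀ T : M.cells, e ∈ M.facesOf T → x ∈ (e : Set (Euc d)) →
      IsRegularPoint (T : Set (Euc d)) (M.facesOf T) (fun e : M.faces => (e : Set (Euc d))) e
          (outwardNormal (T : Set (Euc d)) e) x := by
    rw [ae_all_iff]
    intro T
    by_cases h : e ∈ M.facesOf T
    · have := ae_isRegularPoint (E := fun e : M.faces => (e : Set (Euc d)))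
        (fun e _ => M.isCompact_face e) (fun i _ j _ hij => M.overlap i j hij)
        (N := fun e => outwardNormal (T : Set (Euc d)) e) (fun e he => M.isOutwardNormal he) h
      filter_upwards [this] with x hx _ using hx
    · simp [h]
  have h3 : ∃ᵐ x ∂(surf d), x ∈ (e : Set (Euc d)) := by
    rw [frequently_ae_mem_iff]
    exact ((M.isFlatFace' e).surf_pos hd).ne'
  obtain ⟨x, hx, hx1, hx2⟩ := (h3.and_eventually (h1.and h2)).exists
  exact ⟨x, hx, fun e' h h' => hx1 e' h ⟨hx, h'⟩, fun T hT => hx2 T hT hx⟩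

/-- Two elements sharing a face have opposite normals there. -/
theorem outwardNormal_eq_neg {T T' : M.cells} (hTT : T ≠ T') {e : M.faces}
    (he : e ∈ M.facesOf T) (he' : e ∈ M.facesOf T') {x : Euc d}
    (hx : ∀ T : M.cells, e ∈ M.facesOf T →
        IsRegularPoint (T : Set (Euc d)) (M.facesOf T) (fun e : M.faces => (e : Set (Euc d))) e
          (outwardNormal (T : Set (Euc d)) e) x) :
    outwardNormal (T' : Set (Euc d)) e = -outwardNormal (T : Set (Euc d)) e := by
  obtain ⟨r, hr, hb⟩ := M.isRegularPoint_ball he (hx T he)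
  obtain ⟨r', hr', hb'⟩ := M.isRegularPoint_ball he' (hx T' he')
  have hn := (M.isOutwardNormal he).1
  have hn' := (M.isOutwardNormal he').1
  set n := outwardNormal (T : Set (Euc d)) e
  set n' := outwardNormal (T' : Set (Euc d)) e
  by_contra hne
  have h0 : n + n' ≠ 0 := fun h => hne (eq_neg_of_add_eq_zero_right h)
  -- The quantity is ‖n + n'‖²/2. If it is positive, a small step from `x` along −(n + n') goes
  -- strictly inwards for both elements, contradicting the disjointness of their interiors.
  have hpos : 0 < 1 + inner ℝ n n' := by
    have h1 : ‖n + n'‖ ^ 2 = 2 * (1 + inner ℝ n n') := by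
      rw [norm_add_sq_real, hn, hn']; ring
    have h2 : 0 < ‖n + n'‖ ^ 2 := by positivity
    linarith
  have hlim : ∀ᶠ t : ℝ in 𝓝[>] 0, x - t • (n + n') ∈ Metric.ball x (min r r') := by
    have hc : Continuous fun t : ℝ => x - t • (n + n') := by fun_prop
    have := (hc.continuousAt (x := 0)).eventually
      (Metric.ball_mem_nhds (x - (0 : ℝ) • (n + n')) (lt_min hr hr'))
    simp only [zero_smul, sub_zero] at this
    exact this.filter_mono nhdsWithin_le_nhds
  obtain ⟨t, ht, ht0⟩ := (hlim.and self_mem_nhdsWithin).exists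
  have ht0' : 0 < t := ht0
  have i1 : inner ℝ n (x - t • (n + n') - x) < 0 := by
    have : x - t • (n + n') - x = -(t • (n + n')) := by abel
    rw [this, inner_neg_right, inner_smul_right, inner_add_right, real_inner_self_eq_norm_sq, hn]
    nlinarith
  have i2 : inner ℝ n' (x - t • (n + n') - x) < 0 := by
    have : x - t • (n + n') - x = -(t • (n + n')) := by abel
    rw [this, inner_neg_right, inner_smul_right, inner_add_right, real_inner_self_eq_norm_sq, hn',
      real_inner_comm]
    nlinarith
  have h1 := M.disjoint_interior T T.2 T' T'.2 (fun h' => hTT (Subtype.ext h'))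
  exact Set.eq_empty_iff_forall_notMem.1 h1 _
    ⟨(hb _ (Metric.ball_subset_ball (min_le_left _ _) ht)).1 i1,
      (hb' _ (Metric.ball_subset_ball (min_le_right _ _) ht)).1 i2⟩

/-- An interior face is shared by a second element. -/
theorem exists_neighbour {T : M.cells} {e : M.faces} (he : e ∈ M.facesOf T)
    (hΩ : ¬ (e : Set (Euc d)) ⊆ frontier Ω) {x : Euc d} (hxe : x ∈ (e : Set (Euc d)))
    (hxo : ∀ e' : M.faces, e' ≠ e → x ∉ (e' : Set (Euc d)))
    (hΩo : IsOpen Ω)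
    (hx : IsRegularPoint (T : Set (Euc d)) (M.facesOf T) (fun e : M.faces => (e : Set (Euc d))) e
          (outwardNormal (T : Set (Euc d)) e) x) :
    ∃ T' : M.cells, T' ≠ T ∧ e ∈ M.facesOf T' := by
  classical
  have hxT : x ∈ (T : Set (Euc d)) :=
    (M.isCompact_cell T).isClosed.frontier_subset (M.mem_facesOf.1 he hxe)
  -- If `x` were on ∂Ω, it would lie on some boundary face; since `x` belongs to no face but `e`,
  -- that face would be `e` itself.
  have hxΩ : x ∈ Ω := by
    by_contra h
    have hxf : x ∈ frontier Ω := by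
      rw [hΩo.frontier_eq]; exact ⟨M.cell_subset T hxT, h⟩
    rw [M.frontier_domain] at hxf
    simp only [Set.mem_iUnion] at hxf
    obtain ⟨e', he', hxe'⟩ := hxf
    have : (⟨e', he'.1⟩ : M.faces) = e := by
      by_contra hne
      exact hxo _ hne hxe'
    rw [← this] at hΩ
    exact hΩ he'.2
  have hcl : IsClosed (⋃ T' ∈ (Finset.univ.erase T : Finset M.cells), (T' : Set (Euc d))) :=
    Set.Finite.isClosed_biUnion (Finset.finite_toSet _)
      (fun T' _ => (M.isCompact_cell T').isClosed)
  have hc : Continuous fun t : ℝ => x + t • outwardNormal (T : Set (Euc d)) e := by fun_prop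
  -- Points just beyond `e` stay in Ω but leave `T`, so the other elements cover them. The finite
  -- union of these elements is closed and therefore contains the limit `x`.
  have hmem : ∀ᶠ t : ℝ in 𝓝[>] 0, x + t • outwardNormal (T : Set (Euc d)) e ∈
      ⋃ T' ∈ (Finset.univ.erase T : Finset M.cells), (T' : Set (Euc d)) := by
    have h1 : ∀ᶠ t : ℝ in 𝓝 0, x + t • outwardNormal (T : Set (Euc d)) e ∈ Ω :=
      hc.continuousAt.eventually (hΩo.mem_nhds (by simpa using hxΩ))
    filter_upwards [h1.filter_mono nhdsWithin_le_nhds, hx.2.2] with t ht ht'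
    have h2 := subset_closure ht
    rw [← M.cover] at h2
    simp only [Set.mem_iUnion] at h2 ⊢
    obtain ⟨T', hT', h3⟩ := h2
    refine ⟨⟨T', hT'⟩, Finset.mem_erase.2 ⟨fun h => ht'.2 ?_, Finset.mem_univ _⟩, h3⟩
    exact (congrArg Subtype.val h).subset h3
  have hlim : Tendsto (fun t : ℝ => x + t • outwardNormal (T : Set (Euc d)) e) (𝓝[>] 0) (𝓝 x) := by
    have := hc.tendsto 0
    simp only [zero_smul, add_zero] at this
    exact this.mono_left nhdsWithin_le_nhds
  have hxU := hcl.mem_of_tendsto hlim hmem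
  simp only [Set.mem_iUnion] at hxU
  obtain ⟨T', hT', hxT'⟩ := hxU
  have hne := Finset.ne_of_mem_erase hT'
  -- `T` is the closure of its interior, so an open set about `x` inside `T'` would meet the
  -- interior of `T`.
  have hxint : x ∉ interior (T' : Set (Euc d)) := by
    intro h
    rw [← (M.isElement' T).2.1] at hxT
    obtain ⟨y, hy1, hy2⟩ := mem_closure_iff.1 hxT _ isOpen_interior h
    have h1 := M.disjoint_interior T T.2 T' T'.2 (fun h' => hne (Subtype.ext h'.symm))
    exact Set.eq_empty_iff_forall_notMem.1 h1 y ⟨hy2, hy1⟩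
  have hxf : x ∈ frontier (T' : Set (Euc d)) := by
    rw [(M.isCompact_cell T').isClosed.frontier_eq]; exact ⟨hxT', hxint⟩
  rw [M.frontier_eq T'] at hxf
  simp only [Set.mem_iUnion] at hxf
  obtain ⟨e', he', hxe'⟩ := hxf
  have : e' = e := by
    by_contra hne
    exact hxo _ hne hxe'
  exact ⟨T', hne, this ▸ he'⟩

open Classical in
/-- The outward normals of the elements sharing an interior face cancel. -/
theorem sum_outwardNormal (hd : 1 ≤ d) (hΩo : IsOpen Ω) (e : M.faces)
    (hΩ : ¬ (e : Set (Euc d)) ⊆ frontier Ω) :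
    ∑ T : M.cells with e ∈ M.facesOf T, outwardNormal (T : Set (Euc d)) e = 0 := by
  obtain ⟨x, hxe, hxo, hx⟩ := M.exists_regular_point hd e
  obtain ⟨T₀, hT₀, he₀⟩ := M.face_of_cell e e.2
  have he : e ∈ M.facesOf ⟨T₀, hT₀⟩ := M.mem_facesOf.2 he₀
  obtain ⟨T', hne, he'⟩ := M.exists_neighbour he hΩ hxe hxo hΩo (hx _ he)
  set T : M.cells := ⟨T₀, hT₀⟩
  have hset : (Finset.univ.filter fun T : M.cells => e ∈ M.facesOf T) = {T, T'} := by
    ext S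
    simp only [Finset.mem_filter, Finset.mem_univ, true_and, Finset.mem_insert,
      Finset.mem_singleton]
    constructor
    · intro hS
      by_contra hcon
      push Not at hcon
      -- Three elements on one face would have pairwise opposite unit normals, which forces a normal
      -- to equal its own negative.
      have h1 := M.outwardNormal_eq_neg hne.symm he he' hx
      have h2 := M.outwardNormal_eq_neg (Ne.symm hcon.1) he hS hx
      have h3 := M.outwardNormal_eq_neg (Ne.symm hcon.2) he' hS hx
      rw [h1, neg_neg, h2] at h3
      have h4 := (M.isOutwardNormal he).1
      have h5 : outwardNormal (T : Set (Euc d)) e = 0 := by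
        have h6 : (2 : ℝ) • outwardNormal (T : Set (Euc d)) e = 0 := by
          rw [two_smul]; nth_rewrite 1 [← h3]; exact neg_add_cancel _
        simpa using h6
      rw [h5] at h4
      simp at h4
    · rintro (rfl | rfl)
      · exact he
      · exact he'
  rw [hset, Finset.sum_pair hne.symm, M.outwardNormal_eq_neg hne.symm he he' hx, add_neg_cancel]

/-- Fluxes of single-valued functions vanishing on the boundary cancel. -/
theorem sum_flux_eq_zero (hd : 1 ≤ d) (hΩo : IsOpen Ω) (G : M.faces → Euc d → ℝ)
    (hG : ∀ e : M.faces, (e : Set (Euc d)) ⊆ frontier Ω → ∀ x ∈ (e : Set (Euc d)), G e x = 0)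
    (i : Fin d) :
    ∑ T : M.cells, ∑ e ∈ M.facesOf T, ∫ x in (e : Set (Euc d)),
      G e x * outwardNormal (T : Set (Euc d)) e i ∂(surf d) = 0 := by
  classical
  rw [Finset.sum_comm' (t' := Finset.univ)
    (s' := fun e => Finset.univ.filter fun T : M.cells => e ∈ M.facesOf T) (by simp)]
  refine Finset.sum_eq_zero fun e _ => ?_
  simp_rw [integral_mul_const]
  rw [← Finset.mul_sum]
  by_cases h : (e : Set (Euc d)) ⊆ frontier Ω
  · rw [setIntegral_congr_fun (M.isCompact_face e).measurableSet (hG e h)]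
    simp
  · have h1 := congrArg (fun v : Euc d => v i) (M.sum_outwardNormal hd hΩo e h)
    simp only [WithLp.ofLp_sum, Finset.sum_apply, PiLp.zero_apply] at h1
    rw [h1, mul_zero]

end PolytopalMesh

end Mesh

end WG

namespace WG
open Filter Topology

/-! ### Polynomials -/

section Poly

variable {d : ℕ}

@[fun_prop]
theorem continuous_pval (p : MvPolynomial (Fin d) ℝ) : Continuous (pval p : Euc d → ℝ) := by
  unfold pval
  have h1 : Continuous fun x : Euc d => (fun i => x i : Fin d → ℝ) := by fun_prop
  exact (MvPolynomial.continuous_eval p).comp h1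

theorem pval_add (p q : MvPolynomial (Fin d) ℝ) (x : Euc d) :
    pval (p + q) x = pval p x + pval q x := by simp [pval]

theorem pval_mul (p q : MvPolynomial (Fin d) ℝ) (x : Euc d) :
    pval (p * q) x = pval p x * pval q x := by simp [pval]

theorem pval_smul (c : ℝ) (p : MvPolynomial (Fin d) ℝ) (x : Euc d) :
    pval (c • p) x = c * pval p x := by simp [pval]

theorem pval_sum {ι : Type*} (s : Finset ι) (p : ι → MvPolynomial (Fin d) ℝ) (x : Euc d) :
    pval (∑ i ∈ s, p i) x = ∑ i ∈ s, pval (p i) x := by simp [pval]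

theorem pval_zero (x : Euc d) : pval (0 : MvPolynomial (Fin d) ℝ) x = 0 := by simp [pval]

theorem pval_X (i : Fin d) (x : Euc d) : pval (MvPolynomial.X i) x = x i := by simp [pval]

theorem hasDerivAt_pval (p : MvPolynomial (Fin d) ℝ) (i : Fin d) (x : Euc d) (t : ℝ) :
    HasDerivAt (fun s : ℝ => pval p (x + s • EuclideanSpace.single i 1))
      (pval (MvPolynomial.pderiv i p) (x + t • EuclideanSpace.single i 1)) t := by
  induction p using MvPolynomial.induction_on with
  | C a => simpa [pval] using hasDerivAt_const t a
  | add p q hp hq =>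
    simp only [map_add, pval_add]
    exact hp.add hq
  | mul_X p j hp =>
    have hX : HasDerivAt (fun s : ℝ => pval (MvPolynomial.X j)
        (x + s • (EuclideanSpace.single i 1 : Euc d)))
        (if j = i then 1 else 0) t := by
      have h1 : ∀ s : ℝ, pval (MvPolynomial.X j) (x + s • (EuclideanSpace.single i 1 : Euc d)) =
          x j + s * (if j = i then 1 else 0) := by
        intro s; simp [pval]
      simp_rw [h1]
      simpa using ((hasDerivAt_id t).mul_const (if j = i then (1 : ℝ) else 0)).const_add (x j)
    have h2 := hp.mul hX
    simp only [pval_mul, Derivation.leibniz, smul_eq_mul, MvPolynomial.pderiv_X, pval_add]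
    refine h2.congr_deriv ?_
    by_cases h : j = i
    · subst h; simp [pval]; ring
    · simp [pval, h]; ring

theorem pderiv_mem_poly {k : ℕ} {p : MvPolynomial (Fin d) ℝ} (hp : p ∈ Poly d k) (i : Fin d) :
    MvPolynomial.pderiv i p ∈ Poly d (k - 1) := by
  rw [MvPolynomial.mem_restrictTotalDegree] at hp ⊢
  refine Finset.sup_le fun m hm => ?_
  rw [MvPolynomial.mem_support_iff, MvPolynomial.coeff_pderiv] at hm
  have h1 : m + Finsupp.single i 1 ∈ p.support := by
    rw [MvPolynomial.mem_support_iff]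
    intro h
    simp [h] at hm
  have h2 := (MvPolynomial.le_totalDegree h1).trans hp
  have h3 : ((m + Finsupp.single i 1).sum fun _ e => e) = (m.sum fun _ e => e) + 1 := by
    rw [Finsupp.sum_add_index' (by simp) (by simp)]
    simp
  rw [h3] at h2
  omega

end Poly

section Mesh

variable {d : ℕ} {Ω : Set (Euc d)} (M : PolytopalMesh Ω)

namespace PolytopalMesh

/-- The divergence theorem for polynomials on a mesh element. -/
theorem integral_pderiv (T : M.cells) (p : MvPolynomial (Fin d) ℝ) (i : Fin d) :
    ∫ x in (T : Set (Euc d)), pval (MvPolynomial.pderiv i p) x =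
      ∑ e ∈ M.facesOf T, ∫ x in (e : Set (Euc d)),
        pval p x * outwardNormal (T : Set (Euc d)) e i ∂(surf d) := by
  rw [integral_directional_deriv (M.isCompact_cell T)
    (E := fun e : M.faces => (e : Set (Euc d))) (𝓕 := M.facesOf T)
    (fun e _ => M.isCompact_face e) (fun e _ => (M.isFlatFace' e).nonempty) (M.frontier_eq T)
    (fun i _ j _ hij => M.overlap i j hij)
    (N := fun e => outwardNormal (T : Set (Euc d)) e) (fun e he => M.isOutwardNormal he)
    (ν := EuclideanSpace.single i 1) (by simp) (continuous_pval p) (continuous_pval _)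
    (hasDerivAt_pval p i)]
  simp [EuclideanSpace.inner_single_right]

theorem integrableOn_cell (T : M.cells) {F : Euc d → ℝ} (hF : Continuous F) :
    IntegrableOn F (T : Set (Euc d)) :=
  hF.continuousOn.integrableOn_compact (M.isCompact_cell T)

instance isFiniteMeasure_face (e : M.faces) :
    IsFiniteMeasure ((surf d).restrict (e : Set (Euc d))) :=
  ⟨by rw [Measure.restrict_apply_univ]; exact (M.isFlatFace' e).surf_lt_top⟩

theorem integrableOn_face (e : M.faces) {F : Euc d → ℝ} (hF : Continuous F) :
    IntegrableOn F (e : Set (Euc d)) (surf d) := by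
  obtain ⟨C, hC⟩ := (M.isCompact_face e).exists_bound_of_continuousOn hF.continuousOn
  exact Integrable.of_bound (C := C) hF.aestronglyMeasurable
    ((ae_restrict_iff' (M.isCompact_face e).measurableSet).2 (Eventually.of_forall hC))

end PolytopalMesh

end Mesh

/-! ### The trace inequality -/

section Trace

/-- On a finite-dimensional space every linear functional is dominated by a positive definite
symmetric form. -/
theorem exists_sq_le_of_posDef {V : Type*} [AddCommGroup V] [Module ℝ V] [FiniteDimensional ℝ V]
    (B : V →ₗ[ℝ] V →ₗ[ℝ] ℝ) (hsymm : ∀ v w, B v w = B w v) (hnonneg : ∀ v, 0 ≤ B v v)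
    (hdef : ∀ v, B v v = 0 → v = 0) (L : V →ₗ[ℝ] ℝ) :
    ∃ C : ℝ, 0 < C ∧ ∀ v, L v ^ 2 ≤ C * B v v := by
  have hinj : Function.Injective B := by
    rw [← LinearMap.ker_eq_bot, LinearMap.ker_eq_bot']
    intro v hv
    exact hdef v (by rw [hv]; rfl)
  have hsurj : Function.Surjective B :=
    (LinearMap.injective_iff_surjective_of_finrank_eq_finrank
      (Subspace.dual_finrank_eq (K := ℝ) (V := V)).symm).1 hinj
  obtain ⟨w, hw⟩ := hsurj L
  -- `w` represents `L` in the form `B`, and Cauchy–Schwarz gives the constant B w w. The added 1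
  -- only keeps it positive when L = 0.
  refine ⟨B w w + 1, by linarith [hnonneg w], fun v => ?_⟩
  have hcs : (B w v) ^ 2 ≤ B w w * B v v := by
    have hq : ∀ t : ℝ, 0 ≤ B w w * (t * t) + (2 * B w v) * t + B v v := by
      intro t
      have := hnonneg (t • w + v)
      simp only [map_add, map_smul, LinearMap.add_apply, LinearMap.smul_apply, smul_eq_mul] at this
      rw [hsymm v w] at this
      linarith
    have := discrim_le_zero hq
    rw [discrim] at this
    nlinarith
  rw [← hw]
  nlinarith [hnonneg v]

-- Evaluation at 1 is a linear functional on a finite-dimensional space where the weighted L² form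
-- is positive definite. The weight t^m with m = d − 1 will be the Jacobian of conical coordinates
-- about the apex of a pyramid.
open Polynomial in
theorem exists_eval_one_sq_le (k m : ℕ) : ∃ C : ℝ, 0 < C ∧ ∀ r : Polynomial ℝ, r.natDegree ≤ k →
    r.eval 1 ^ 2 ≤ C * ∫ t in (0 : ℝ)..1, r.eval t ^ 2 * t ^ m := by
  let V := Polynomial.degreeLT ℝ (k + 1)
  have hint : ∀ F : ℝ → ℝ, Continuous F → IntervalIntegrable F volume 0 1 :=
    fun F hF => hF.intervalIntegrable 0 1
  let B : V →ₗ[ℝ] V →ₗ[ℝ] ℝ := LinearMap.mk₂ ℝ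
    (fun p q => ∫ t in (0 : ℝ)..1, (p : ℝ[X]).eval t * (q : ℝ[X]).eval t * t ^ m)
    (fun p p' q => by
      rw [← intervalIntegral.integral_add (hint _ (by fun_prop)) (hint _ (by fun_prop))]
      congr 1; funext t; simp; ring)
    (fun c p q => by
      rw [smul_eq_mul, ← intervalIntegral.integral_const_mul]
      congr 1; funext t; simp; ring)
    (fun p q q' => by
      rw [← intervalIntegral.integral_add (hint _ (by fun_prop)) (hint _ (by fun_prop))]
      congr 1; funext t; simp; ring)
    (fun c p q => by
      rw [smul_eq_mul, ← intervalIntegral.integral_const_mul]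
      congr 1; funext t; simp; ring)
  have hB : ∀ p q : V, B p q = ∫ t in (0 : ℝ)..1, (p : ℝ[X]).eval t * (q : ℝ[X]).eval t * t ^ m :=
    fun p q => rfl
  have hnn : ∀ (p : V), ∀ t ∈ Set.Icc (0 : ℝ) 1, 0 ≤ (p : ℝ[X]).eval t * (p : ℝ[X]).eval t * t ^ m :=
    fun p t ht => mul_nonneg (mul_self_nonneg _) (pow_nonneg ht.1 m)
  let L : V →ₗ[ℝ] ℝ := (Polynomial.leval 1).comp V.subtype
  obtain ⟨C, hC, h⟩ := exists_sq_le_of_posDef B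
    (fun p q => by simp only [hB]; congr 1; funext t; ring)
    (fun p => intervalIntegral.integral_nonneg zero_le_one (hnn p))
    (fun p hp => by
      rw [hB] at hp
      have h0 : ∀ t ∈ Set.Ioc (0 : ℝ) 1, (p : ℝ[X]).eval t = 0 := by
        intro t ht
        by_contra hne
        have hpos : 0 < ∫ t in (0 : ℝ)..1, (p : ℝ[X]).eval t * (p : ℝ[X]).eval t * t ^ m := by
          refine intervalIntegral.integral_pos zero_lt_one (by fun_prop)
            (fun s hs => hnn p s ⟨hs.1.le, hs.2⟩) ⟨t, ⟨ht.1.le, ht.2⟩, ?_⟩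
          exact mul_pos (mul_self_pos.2 hne) (pow_pos ht.1 m)
        exact hpos.ne' hp
      have : (p : ℝ[X]) = 0 := by
        refine Polynomial.eq_zero_of_infinite_isRoot _ ((Set.Ioc_infinite zero_lt_one).mono ?_)
        intro t ht
        exact h0 t ht
      exact Subtype.ext this) L
  refine ⟨C, hC, fun r hr => ?_⟩
  have hrV : r ∈ V := Polynomial.mem_degreeLT.2
    (lt_of_le_of_lt Polynomial.degree_le_natDegree (by exact_mod_cast Nat.lt_succ_of_le hr))
  have := h ⟨r, hrV⟩
  rw [hB] at this
  simp_rw [← sq] at this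
  exact this

/-- Restriction of a multivariate polynomial to a line. -/
theorem exists_polynomial_line {d k : ℕ} {p : MvPolynomial (Fin d) ℝ} (hp : p ∈ Poly d k)
    (A y : Euc d) : ∃ r : Polynomial ℝ, r.natDegree ≤ k ∧ ∀ t, r.eval t = pval p (A + t • y) := by
  rw [MvPolynomial.mem_restrictTotalDegree] at hp
  let f : Fin d → Polynomial ℝ := fun i => Polynomial.C (A i) + Polynomial.C (y i) * Polynomial.X
  refine ⟨MvPolynomial.aeval f p, ?_, fun t => ?_⟩
  · have := MvPolynomial.aeval_natDegree_le p hp f (n := 1) (fun i => by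
      simp only [f]; compute_degree)
    simpa using this
  · have h1 : (Polynomial.evalRingHom t) (MvPolynomial.aeval f p) =
        MvPolynomial.eval (fun i => Polynomial.eval t (f i)) p := by
      rw [MvPolynomial.aeval_def, MvPolynomial.eval₂_eq', MvPolynomial.eval_eq', map_sum]
      refine Finset.sum_congr rfl fun m _ => ?_
      simp [Polynomial.algebraMap_eq, Polynomial.eval_prod]
    rw [← Polynomial.coe_evalRingHom, h1, pval]
    congr 2
    funext i
    simp [f]
    ring

end Trace

end WG

namespace WG
open Filter Topology

section Trace

theorem lintegral_comp_smul_perp {d : ℕ} {n : Euc d} (hn : ‖n‖ = 1) {τ : ℝ} (hτ : 0 < τ)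
    {g : Perp n → ENNReal} (hg : Measurable g) :
    ∫⁻ z, g z = ENNReal.ofReal (τ ^ (d - 1)) * ∫⁻ w, g (τ • w) := by
  have h := Measure.map_addHaar_smul (volume : Measure (Perp n)) hτ.ne'
  rw [finrank_perp hn] at h
  have hpos : 0 < τ ^ (d - 1) := by positivity
  rw [← lintegral_map hg (measurable_const_smul τ), h, lintegral_smul_measure, smul_eq_mul,
    ← mul_assoc, ← ENNReal.ofReal_mul hpos.le, abs_of_pos (inv_pos.2 hpos),
    mul_inv_cancel₀ hpos.ne', ENNReal.ofReal_one, one_mul]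

/-- Trace inequality for polynomials on a pyramid. -/
theorem exists_pyramid_trace (d k : ℕ) : ∃ C : ℝ, 0 < C ∧
    ∀ (T e : Set (Euc d)) (A n : Euc d) (H : ℝ), IsCompact T → IsCompact e → ‖n‖ = 1 →
      (∀ x ∈ e, ∀ y ∈ e, inner ℝ n (x - y) = 0) → convexJoin ℝ {A} e ⊆ T → 0 < H →
      (∀ x ∈ e, H ≤ inner ℝ n (x - A)) →
      ∀ p ∈ Poly d k, H * ∫ x in e, pval p x ^ 2 ∂(surf d) ≤ C * ∫ x in T, pval p x ^ 2 := by
  obtain ⟨C, hC, hpoly⟩ := exists_eval_one_sq_le k (d - 1)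
  refine ⟨C, hC, fun T e A n H₀ hT he hn ho hcone hH₀ hH p hp => ?_⟩
  rcases e.eq_empty_or_nonempty with rfl | ⟨x₀, hx₀⟩
  · simp only [Measure.restrict_empty, integral_zero_measure, mul_zero]
    exact mul_nonneg hC.le (integral_nonneg fun x => sq_nonneg _)
  -- The exact height of the apex over the hyperplane of the base; `H₀` is only a lower bound and
  -- enters at the very end.
  set H : ℝ := inner ℝ n (x₀ - A) with hHdef
  have hHpos : 0 < H := hH₀.trans_le (hH x₀ hx₀)
  have hn1 : inner ℝ n n = (1 : ℝ) := by rw [real_inner_self_eq_norm_sq, hn]; simp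
  let P : Euc d → ENNReal := fun x => ENNReal.ofReal (pval p x ^ 2)
  have hP : Measurable P := by
    have : Continuous fun x : Euc d => pval p x ^ 2 := by fun_prop
    exact this.measurable.ennreal_ofReal
  let q : Euc d → ENNReal := T.indicator P
  have hq : Measurable q := hP.indicator hT.measurableSet
  have hfin_e : IsFiniteMeasure ((surf d).restrict e) :=
    ⟨by rw [Measure.restrict_apply_univ]; exact surf_lt_top he hn ho⟩
  have hsq : Continuous fun x : Euc d => pval p x ^ 2 := by fun_prop
  have hint_e : IntegrableOn (fun x => pval p x ^ 2) e (surf d) := by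
    obtain ⟨B, hB⟩ := he.exists_bound_of_continuousOn hsq.continuousOn
    exact Integrable.of_bound (C := B) hsq.aestronglyMeasurable
      ((ae_restrict_iff' he.measurableSet).2 (Eventually.of_forall hB))
  have hint_T : IntegrableOn (fun x => pval p x ^ 2) T :=
    hsq.continuousOn.integrableOn_compact hT
  -- the base of the pyramid in orthogonal coordinates
  have hbase : ∫⁻ x in e, P x ∂(surf d) =
      ∫⁻ w : Perp n, e.indicator P (A + (H • n + (w : Euc d))) := by
    have ho' : ∀ x ∈ e, inner ℝ n (x - (A + H • n)) = 0 := by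
      intro x hx
      have h1 := ho x hx x₀ hx₀
      rw [show x - (A + H • n) = (x - x₀) + ((x₀ - A) - H • n) by abel, inner_add_right, h1,
        inner_sub_right, inner_smul_right, hn1, ← hHdef]
      ring
    have hsub : e ⊆ {x | inner ℝ n (x - (A + H • n)) = 0} := fun x hx => ho' x hx
    rw [← lintegral_indicator he.measurableSet]
    have h2 : ∫⁻ x, e.indicator P x ∂(surf d) =
        ∫⁻ x, e.indicator P x ∂((surf d).restrict {x | inner ℝ n (x - (A + H • n)) = 0}) := by
      rw [lintegral_indicator he.measurableSet, lintegral_indicator he.measurableSet,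
        Measure.restrict_restrict he.measurableSet, Set.inter_eq_left.2 hsub]
    rw [h2, ← map_perp_eq_surf hn, lintegral_map (hP.indicator he.measurableSet) (by fun_prop)]
    simp only [add_assoc]
  -- the one-dimensional inequality along the rays from the apex
  have hray : ∀ y : Euc d, ENNReal.ofReal (C⁻¹) * P (A + y) ≤
      ∫⁻ τ in Set.Ioc (0 : ℝ) 1, ENNReal.ofReal (τ ^ (d - 1)) * P (A + τ • y) := by
    intro y
    obtain ⟨r, hr, hre⟩ := exists_polynomial_line hp A y
    have h1 := hpoly r hr
    have hcont : Continuous fun t : ℝ => r.eval t ^ 2 * t ^ (d - 1) := by fun_prop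
    have h2 : ∫⁻ τ in Set.Ioc (0 : ℝ) 1, ENNReal.ofReal (τ ^ (d - 1)) * P (A + τ • y) =
        ENNReal.ofReal (∫ t in (0 : ℝ)..1, r.eval t ^ 2 * t ^ (d - 1)) := by
      rw [intervalIntegral.integral_of_le zero_le_one, ofReal_integral_eq_lintegral_ofReal]
      · refine setLIntegral_congr_fun measurableSet_Ioc fun t ht => ?_
        simp only [P, ← hre]
        rw [← ENNReal.ofReal_mul (pow_nonneg ht.1.le _), mul_comm]
      · exact (hcont.integrableOn_Icc (a := 0) (b := 1)).mono_set Set.Ioc_subset_Icc_self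
      · exact (ae_restrict_iff' measurableSet_Ioc).2 (Eventually.of_forall fun t ht =>
          mul_nonneg (sq_nonneg _) (pow_nonneg ht.1.le _))
    rw [h2, ← ENNReal.ofReal_mul (inv_pos.2 hC).le]
    refine ENNReal.ofReal_le_ofReal ?_
    rw [hre, one_smul] at h1
    rw [inv_mul_le_iff₀ hC]
    exact h1
  have hmain : ENNReal.ofReal (H * C⁻¹) * ∫⁻ x in e, P x ∂(surf d) ≤ ∫⁻ x in T, P x := by
    have hmq : Measurable fun p : ℝ × Perp n => q (A + p.1 • n + (p.2 : Euc d)) :=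
      hq.comp (measurePreserving_perp hn A).measurable
    set g : ℝ → ENNReal := fun s => ∫⁻ z : Perp n, q (A + s • n + (z : Euc d)) with hg
    have hgm : Measurable g := hmq.lintegral_prod_right'
    have hgs : ∫⁻ s, g s = ENNReal.ofReal H * ∫⁻ τ, g (H * τ) := by
      rw [← lintegral_map hgm (measurable_const_mul H), Real.map_volume_mul_left hHpos.ne',
        lintegral_smul_measure, smul_eq_mul, ← mul_assoc, ← ENNReal.ofReal_mul hHpos.le,
        abs_of_pos (inv_pos.2 hHpos), mul_inv_cancel₀ hHpos.ne', ENNReal.ofReal_one, one_mul]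
    -- The slice of the pyramid at height Hτ is the base contracted by τ towards `A`; rescaling in
    -- dimension d − 1 produces the weight τ^(d−1).
    have hgτ : ∀ τ ∈ Set.Ioc (0 : ℝ) 1, ∫⁻ w : Perp n,
        (e.indicator 1 (A + (H • n + (w : Euc d))) *
          (ENNReal.ofReal (τ ^ (d - 1)) * P (A + τ • (H • n + (w : Euc d))))) ≤ g (H * τ) := by
      intro τ hτ
      simp only [hg]
      have hz : Measurable fun z : Perp n => q (A + (H * τ) • n + (z : Euc d)) :=
        hq.comp (by fun_prop)
      have hz' : Measurable fun w : Perp n => q (A + (H * τ) • n + ((τ • w : Perp n) : Euc d)) :=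
        hz.comp (measurable_const_smul τ)
      rw [lintegral_comp_smul_perp hn hτ.1 hz, ← lintegral_const_mul _ hz']
      refine lintegral_mono fun w => ?_
      by_cases hw : A + (H • n + (w : Euc d)) ∈ e
      · have hmem : A + τ • (H • n + (w : Euc d)) ∈ T := by
          apply hcone
          rw [mem_convexJoin]
          refine ⟨A, rfl, _, hw, 1 - τ, τ, by linarith [hτ.2], hτ.1.le, by ring, ?_⟩
          rw [smul_add τ A, ← add_assoc, ← add_smul, sub_add_cancel, one_smul]
        have heq : A + (H * τ) • n + ((τ • w : Perp n) : Euc d) =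
            A + τ • (H • n + (w : Euc d)) := by
          rw [Submodule.coe_smul, smul_add, smul_smul, mul_comm, add_assoc]
        rw [heq, Set.indicator_of_mem hw, show q _ = P _ from Set.indicator_of_mem hmem _]
        simp
      · rw [Set.indicator_of_notMem hw, zero_mul]
        exact zero_le
    rw [← lintegral_indicator hT.measurableSet, lintegral_eq_perp hn A hq]
    change _ ≤ ∫⁻ s, g s
    rw [hgs, ENNReal.ofReal_mul hHpos.le, mul_assoc]
    refine mul_le_mul_right ?_ _
    calc ENNReal.ofReal C⁻¹ * ∫⁻ x in e, P x ∂(surf d)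
        = ∫⁻ w : Perp n, ENNReal.ofReal C⁻¹ * e.indicator P (A + (H • n + (w : Euc d))) := by
          rw [hbase, lintegral_const_mul]
          exact (hP.indicator he.measurableSet).comp (by fun_prop)
      _ ≤ ∫⁻ w : Perp n, ∫⁻ τ in Set.Ioc (0 : ℝ) 1, (e.indicator 1 (A + (H • n + (w : Euc d))) *
          (ENNReal.ofReal (τ ^ (d - 1)) * P (A + τ • (H • n + (w : Euc d))))) := by
          refine lintegral_mono fun w => ?_
          by_cases hw : A + (H • n + (w : Euc d)) ∈ e
          · simp only [Set.indicator_of_mem hw, Pi.one_apply, one_mul]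
            exact hray _
          · simp only [Set.indicator_of_notMem hw, mul_zero]
            exact zero_le
      _ = ∫⁻ τ in Set.Ioc (0 : ℝ) 1, ∫⁻ w : Perp n, (e.indicator 1 (A + (H • n + (w : Euc d))) *
          (ENNReal.ofReal (τ ^ (d - 1)) * P (A + τ • (H • n + (w : Euc d))))) := by
          refine lintegral_lintegral_swap (Measurable.aemeasurable ?_)
          refine Measurable.mul ((measurable_one.indicator he.measurableSet).comp (by fun_prop)) ?_
          refine Measurable.mul (by fun_prop) (hP.comp (by fun_prop))
      _ ≤ ∫⁻ τ in Set.Ioc (0 : ℝ) 1, g (H * τ) :=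
          setLIntegral_mono (hgm.comp (measurable_const_mul H)) hgτ
      _ ≤ ∫⁻ τ, g (H * τ) := setLIntegral_le_lintegral _ _
  have hreal : H * C⁻¹ * ∫ x in e, pval p x ^ 2 ∂(surf d) ≤ ∫ x in T, pval p x ^ 2 := by
    have i1 := ofReal_integral_eq_lintegral_ofReal hint_e
      (Eventually.of_forall fun x => sq_nonneg (pval p x))
    have i2 := ofReal_integral_eq_lintegral_ofReal hint_T
      (Eventually.of_forall fun x => sq_nonneg (pval p x))
    change ENNReal.ofReal (H * C⁻¹) * ∫⁻ x in e, ENNReal.ofReal (pval p x ^ 2) ∂(surf d) ≤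
      ∫⁻ x in T, ENNReal.ofReal (pval p x ^ 2) at hmain
    rw [← i1, ← i2, ← ENNReal.ofReal_mul (by positivity)] at hmain
    exact (ENNReal.ofReal_le_ofReal_iff (integral_nonneg fun x => sq_nonneg _)).1 hmain
  have h0 : 0 ≤ ∫ x in e, pval p x ^ 2 ∂(surf d) := integral_nonneg fun x => sq_nonneg _
  have h1 : H₀ * ∫ x in e, pval p x ^ 2 ∂(surf d) ≤ H * ∫ x in e, pval p x ^ 2 ∂(surf d) :=
    mul_le_mul_of_nonneg_right (hH x₀ hx₀) h0
  refine h1.trans ?_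
  calc H * ∫ x in e, pval p x ^ 2 ∂(surf d)
      = C * (H * C⁻¹ * ∫ x in e, pval p x ^ 2 ∂(surf d)) := by field_simp
    _ ≤ _ := mul_le_mul_of_nonneg_left hreal hC.le

/-- Trace inequality on the elements of a shape regular mesh. -/
theorem PolytopalMesh.exists_trace {d : ℕ} (hd : 1 ≤ d) (k : ℕ) (c : ShapeConstants) :
    ∃ C : ℝ, 0 < C ∧ ∀ {Ω : Set (Euc d)} (M : PolytopalMesh Ω), M.ShapeRegular c →
      ∀ (T : M.cells), ∀ e ∈ M.facesOf T, ∀ p ∈ Poly d k,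
        ∫ x in (e : Set (Euc d)), pval p x ^ 2 ∂(surf d) ≤
          C * (Metric.diam (T : Set (Euc d)))⁻¹ * ∫ x in (T : Set (Euc d)), pval p x ^ 2 := by
  obtain ⟨C, hC, h⟩ := exists_pyramid_trace d k
  refine ⟨C * c.σ⁻¹, mul_pos hC (inv_pos.2 c.σ_pos), fun M hM T e he p hp => ?_⟩
  obtain ⟨A, hA, hcone, hang⟩ := hM.pyramid T e he
  have hn := M.isOutwardNormal he
  have hdiam := (M.isElement' T).diam_pos hd
  have hσ := mul_pos c.σ_pos hdiam
  have := h T e A _ _ (M.isCompact_cell T) (M.isCompact_face e) hn.1 hn.2.1 hcone hσ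
    (fun x hx => (hang x hx).1) p hp
  rw [mul_comm, ← le_div_iff₀ hσ] at this
  refine this.trans (le_of_eq ?_)
  have := c.σ_pos.ne'
  field_simp

end Trace

end WG

namespace WG
open Filter Topology

/-! ### Zeros of continuous vector fields -/

section Brouwer

variable {n : ℕ}

/-- `det (1 + A)` as a combination of the values `det (1 + t A)` at small `t`. -/
theorem exists_det_interpolation (n : ℕ) {δ : ℝ} (hδ : 0 < δ) :
    ∃ (t w : ℕ → ℝ), (∀ i, 0 < t i ∧ t i < δ) ∧ ∑ i ∈ Finset.range (n + 1), w i = 1 ∧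
      ∀ A : Euc n →L[ℝ] Euc n, (1 + A).det = ∑ i ∈ Finset.range (n + 1), w i * (1 + t i • A).det := by
  -- Distinct nodes strictly between 0 and δ. Since det(1 + sA) has degree at most n in s, Lagrange
  -- interpolation at n + 1 nodes recovers its value at s = 1, with weights that do not depend on
  -- `A`.
  let t : ℕ → ℝ := fun i => δ / (i + 2)
  have htinj : Set.InjOn t (Finset.range (n + 1)) := by
    intro i _ j _ hij
    have h1 : (i : ℝ) + 2 ≠ 0 := by positivity
    have h2 : (j : ℝ) + 2 ≠ 0 := by positivity
    simp only [t] at hij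
    rw [div_eq_div_iff h1 h2, mul_right_inj' hδ.ne'] at hij
    have : (i : ℝ) = j := by linarith
    exact_mod_cast this
  let w : ℕ → ℝ := fun i => (Lagrange.basis (Finset.range (n + 1)) t i).eval 1
  refine ⟨t, w, fun i => ⟨by positivity, ?_⟩, ?_, fun A => ?_⟩
  · exact div_lt_self hδ (by have : (0 : ℝ) ≤ i := by positivity
                             linarith)
  · simp only [w]
    rw [← Polynomial.eval_finsetSum, Lagrange.sum_basis htinj ⟨0, by simp⟩, Polynomial.eval_one]
  · let b := (EuclideanSpace.basisFun (Fin n) ℝ).toBasis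
    let Mx := LinearMap.toMatrix b b (A : Euc n →ₗ[ℝ] Euc n)
    let q : Polynomial ℝ := Matrix.det ((Polynomial.X : Polynomial ℝ) • Mx.map Polynomial.C +
      (1 : Matrix (Fin n) (Fin n) ℝ).map Polynomial.C)
    have hq : ∀ s : ℝ, q.eval s = (1 + s • A).det := by
      intro s
      have h1 : (1 + s • A).det = Matrix.det (1 + s • Mx) := by
        change LinearMap.det ((1 + s • A : Euc n →L[ℝ] Euc n) : Euc n →ₗ[ℝ] Euc n) = _
        rw [← LinearMap.det_toMatrix b]
        congr 1
        have : ((1 + s • A : Euc n →L[ℝ] Euc n) : Euc n →ₗ[ℝ] Euc n) =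
          LinearMap.id + s • (A : Euc n →ₗ[ℝ] Euc n) := rfl
        rw [this, map_add, map_smul, LinearMap.toMatrix_id]
      rw [h1, ← Polynomial.coe_evalRingHom, RingHom.map_det]
      congr 1
      ext i j
      by_cases h : i = j
      · subst h; simp; ring
      · simp [Matrix.one_apply_ne h]; ring
    have hdeg : q.degree < (Finset.range (n + 1)).card := by
      rw [Finset.card_range]
      refine lt_of_le_of_lt Polynomial.degree_le_natDegree ?_
      have := Polynomial.natDegree_det_X_add_C_le Mx (1 : Matrix (Fin n) (Fin n) ℝ)
      rw [Fintype.card_fin] at this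
      exact_mod_cast Nat.lt_succ_of_le this
    have h2 := Lagrange.eq_interpolate htinj hdeg
    have h3 := congrArg (Polynomial.eval 1) h2
    rw [Lagrange.interpolate_apply, Polynomial.eval_finsetSum, hq 1, one_smul] at h3
    rw [h3]
    refine Finset.sum_congr rfl fun i _ => ?_
    rw [Polynomial.eval_mul, Polynomial.eval_C, hq, mul_comm]

/-- Along the segment from 1 to 1 + A every operator is injective because ‖sA‖ < 1, so the
determinant never vanishes and keeps the sign it has at the identity. -/
theorem det_one_add_pos {A : Euc n →L[ℝ] Euc n} (hA : ‖A‖ < 1) : 0 < (1 + A).det := by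
  have hne : ∀ s ∈ Set.Icc (0 : ℝ) 1, (1 + s • A).det ≠ 0 := by
    intro s hs h0
    have h1 : LinearMap.det ((1 + s • A : Euc n →L[ℝ] Euc n) : Euc n →ₗ[ℝ] Euc n) = 0 := h0
    have hker := LinearMap.bot_lt_ker_of_det_eq_zero h1
    obtain ⟨v, hv, hv0⟩ := Submodule.exists_mem_ne_zero_of_ne_bot hker.ne'
    have hv' : v + s • A v = 0 := hv
    have h2 : ‖v‖ = ‖s • A v‖ := (congrArg norm (eq_neg_of_add_eq_zero_left hv')).trans (norm_neg _)
    have h3 : ‖s • A v‖ ≤ ‖A‖ * ‖v‖ := by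
      rw [norm_smul, Real.norm_eq_abs, abs_of_nonneg hs.1]
      calc s * ‖A v‖ ≤ 1 * ‖A v‖ := mul_le_mul_of_nonneg_right hs.2 (norm_nonneg _)
        _ ≤ _ := by rw [one_mul]; exact A.le_opNorm v
    have h4 : 0 < ‖v‖ := norm_pos_iff.2 hv0
    nlinarith
  have hcont : Continuous fun s : ℝ => (1 + s • A).det :=
    ContinuousLinearMap.continuous_det.comp (by fun_prop)
  by_contra hneg
  push Not at hneg
  have h0 : (1 + (0 : ℝ) • A).det = 1 := by
    have : (1 + (0 : ℝ) • A) = 1 := by ext; simp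
    rw [this]
    exact LinearMap.det_id
  have h1 : (1 + (1 : ℝ) • A).det ≤ 0 := by rwa [one_smul]
  obtain ⟨s, hs, hs0⟩ := intermediate_value_Icc' (zero_le_one (α := ℝ)) hcont.continuousOn
    (show (0 : ℝ) ∈ Set.Icc ((1 + (1 : ℝ) • A).det) ((1 + (0 : ℝ) • A).det) from
      ⟨h1, by rw [h0]; exact zero_le_one⟩)
  exact hne s hs hs0

/-- A perturbation of the identity by a contraction supported in a set maps that set onto itself. -/
theorem image_one_add_eq {K : Euc n → Euc n} {L : NNReal} (hK : LipschitzWith L K) (hL : L < 1)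
    {U : Set (Euc n)} (hU : ∀ x ∉ U, K x = 0) :
    Function.Injective (fun x => x + K x) ∧ (fun x => x + K x) '' U = U := by
  have hinj : Function.Injective (fun x => x + K x) := by
    intro x y hxy
    have h1 : x - y = K y - K x := by
      have : x + K x = y + K y := hxy
      rw [sub_eq_sub_iff_add_eq_add, this, add_comm]
    have h2 := hK.dist_le_mul y x
    rw [dist_eq_norm, dist_eq_norm, ← h1, norm_sub_rev y x] at h2
    have h3 : (L : ℝ) < 1 := by exact_mod_cast hL
    have h4 : ‖x - y‖ = 0 := by nlinarith [norm_nonneg (x - y)]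
    exact sub_eq_zero.1 (norm_eq_zero.1 h4)
  refine ⟨hinj, Set.Subset.antisymm ?_ ?_⟩
  · rintro _ ⟨x, hx, rfl⟩
    by_contra hc
    have h1 := hU _ hc
    have h2 : x + K x = x := hinj (by simp only [h1, add_zero])
    exact hc (by simpa only [h2] using hx)
  · intro y hy
    have hc : ContractingWith L (fun x => y - K x) :=
      ⟨hL, LipschitzWith.of_dist_le_mul fun a b => by
        rw [dist_sub_left]; exact hK.dist_le_mul a b⟩
    have hx := hc.fixedPoint_isFixedPt
    set x := ContractingWith.fixedPoint _ hc
    have hx' : x + K x = y := by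
      have : y - K x = x := hx
      exact (sub_eq_iff_eq_add.1 this).symm
    refine ⟨x, ?_, hx'⟩
    by_contra hxU
    rw [hU x hxU, add_zero] at hx'
    exact hxU (hx' ▸ hy)

/-- There is no Lipschitz retraction onto the sphere which is differentiable inside the ball. -/
theorem no_retraction {R : ℝ} (hR : 0 < R) {K : Euc n → Euc n} {L : NNReal}
    (hK : LipschitzWith L K) (hU : ∀ x ∉ Metric.ball (0 : Euc n) R, K x = 0)
    (hd : ∀ x ∈ Metric.ball (0 : Euc n) R, DifferentiableAt ℝ K x)
    (hs : ∀ x ∈ Metric.ball (0 : Euc n) R, ‖x + K x‖ = R) : False := by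
  set U := Metric.ball (0 : Euc n) R with hUdef
  have hUo : IsOpen U := Metric.isOpen_ball
  have hδ : 0 < 1 / ((L : ℝ) + 1) := by positivity
  -- For t < 1/(L + 1) the map x + t K x is injective and carries the ball onto itself, so det(1 + t
  -- DK) integrates to the volume of the ball. Interpolation extends this to t = 1. There the map
  -- takes values in the sphere, its differential is singular, and the integral is 0.
  obtain ⟨t, w, ht, hw, hdet⟩ := exists_det_interpolation n hδ
  have hnorm : ∀ x, ‖fderiv ℝ K x‖ ≤ L := fun x => norm_fderiv_le_of_lipschitz ℝ hK
  have hLt : ∀ i, t i * L < 1 := by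
    intro i
    have h1 := (ht i).2
    rw [lt_div_iff₀ (by positivity)] at h1
    nlinarith [(ht i).1]
  have hvol : ∀ i, IntegrableOn (fun x => (1 + t i • fderiv ℝ K x).det) U ∧
      ∫ x in U, (1 + t i • fderiv ℝ K x).det = volume.real U := by
    intro i
    have hti := (ht i).1
    have hKi : LipschitzWith (Real.toNNReal (t i) * L) (fun x => t i • K x) := by
      refine LipschitzWith.of_dist_le_mul fun a b => ?_
      rw [dist_eq_norm, ← smul_sub, norm_smul, Real.norm_eq_abs, abs_of_pos hti, NNReal.coe_mul,
        Real.coe_toNNReal _ hti.le, mul_assoc, ← dist_eq_norm]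
      exact mul_le_mul_of_nonneg_left (hK.dist_le_mul a b) hti.le
    have hlt : Real.toNNReal (t i) * L < 1 := by
      rw [← NNReal.coe_lt_coe, NNReal.coe_mul, Real.coe_toNNReal _ hti.le]
      exact hLt i
    obtain ⟨hinj, himg⟩ := image_one_add_eq hKi hlt (U := U) (fun x hx => by simp [hU x hx])
    have hder : ∀ x ∈ U, HasFDerivWithinAt (fun x => x + t i • K x) (1 + t i • fderiv ℝ K x) U x := by
      intro x hx
      exact ((hasFDerivAt_id x).add ((hd x hx).hasFDerivAt.const_smul (t i))).hasFDerivWithinAt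
    have hpos : ∀ x, 0 < (1 + t i • fderiv ℝ K x).det := by
      intro x
      apply det_one_add_pos
      rw [norm_smul, Real.norm_eq_abs, abs_of_pos hti]
      exact (mul_le_mul_of_nonneg_left (hnorm x) hti.le).trans_lt (hLt i)
    have h1 := lintegral_abs_det_fderiv_eq_addHaar_image volume hUo.measurableSet hder hinj.injOn
    rw [himg] at h1
    have h2 : ∀ x, |(1 + t i • fderiv ℝ K x).det| = (1 + t i • fderiv ℝ K x).det :=
      fun x => abs_of_pos (hpos x)
    simp only [h2] at h1
    have hmeas : Measurable fun x => (1 + t i • fderiv ℝ K x).det :=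
      ContinuousLinearMap.continuous_det.measurable.comp
        ((measurable_fderiv ℝ K).const_smul (t i) |>.const_add 1)
    refine ⟨⟨hmeas.aestronglyMeasurable, ?_⟩, ?_⟩
    · rw [hasFiniteIntegral_iff_ofReal (Eventually.of_forall fun x => (hpos x).le), h1]
      exact measure_ball_lt_top
    · rw [integral_eq_lintegral_of_nonneg_ae (Eventually.of_forall fun x => (hpos x).le)
        hmeas.aestronglyMeasurable, h1]
      rfl
  have htotal : ∫ x in U, (1 + fderiv ℝ K x).det = volume.real U := by
    rw [integral_congr_ae (Eventually.of_forall fun x => hdet (fderiv ℝ K x)), integral_finsetSum _ fun i _ => (hvol i).1.const_mul (w i)]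
    simp_rw [integral_const_mul, (hvol _).2]
    rw [← Finset.sum_mul, hw, one_mul]
  have hzero : ∀ x ∈ U, (1 + fderiv ℝ K x).det = 0 := by
    intro x hx
    have hF : HasFDerivAt (fun x => x + K x) (1 + fderiv ℝ K x) x :=
      (hasFDerivAt_id x).add (hd x hx).hasFDerivAt
    -- ‖x + K x‖² is constant, so x + K x is orthogonal to the range of the differential. If the
    -- differential were onto, this nonzero vector would be orthogonal to itself.
    have hsq := hF.inner ℝ hF
    have hconst : HasFDerivAt (fun y => inner ℝ (y + K y) (y + K y) : Euc n → ℝ)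
        (0 : Euc n →L[ℝ] ℝ) x := by
      refine (hasFDerivAt_const (R ^ 2) x).congr_of_eventuallyEq ?_
      filter_upwards [hUo.mem_nhds hx] with y hy
      rw [real_inner_self_eq_norm_sq, hs y hy]
    have hun := hsq.unique hconst
    by_contra hne
    have hinj : Function.Surjective (1 + fderiv ℝ K x : Euc n →L[ℝ] Euc n) := by
      exact (LinearMap.equivOfDetNeZero ((1 + fderiv ℝ K x : Euc n →L[ℝ] Euc n) :
          Euc n →ₗ[ℝ] Euc n) hne).surjective
    obtain ⟨v, hv⟩ := hinj (x + K x)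
    have h1 := congrArg (fun (l : Euc n →L[ℝ] ℝ) => l v) hun
    simp only [ContinuousLinearMap.comp_apply, ContinuousLinearMap.prod_apply,
      fderivInnerCLM_apply, hv, zero_apply] at h1
    rw [real_inner_self_eq_norm_sq, hs x hx] at h1
    nlinarith
  rw [setIntegral_congr_fun hUo.measurableSet hzero, integral_zero] at htotal
  have hpos : 0 < volume.real U :=
    ENNReal.toReal_pos (Metric.measure_ball_pos volume _ hR).ne' measure_ball_lt_top.ne
  exact hpos.ne htotal

end Brouwer

end WG

namespace WG
open Filter Topology

section Brouwer

variable {n : ℕ}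

/-- A segment from a point of the ball to a point outside crosses the sphere, where `k` vanishes,
and the crossing point is no farther away than the outer end. -/
theorem lipschitzWith_indicator_closedBall {R : ℝ} {k : Euc n → Euc n} {L : NNReal}
    (hk : LipschitzOnWith L k (Metric.closedBall 0 R)) (h0 : ∀ x, ‖x‖ = R → k x = 0) :
    LipschitzWith L ((Metric.closedBall (0 : Euc n) R).indicator k) := by
  set B := Metric.closedBall (0 : Euc n) R
  have hmem : ∀ x, x ∈ B ↔ ‖x‖ ≤ R := fun x => by simp [B]
  have key : ∀ x ∈ B, ∀ y ∉ B, dist (k x) 0 ≤ L * dist x y := by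
    intro x hx y hy
    have hc : Continuous fun s : ℝ => ‖AffineMap.lineMap x y s‖ := by fun_prop
    have hx' := (hmem x).1 hx
    have hy' : R ≤ ‖y‖ := by rw [hmem] at hy; linarith
    obtain ⟨s, hs, hsR⟩ := intermediate_value_Icc (zero_le_one (α := ℝ)) hc.continuousOn
      (show R ∈ Set.Icc _ _ by simpa using ⟨hx', hy'⟩)
    have hsR' : ‖AffineMap.lineMap x y s‖ = R := hsR
    have h1 := hk.dist_le_mul x hx (AffineMap.lineMap x y s) ((hmem _).2 hsR'.le)
    rw [h0 _ hsR', dist_left_lineMap, Real.norm_eq_abs, abs_of_nonneg hs.1] at h1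
    refine h1.trans (mul_le_mul_of_nonneg_left ?_ L.2)
    exact mul_le_of_le_one_left dist_nonneg hs.2
  refine LipschitzWith.of_dist_le_mul fun x y => ?_
  by_cases hx : x ∈ B <;> by_cases hy : y ∈ B
  · rw [Set.indicator_of_mem hx, Set.indicator_of_mem hy]
    exact hk.dist_le_mul x hx y hy
  · rw [Set.indicator_of_mem hx, Set.indicator_of_notMem hy]
    exact key x hx y hy
  · rw [Set.indicator_of_notMem hx, Set.indicator_of_mem hy, dist_comm, dist_comm x]
    exact key y hy x hx
  · rw [Set.indicator_of_notMem hx, Set.indicator_of_notMem hy, dist_self]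
    positivity

/-- Without a zero, N = −R G/‖G‖ would map the ball into the sphere. A fixed point of N would lie on
the sphere with ⟨G x, x⟩ < 0, against the outward condition. The usual construction from a
fixed-point-free map then yields a retraction onto the sphere. -/
theorem exists_zero_of_contDiff {R : ℝ} (hR : 0 < R) {G : Euc n → Euc n} (hG : ContDiff ℝ 1 G)
    (hpos : ∀ x, ‖x‖ = R → 0 < inner ℝ (G x) x) : ∃ x, ‖x‖ ≤ R ∧ G x = 0 := by
  by_contra hcon
  push Not at hcon
  let N : Euc n → Euc n := fun x => (-(R / ‖G x‖)) • G x
  have hNnorm : ∀ x, ‖x‖ ≤ R → ‖N x‖ = R := by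
    intro x hx
    have := norm_pos_iff.2 (hcon x hx)
    simp only [N]
    rw [norm_smul, norm_neg, Real.norm_eq_abs, abs_of_pos (by positivity)]
    field_simp
  have hNne : ∀ x, ‖x‖ ≤ R → x - N x ≠ 0 := by
    intro x hx h
    have hxN : x = N x := sub_eq_zero.1 h
    have hxR : ‖x‖ = R := by rw [hxN]; exact hNnorm x hx
    have h1 := hpos x hxR
    rw [hxN] at h1
    have h2 : inner ℝ (G x) (N x) < 0 := by
      have := norm_pos_iff.2 (hcon x hx)
      simp only [N]
      rw [inner_smul_right, real_inner_self_eq_norm_sq]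
      have : 0 < R / ‖G x‖ * ‖G x‖ ^ 2 := by positivity
      linarith
    rw [← hxN] at h1 h2
    linarith
  -- x + k x is the second intersection with the sphere of the line from N x through x. One
  -- intersection being known, the other is rational in the data: no square root appears, and `k` is
  -- C¹ up to the sphere.
  let k : Euc n → Euc n := fun x => ((R ^ 2 - ‖x‖ ^ 2) / ‖x - N x‖ ^ 2) • (x - N x)
  have hkd : ∀ x, ‖x‖ ≤ R → ContDiffAt ℝ 1 k x := by
    intro x hx
    have hNd : ContDiffAt ℝ 1 N x :=
      ((contDiffAt_const.div (hG.contDiffAt.norm ℝ (hcon x hx))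
        (norm_ne_zero_iff.2 (hcon x hx))).neg).smul hG.contDiffAt
    have hd : ContDiffAt ℝ 1 (fun x => x - N x) x := contDiffAt_id.sub hNd
    exact ((contDiffAt_const.sub (contDiffAt_id.norm_sq ℝ)).div (hd.norm_sq ℝ)
      (pow_ne_zero 2 (norm_ne_zero_iff.2 (hNne x hx)))).smul hd
  obtain ⟨L, hL⟩ : ∃ L, LipschitzOnWith L k (Metric.closedBall 0 R) :=
    LocallyLipschitzOn.exists_lipschitzOnWith_of_compact (isCompact_closedBall 0 R)
      (ContDiffOn.locallyLipschitzOn (convex_closedBall 0 R)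
        fun x hx => (hkd x (by simpa using hx)).contDiffWithinAt)
  have h0 : ∀ x, ‖x‖ = R → k x = 0 := by
    intro x hx
    simp [k, hx]
  have hK := lipschitzWith_indicator_closedBall hL h0
  refine no_retraction hR hK ?_ ?_ ?_
  · intro x hx
    by_cases hxB : x ∈ Metric.closedBall (0 : Euc n) R
    · rw [Set.indicator_of_mem hxB]
      refine h0 x (le_antisymm (by simpa using hxB) (by simpa using hx))
    · exact Set.indicator_of_notMem hxB _
  · intro x hx
    have hx' : ‖x‖ ≤ R := by simpa using Metric.ball_subset_closedBall hx
    refine ((hkd x hx').differentiableAt one_ne_zero).congr_of_eventuallyEq ?_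
    filter_upwards [Metric.isOpen_ball.mem_nhds hx] with y hy
    exact Set.indicator_of_mem (Metric.ball_subset_closedBall hy) _
  · intro x hx
    have hx' : ‖x‖ ≤ R := by simpa using Metric.ball_subset_closedBall hx
    rw [Set.indicator_of_mem (Metric.ball_subset_closedBall hx)]
    have hD : 0 < ‖x - N x‖ := norm_pos_iff.2 (hNne x hx')
    have hsq : ‖x + k x‖ ^ 2 = R ^ 2 := by
      have h1 : ‖x - N x‖ ^ 2 = ‖x‖ ^ 2 - 2 * inner ℝ x (N x) + R ^ 2 := by
        rw [norm_sub_sq_real, hNnorm x hx']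
      have h2 : inner ℝ x (x - N x) = ‖x‖ ^ 2 - inner ℝ x (N x) := by
        rw [inner_sub_right, real_inner_self_eq_norm_sq]
      simp only [k]
      rw [norm_add_sq_real, inner_smul_right, norm_smul, Real.norm_eq_abs, mul_pow, sq_abs, h2]
      have h3 : inner ℝ x (N x) = (‖x‖ ^ 2 + R ^ 2 - ‖x - N x‖ ^ 2) / 2 := by linarith
      rw [h3]
      field_simp
      ring
    exact (pow_left_inj₀ (norm_nonneg _) hR.le two_ne_zero).1 hsq

/-- A continuous vector field pointing outwards on a sphere has a zero inside. -/
theorem exists_zero_of_continuous {R : ℝ} (hR : 0 < R) {G : Euc n → Euc n} (hG : Continuous G)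
    (hpos : ∀ x, ‖x‖ = R → 0 < inner ℝ (G x) x) : ∃ x, ‖x‖ ≤ R ∧ G x = 0 := by
  by_contra hcon
  push Not at hcon
  have hcl : IsCompact (Metric.closedBall (0 : Euc n) R) := isCompact_closedBall 0 R
  have hsp : IsCompact (Metric.sphere (0 : Euc n) R) := isCompact_sphere 0 R
  obtain ⟨ε₁, hε₁, h1⟩ : ∃ ε > 0, ∀ x, ‖x‖ ≤ R → ε ≤ ‖G x‖ := by
    obtain ⟨x, hx, hmin⟩ := hcl.exists_isMinOn ⟨0, by simp [hR.le]⟩ hG.norm.continuousOn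
    exact ⟨‖G x‖, norm_pos_iff.2 (hcon x (by simpa using hx)),
      fun y hy => hmin (by simpa using hy)⟩
  obtain ⟨ε₂, hε₂, h2⟩ : ∃ ε > 0, ∀ x, ‖x‖ = R → ε ≤ inner ℝ (G x) x := by
    -- The sphere is empty in dimension 0, where no minimum over it exists.
    rcases (Metric.sphere (0 : Euc n) R).eq_empty_or_nonempty with he | hne
    · refine ⟨1, one_pos, fun x hx => ?_⟩
      have : x ∈ Metric.sphere (0 : Euc n) R := by simpa using hx
      rw [he] at this
      exact this.elim
    · have hc : Continuous fun x => (inner ℝ (G x) x : ℝ) := by fun_prop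
      obtain ⟨x, hx, hmin⟩ := hsp.exists_isMinOn hne hc.continuousOn
      exact ⟨inner ℝ (G x) x, hpos x (by simpa using hx), fun y hy => hmin (by simpa using hy)⟩
  -- Closeness ε₂/(2R) keeps the smooth field pointing outwards on the sphere. Closeness ε₁ keeps it
  -- from vanishing anywhere in the ball.
  obtain ⟨H, hH, happ, -⟩ := hG.exists_contDiff_approx 1
    (ε := fun _ => min ε₁ (ε₂ / (2 * R))) continuous_const
    (fun _ => lt_min hε₁ (by positivity))
  obtain ⟨x, hx, hx0⟩ := exists_zero_of_contDiff hR (G := H) hH (by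
    intro x hx
    have h3 := (happ x).trans_le (min_le_right _ _)
    have h4 := h2 x hx
    have h5 := abs_real_inner_le_norm (H x - G x) x
    rw [hx, ← dist_eq_norm, inner_sub_left] at h5
    have h6 : dist (H x) (G x) * R < ε₂ := by
      calc dist (H x) (G x) * R < ε₂ / (2 * R) * R := mul_lt_mul_of_pos_right h3 hR
        _ = ε₂ / 2 := by field_simp
        _ < ε₂ := by linarith
    have h7 := (abs_le.1 h5).1
    linarith)
  have h3 := (happ x).trans_le (min_le_left _ _)
  rw [hx0, dist_eq_norm, zero_sub, norm_neg] at h3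
  linarith [h1 x hx]

end Brouwer

end WG

/-! ### Polynomial vector fields and the discrete weak gradient -/

namespace WG
open Filter Topology

theorem eq_zero_of_pval_eq_zero {d : ℕ} {p : MvPolynomial (Fin d) ℝ} {U : Set (Euc d)}
    (hU : IsOpen U) (hne : U.Nonempty) (h : ∀ x ∈ U, pval p x = 0) : p = 0 := by
  obtain ⟨x, hx⟩ := hne
  obtain ⟨r, hr, hb⟩ := Metric.isOpen_iff.1 (hU.preimage (PiLp.continuous_toLp 2 fun _ : Fin d => ℝ))
    (fun i => x i) hx
  refine MvPolynomial.funext_set (fun i => Metric.ball (x i) r) (fun i => ?_) fun y hy => ?_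
  · rw [Real.ball_eq_Ioo]
    exact Set.Ioo_infinite (by linarith)
  · have hy' : y ∈ Metric.ball (fun i => x i) r := by
      rw [ball_pi _ hr]
      exact hy
    have := h _ (hb hy')
    simpa [pval] using this

/-- Finite-dimensional Lax–Milgram: definiteness gives injectivity, and a space and its dual have
the same dimension. It produces both the weak gradient and the L² projection on a boundary face. -/
theorem surjective_of_posDef {V : Type*} [AddCommGroup V] [Module ℝ V] [FiniteDimensional ℝ V]
    (B : V →ₗ[ℝ] V →ₗ[ℝ] ℝ) (hdef : ∀ v, B v v = 0 → v = 0) : Function.Surjective B := by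
  have hinj : Function.Injective B := by
    rw [← LinearMap.ker_eq_bot, LinearMap.ker_eq_bot']
    intro v hv
    exact hdef v (by rw [hv]; rfl)
  exact (LinearMap.injective_iff_surjective_of_finrank_eq_finrank
    (Subspace.dual_finrank_eq (K := ℝ) (V := V)).symm).1 hinj

section PolyVec

variable {d r : ℕ}

@[fun_prop]
theorem PolyVec.continuous_val (q : PolyVec d r) : Continuous q.val := by
  unfold PolyVec.val
  exact (PiLp.continuous_toLp 2 fun _ : Fin d => ℝ).comp
    (continuous_pi fun i => continuous_pval _)

@[fun_prop]
theorem PolyVec.continuous_div (q : PolyVec d r) : Continuous q.div := by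
  unfold PolyVec.div
  exact continuous_pval _

theorem PolyVec.val_apply (q : PolyVec d r) (x : Euc d) (i : Fin d) :
    q.val x i = pval (q i : MvPolynomial (Fin d) ℝ) x := rfl

theorem PolyVec.val_add (q q' : PolyVec d r) (x : Euc d) : (q + q').val x = q.val x + q'.val x := by
  ext i; simp [PolyVec.val_apply, pval_add]

theorem PolyVec.val_smul (c : ℝ) (q : PolyVec d r) (x : Euc d) : (c • q).val x = c • q.val x := by
  ext i; simp [PolyVec.val_apply, pval_smul]

theorem PolyVec.div_add (q q' : PolyVec d r) (x : Euc d) : (q + q').div x = q.div x + q'.div x := by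
  simp [PolyVec.div, pval_sum, pval_add, Finset.sum_add_distrib]

theorem PolyVec.div_smul (c : ℝ) (q : PolyVec d r) (x : Euc d) : (c • q).div x = c * q.div x := by
  simp [PolyVec.div, pval_sum, pval_smul, Finset.mul_sum]

theorem PolyVec.inner_val (q q' : PolyVec d r) (x : Euc d) : inner ℝ (q.val x) (q'.val x) =
    ∑ i, pval (q i : MvPolynomial (Fin d) ℝ) x * pval (q' i : MvPolynomial (Fin d) ℝ) x := by
  rw [PiLp.inner_apply]
  exact Finset.sum_congr rfl fun i _ => by simp [PolyVec.val_apply, mul_comm]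

/-- The gradient of a polynomial. -/
noncomputable def polyGrad {k : ℕ} {p : MvPolynomial (Fin d) ℝ} (hp : p ∈ Poly d k) :
    PolyVec d (k - 1) := fun i => ⟨MvPolynomial.pderiv i p, pderiv_mem_poly hp i⟩

end PolyVec

section Mesh

variable {d : ℕ} {Ω : Set (Euc d)} (M : PolytopalMesh Ω) {k : ℕ}

namespace PolytopalMesh

theorem integrableOn_face_of_continuousOn (e : M.faces) {F : Euc d → ℝ}
    (hF : ContinuousOn F (e : Set (Euc d))) : IntegrableOn F (e : Set (Euc d)) (surf d) := by
  obtain ⟨C, hC⟩ := (M.isCompact_face e).exists_bound_of_continuousOn hF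
  exact Integrable.of_bound (C := C) (hF.aestronglyMeasurable (M.isCompact_face e).measurableSet)
    ((ae_restrict_iff' (M.isCompact_face e).measurableSet).2 (Eventually.of_forall hC))

theorem integrableOn_cell_of_continuousOn (T : M.cells) {F : Euc d → ℝ}
    (hF : ContinuousOn F (T : Set (Euc d))) : IntegrableOn F (T : Set (Euc d)) :=
  hF.integrableOn_compact (M.isCompact_cell T)

theorem exists_poly_v0 (v : M.V k) (T : M.cells) :
    ∃ p ∈ Poly d k, ∀ x ∈ (T : Set (Euc d)), M.v0 v T x = pval p x := by
  obtain ⟨p, hp, h⟩ := (v.1 T).2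
  exact ⟨p, hp, fun x hx => by simp only [v0, h, Set.indicator_of_mem hx]⟩

theorem exists_poly_vb (v : M.V k) (e : M.faces) :
    ∃ p ∈ Poly d k, ∀ x ∈ (e : Set (Euc d)), M.vb v e x = pval p x := by
  obtain ⟨p, hp, h⟩ := (v.2 e).2
  exact ⟨p, hp, fun x hx => by simp only [vb, h, Set.indicator_of_mem hx]⟩

theorem v0_of_notMem (v : M.V k) (T : M.cells) {x : Euc d} (hx : x ∉ (T : Set (Euc d))) :
    M.v0 v T x = 0 := by
  obtain ⟨p, hp, h⟩ := (v.1 T).2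
  simp only [v0, h, Set.indicator_of_notMem hx]

theorem continuousOn_v0 (v : M.V k) (T : M.cells) : ContinuousOn (M.v0 v T) (T : Set (Euc d)) := by
  obtain ⟨p, -, h⟩ := M.exists_poly_v0 v T
  exact (continuous_pval p).continuousOn.congr h

theorem continuousOn_vb (v : M.V k) (e : M.faces) : ContinuousOn (M.vb v e) (e : Set (Euc d)) := by
  obtain ⟨p, -, h⟩ := M.exists_poly_vb v e
  exact (continuous_pval p).continuousOn.congr h

theorem face_subset {T : M.cells} {e : M.faces} (he : e ∈ M.facesOf T) :
    (e : Set (Euc d)) ⊆ (T : Set (Euc d)) :=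
  (M.mem_facesOf.1 he).trans (M.isCompact_cell T).isClosed.frontier_subset

theorem v0_add (v w : M.V k) (T : M.cells) (x : Euc d) :
    M.v0 (v + w) T x = M.v0 v T x + M.v0 w T x := rfl

theorem v0_smul (c : ℝ) (v : M.V k) (T : M.cells) (x : Euc d) :
    M.v0 (c • v) T x = c * M.v0 v T x := rfl

theorem vb_add (v w : M.V k) (e : M.faces) (x : Euc d) :
    M.vb (v + w) e x = M.vb v e x + M.vb w e x := rfl

theorem vb_smul (c : ℝ) (v : M.V k) (e : M.faces) (x : Euc d) :
    M.vb (c • v) e x = c * M.vb v e x := rfl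

/-! ### The weak gradient -/

/-- The `L²(T)` inner product of polynomial vector fields. -/
noncomputable def gradForm (T : M.cells) (r : ℕ) :
    PolyVec d r →ₗ[ℝ] PolyVec d r →ₗ[ℝ] ℝ := LinearMap.mk₂ ℝ
  (fun G q => ∫ x in (T : Set (Euc d)), inner ℝ (G.val x) (q.val x))
  (fun G G' q => by
    rw [← integral_add (M.integrableOn_cell T (by fun_prop)) (M.integrableOn_cell T (by fun_prop))]
    simp only [PolyVec.val_add, inner_add_left])
  (fun c G q => by
    rw [smul_eq_mul, ← integral_const_mul]
    simp only [PolyVec.val_smul, real_inner_smul_left])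
  (fun G q q' => by
    rw [← integral_add (M.integrableOn_cell T (by fun_prop)) (M.integrableOn_cell T (by fun_prop))]
    simp only [PolyVec.val_add, inner_add_right])
  (fun c G q => by
    rw [smul_eq_mul, ← integral_const_mul]
    simp only [PolyVec.val_smul, real_inner_smul_right])

theorem gradForm_apply (T : M.cells) (r : ℕ) (G q : PolyVec d r) :
    M.gradForm T r G q = ∫ x in (T : Set (Euc d)), inner ℝ (G.val x) (q.val x) := rfl

/-- The integrand vanishes almost everywhere, hence by continuity on the nonempty interior of the
element, and a polynomial vanishing on an open set is zero. -/
theorem gradForm_def (T : M.cells) (r : ℕ) (G : PolyVec d r) (h : M.gradForm T r G G = 0) :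
    G = 0 := by
  rw [gradForm_apply] at h
  have hnn : ∀ x, 0 ≤ (inner ℝ (G.val x) (G.val x) : ℝ) := fun x => real_inner_self_nonneg
  have h0 := (setIntegral_eq_zero_iff_of_nonneg_ae (Eventually.of_forall hnn)
    (M.integrableOn_cell T (by fun_prop))).1 h
  have h1 : ∀ x ∈ interior (T : Set (Euc d)), G.val x = 0 := by
    have h2 := ae_restrict_of_ae_restrict_of_subset interior_subset h0
    have h3 := Measure.eqOn_open_of_ae_eq h2 isOpen_interior
      (by fun_prop) (by fun_prop)
    exact fun x hx => inner_self_eq_zero.1 (h3 hx)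
  funext i
  refine Subtype.ext (eq_zero_of_pval_eq_zero isOpen_interior
    (M.isElement' T).interior_nonempty fun x hx => ?_)
  have := congrArg (fun v : Euc d => v i) (h1 x hx)
  exact this

/-- The right-hand side in the definition of the weak gradient. -/
noncomputable def weakGradForm (T : M.cells) (k : ℕ) :
    M.V k →ₗ[ℝ] PolyVec d (k - 1) →ₗ[ℝ] ℝ := LinearMap.mk₂ ℝ
  (fun v q => -(∫ x in (T : Set (Euc d)), M.v0 v T x * q.div x) +
      ∑ e ∈ M.facesOf T, ∫ x in (e : Set (Euc d)),
        M.vb v e x * inner ℝ (q.val x) (outwardNormal (T : Set (Euc d)) e) ∂(surf d))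
  (fun v w q => by
    have h1 : ∀ v : M.V k, IntegrableOn (fun x => M.v0 v T x * q.div x) (T : Set (Euc d)) :=
      fun v => M.integrableOn_cell_of_continuousOn T
        ((M.continuousOn_v0 v T).mul (by fun_prop))
    have h2 : ∀ (v : M.V k) (e : M.faces), IntegrableOn (fun x => M.vb v e x *
        inner ℝ (q.val x) (outwardNormal (T : Set (Euc d)) e)) (e : Set (Euc d)) (surf d) :=
      fun v e => M.integrableOn_face_of_continuousOn e
        ((M.continuousOn_vb v e).mul (by fun_prop))
    simp only [v0_add, vb_add, add_mul]
    rw [integral_add (h1 v) (h1 w), Finset.sum_congr rfl fun e _ => integral_add (h2 v e) (h2 w e),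
      Finset.sum_add_distrib]
    ring)
  (fun c v q => by
    simp only [v0_smul, vb_smul, mul_assoc, integral_const_mul, ← Finset.mul_sum, smul_eq_mul]
    ring)
  (fun v q q' => by
    have h1 : ∀ q : PolyVec d (k - 1),
        IntegrableOn (fun x => M.v0 v T x * q.div x) (T : Set (Euc d)) :=
      fun q => M.integrableOn_cell_of_continuousOn T
        ((M.continuousOn_v0 v T).mul (by fun_prop))
    have h2 : ∀ (q : PolyVec d (k - 1)) (e : M.faces), IntegrableOn (fun x => M.vb v e x *
        inner ℝ (q.val x) (outwardNormal (T : Set (Euc d)) e)) (e : Set (Euc d)) (surf d) :=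
      fun q e => M.integrableOn_face_of_continuousOn e
        ((M.continuousOn_vb v e).mul (by fun_prop))
    simp only [PolyVec.div_add, PolyVec.val_add, inner_add_left, mul_add]
    rw [integral_add (h1 q) (h1 q'),
      Finset.sum_congr rfl fun e _ => integral_add (h2 q e) (h2 q' e), Finset.sum_add_distrib]
    ring)
  (fun c v q => by
    simp only [PolyVec.div_smul, PolyVec.val_smul, real_inner_smul_left, mul_left_comm _ c,
      integral_const_mul, ← Finset.mul_sum, smul_eq_mul]
    ring)

theorem isWeakGrad_iff (v : M.V k) (T : M.cells) (G : PolyVec d (k - 1)) :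
    M.IsWeakGrad v T G ↔ M.gradForm T (k - 1) G = M.weakGradForm T k v :=
  ⟨fun h => LinearMap.ext h, fun h q => LinearMap.congr_fun h q⟩

/-- The defining functional is represented in the positive definite L² form, so the choice is never
void. Uniqueness of the representative gives linearity of the weak gradient. -/
theorem isWeakGrad_weakGrad (v : M.V k) (T : M.cells) : M.IsWeakGrad v T (M.weakGrad v T) := by
  refine Classical.epsilon_spec ?_
  obtain ⟨G, hG⟩ := surjective_of_posDef (M.gradForm T (k - 1)) (M.gradForm_def T _)
    (M.weakGradForm T k v)
  exact ⟨G, (M.isWeakGrad_iff v T G).2 hG⟩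

theorem gradForm_weakGrad (v : M.V k) (T : M.cells) :
    M.gradForm T (k - 1) (M.weakGrad v T) = M.weakGradForm T k v :=
  (M.isWeakGrad_iff v T _).1 (M.isWeakGrad_weakGrad v T)

theorem gradForm_injective (T : M.cells) (r : ℕ) : Function.Injective (M.gradForm T r) := by
  rw [← LinearMap.ker_eq_bot, LinearMap.ker_eq_bot']
  intro v hv
  exact M.gradForm_def T r v (by rw [hv]; rfl)

theorem weakGrad_add (v w : M.V k) (T : M.cells) :
    M.weakGrad (v + w) T = M.weakGrad v T + M.weakGrad w T :=
  M.gradForm_injective T _ (by rw [map_add, gradForm_weakGrad, gradForm_weakGrad,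
    gradForm_weakGrad, map_add])

theorem weakGrad_smul (c : ℝ) (v : M.V k) (T : M.cells) :
    M.weakGrad (c • v) T = c • M.weakGrad v T :=
  M.gradForm_injective T _ (by rw [map_smul, gradForm_weakGrad, gradForm_weakGrad, map_smul])

/-- Integration by parts: the weak gradient in terms of the gradient and the jumps. -/
theorem integral_weakGrad (v : M.V k) (T : M.cells) {p : MvPolynomial (Fin d) ℝ}
    (hp : p ∈ Poly d k) (hpv : ∀ x ∈ (T : Set (Euc d)), M.v0 v T x = pval p x)
    (q : PolyVec d (k - 1)) :
    ∫ x in (T : Set (Euc d)), inner ℝ ((M.weakGrad v T).val x) (q.val x) =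
      (∫ x in (T : Set (Euc d)), inner ℝ ((polyGrad hp).val x) (q.val x)) -
      ∑ e ∈ M.facesOf T, ∫ x in (e : Set (Euc d)), (M.v0 v T x - M.vb v e x) *
        inner ℝ (q.val x) (outwardNormal (T : Set (Euc d)) e) ∂(surf d) := by
  rw [M.isWeakGrad_weakGrad v T q]
  have hcell : ∫ x in (T : Set (Euc d)), M.v0 v T x * q.div x =
      (∑ e ∈ M.facesOf T, ∫ x in (e : Set (Euc d)), M.v0 v T x *
        inner ℝ (q.val x) (outwardNormal (T : Set (Euc d)) e) ∂(surf d)) -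
      ∫ x in (T : Set (Euc d)), inner ℝ ((polyGrad hp).val x) (q.val x) := by
    -- The product rule Σ ∂_i(p q_i) = ∇p · q + p div q, prepared so that the divergence theorem
    -- applies to each polynomial p q_i.
    have h1 : ∫ x in (T : Set (Euc d)), M.v0 v T x * q.div x =
        (∑ i, ∫ x in (T : Set (Euc d)), pval (MvPolynomial.pderiv i (p * (q i).1)) x) -
        ∫ x in (T : Set (Euc d)), inner ℝ ((polyGrad hp).val x) (q.val x) := by
      rw [← integral_finsetSum _ fun i _ => M.integrableOn_cell T (continuous_pval _),
        ← integral_sub (integrable_finsetSum _ fun i _ => M.integrableOn_cell T (continuous_pval _))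
          (M.integrableOn_cell T (by fun_prop))]
      refine setIntegral_congr_fun (M.isCompact_cell T).measurableSet fun x hx => ?_
      simp only [hpv x hx, PolyVec.div, pval_sum, PolyVec.inner_val, polyGrad, Derivation.leibniz,
        pval_add, smul_eq_mul, pval_mul, Finset.mul_sum, Finset.sum_add_distrib]
      rw [eq_sub_iff_add_eq]
      congr 1
      exact Finset.sum_congr rfl fun i _ => mul_comm _ _
    rw [h1]
    congr 1
    simp_rw [M.integral_pderiv]
    rw [Finset.sum_comm]
    refine Finset.sum_congr rfl fun e he => ?_
    rw [← integral_finsetSum _ fun i _ => M.integrableOn_face e (by fun_prop)]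
    refine setIntegral_congr_fun (M.isCompact_face e).measurableSet fun x hx => ?_
    simp only [hpv x (M.face_subset he hx), pval_mul, PiLp.inner_apply, Finset.mul_sum]
    refine Finset.sum_congr rfl fun i _ => ?_
    simp [PolyVec.val_apply]
    ring
  have hface : ∀ e ∈ M.facesOf T, ∫ x in (e : Set (Euc d)), (M.v0 v T x - M.vb v e x) *
        inner ℝ (q.val x) (outwardNormal (T : Set (Euc d)) e) ∂(surf d) =
      (∫ x in (e : Set (Euc d)), M.v0 v T x *
        inner ℝ (q.val x) (outwardNormal (T : Set (Euc d)) e) ∂(surf d)) -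
      ∫ x in (e : Set (Euc d)), M.vb v e x *
        inner ℝ (q.val x) (outwardNormal (T : Set (Euc d)) e) ∂(surf d) := by
    intro e he
    rw [← integral_sub]
    · simp only [sub_mul]
    · exact M.integrableOn_face_of_continuousOn e
        (((M.continuousOn_v0 v T).mono (M.face_subset he)).mul (by fun_prop))
    · exact M.integrableOn_face_of_continuousOn e ((M.continuousOn_vb v e).mul (by fun_prop))
  rw [hcell, Finset.sum_congr rfl hface, Finset.sum_sub_distrib]
  ring

end PolytopalMesh

end Mesh

end WG

/-! ### Energy terms and the discrete Poincaré inequality -/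

namespace WG
open Filter Topology

section Mesh

variable {d : ℕ} {Ω : Set (Euc d)} (M : PolytopalMesh Ω) {k : ℕ}

namespace PolytopalMesh

/-- The squared `L²(T)` norm of the weak gradient. -/
noncomputable def gradSq (v : M.V k) (T : M.cells) : ℝ :=
  ∫ x in (T : Set (Euc d)), ‖(M.weakGrad v T).val x‖ ^ 2

/-- The jump term `h_T⁻¹ ‖v₀ - v_b‖²` on `∂T`. -/
noncomputable def jumpSq (v : M.V k) (T : M.cells) : ℝ :=
  (Metric.diam (T : Set (Euc d)))⁻¹ * ∑ e ∈ M.facesOf T, ∫ x in (e : Set (Euc d)),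
    (M.v0 v T x - M.vb v e x) ^ 2 ∂(surf d)

theorem gradSq_nonneg (v : M.V k) (T : M.cells) : 0 ≤ M.gradSq v T :=
  integral_nonneg fun _ => sq_nonneg _

theorem jumpSq_nonneg (v : M.V k) (T : M.cells) : 0 ≤ M.jumpSq v T :=
  mul_nonneg (inv_nonneg.2 Metric.diam_nonneg)
    (Finset.sum_nonneg fun _ _ => integral_nonneg fun _ => sq_nonneg _)

theorem continuousOn_jump (v : M.V k) {T : M.cells} {e : M.faces} (he : e ∈ M.facesOf T) :
    ContinuousOn (fun x => M.v0 v T x - M.vb v e x) (e : Set (Euc d)) :=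
  ((M.continuousOn_v0 v T).mono (M.face_subset he)).sub (M.continuousOn_vb v e)

theorem norm_polyGrad_sq {p : MvPolynomial (Fin d) ℝ} (hp : p ∈ Poly d k) (x : Euc d) :
    ‖(polyGrad hp).val x‖ ^ 2 = ∑ i, pval (MvPolynomial.pderiv i p) x ^ 2 := by
  rw [← real_inner_self_eq_norm_sq, PolyVec.inner_val]
  exact Finset.sum_congr rfl fun i _ => by rw [sq]; rfl

theorem sum_trace_le {T : M.cells} {C : ℝ} {N : ℕ} (hC : 0 < C)
    (hN : (M.facesOf T).card ≤ N)
    (htr : ∀ e ∈ M.facesOf T, ∀ p ∈ Poly d k, ∫ x in (e : Set (Euc d)), pval p x ^ 2 ∂(surf d) ≤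
          C * (Metric.diam (T : Set (Euc d)))⁻¹ * ∫ x in (T : Set (Euc d)), pval p x ^ 2)
    {p : MvPolynomial (Fin d) ℝ} (hp : p ∈ Poly d k) :
    ∑ e ∈ M.facesOf T, ∫ x in (e : Set (Euc d)), pval p x ^ 2 ∂(surf d) ≤
      N * C * (Metric.diam (T : Set (Euc d)))⁻¹ * ∫ x in (T : Set (Euc d)), pval p x ^ 2 := by
  refine (Finset.sum_le_card_nsmul _ _ _ fun e he => htr e he p hp).trans ?_
  have h0 : 0 ≤ C * (Metric.diam (T : Set (Euc d)))⁻¹ * ∫ x in (T : Set (Euc d)), pval p x ^ 2 :=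
    mul_nonneg (mul_nonneg hC.le (inv_nonneg.2 Metric.diam_nonneg))
      (integral_nonneg fun _ => sq_nonneg _)
  rw [nsmul_eq_mul]
  calc ((M.facesOf T).card : ℝ) * _ ≤ N * _ :=
        mul_le_mul_of_nonneg_right (by exact_mod_cast hN) h0
    _ = _ := by ring

/-- Young's inequality with weight `s`, taken pointwise by completing a square. -/
theorem abs_integral_face_le (e : M.faces) {J Q A : Euc d → ℝ}
    (hJ : ContinuousOn J (e : Set (Euc d))) (hQ : Continuous Q) (hA : Continuous A) {s : ℝ}
    (hs : 0 < s) (hQA : ∀ x ∈ (e : Set (Euc d)), |Q x| ≤ A x) :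
    |∫ x in (e : Set (Euc d)), J x * Q x ∂(surf d)| ≤
      s * ∫ x in (e : Set (Euc d)), J x ^ 2 ∂(surf d) +
        (4 * s)⁻¹ * ∫ x in (e : Set (Euc d)), A x ^ 2 ∂(surf d) := by
  refine (abs_integral_le_integral_abs).trans ?_
  rw [← integral_const_mul, ← integral_const_mul, ← integral_add
    (M.integrableOn_face_of_continuousOn e (by fun_prop))
    (M.integrableOn_face_of_continuousOn e (by fun_prop))]
  refine setIntegral_mono_on (M.integrableOn_face_of_continuousOn e (by fun_prop))
    (M.integrableOn_face_of_continuousOn e (by fun_prop)) (M.isCompact_face e).measurableSet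
    fun x hx => ?_
  have h1 := hQA x hx
  have h2 : |J x * Q x| ≤ |J x| * A x := by
    rw [abs_mul]; exact mul_le_mul_of_nonneg_left h1 (abs_nonneg _)
  have h3 : s * J x ^ 2 + (4 * s)⁻¹ * A x ^ 2 - |J x| * A x =
      s * (|J x| - A x / (2 * s)) ^ 2 := by
    rw [← sq_abs (J x)]; field_simp; ring
  have h4 : 0 ≤ s * (|J x| - A x / (2 * s)) ^ 2 := by positivity
  linarith

theorem pderiv_mem_poly' {p : MvPolynomial (Fin d) ℝ} (hp : p ∈ Poly d k) (i : Fin d) :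
    MvPolynomial.pderiv i p ∈ Poly d k := by
  have h := pderiv_mem_poly hp i
  rw [MvPolynomial.mem_restrictTotalDegree] at h ⊢
  omega

/-- Pointwise exchange of v₀² for v_b² in a boundary flux: p² − b² = −(p − b)² + 2(p − b)p. Young's
inequality with weights K/h and h/K splits the cross term, and h ≤ 2R turns the pure square into a
multiple of h⁻¹(p − b)². The factor h in the p² term matches the h⁻¹ of the trace inequality, and
`K` is left free so that this term can be absorbed. -/
theorem jump_bound {h R K p b y n : ℝ} (hh : 0 < h) (hhR : h ≤ 2 * R) (hK : 0 < K)
    (hy : |y| ≤ R) (hn : |n| ≤ 1) :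
    p * p * y * n ≤ R * (2 * R + K) * (h⁻¹ * (p - b) ^ 2) + R * (h / K) * p ^ 2 +
      b ^ 2 * y * n := by
  have hR : 0 ≤ R := (abs_nonneg y).trans hy
  have h1 : |y * n| ≤ R := by
    rw [abs_mul]
    calc |y| * |n| ≤ R * 1 := mul_le_mul hy hn (abs_nonneg _) hR
      _ = R := mul_one R
  have h2 : (p * p - b ^ 2) * (y * n) ≤ |p * p - b ^ 2| * R := by
    refine (le_abs_self _).trans ?_
    rw [abs_mul]
    exact mul_le_mul_of_nonneg_left h1 (abs_nonneg _)
  have h3 : |p * p - b ^ 2| ≤ (p - b) ^ 2 + 2 * |p - b| * |p| := by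
    have : p * p - b ^ 2 = -(p - b) ^ 2 + 2 * (p - b) * p := by ring
    rw [this]
    refine (abs_add_le _ _).trans (le_of_eq ?_)
    rw [abs_neg, abs_of_nonneg (sq_nonneg (p - b)), abs_mul, abs_mul, abs_two]
  have h4 : 2 * |p - b| * |p| ≤ K / h * (p - b) ^ 2 + h / K * p ^ 2 := by
    have e : K / h * (p - b) ^ 2 + h / K * p ^ 2 - 2 * |p - b| * |p| =
        K / h * (|p - b| - h / K * |p|) ^ 2 := by
      rw [← sq_abs (p - b), ← sq_abs p]; field_simp; ring
    have : 0 ≤ K / h * (|p - b| - h / K * |p|) ^ 2 := by positivity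
    linarith
  have h5 : (p - b) ^ 2 ≤ 2 * R * (h⁻¹ * (p - b) ^ 2) := by
    have : 1 ≤ 2 * R * h⁻¹ := by rw [← div_eq_mul_inv, one_le_div hh]; exact hhR
    nlinarith [sq_nonneg (p - b)]
  have h6 : |p * p - b ^ 2| * R ≤
      (2 * R * (h⁻¹ * (p - b) ^ 2) + (K / h * (p - b) ^ 2 + h / K * p ^ 2)) * R :=
    mul_le_mul_of_nonneg_right (by linarith) hR
  have h7 : (2 * R * (h⁻¹ * (p - b) ^ 2) + (K / h * (p - b) ^ 2 + h / K * p ^ 2)) * R =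
      R * (2 * R + K) * (h⁻¹ * (p - b) ^ 2) + R * (h / K) * p ^ 2 := by
    field_simp; ring
  linarith

/-- The gradient of `v₀` is controlled by the weak gradient and the jumps. -/
theorem grad_le (hd : 1 ≤ d) (v : M.V k) {T : M.cells} {C : ℝ} {N : ℕ} (hC : 0 < C)
    (hN : (M.facesOf T).card ≤ N)
    (htr : ∀ e ∈ M.facesOf T, ∀ p ∈ Poly d k, ∫ x in (e : Set (Euc d)), pval p x ^ 2 ∂(surf d) ≤
          C * (Metric.diam (T : Set (Euc d)))⁻¹ * ∫ x in (T : Set (Euc d)), pval p x ^ 2)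
    {p : MvPolynomial (Fin d) ℝ} (hp : p ∈ Poly d k)
    (hpv : ∀ x ∈ (T : Set (Euc d)), M.v0 v T x = pval p x) :
    ∫ x in (T : Set (Euc d)), ‖(polyGrad hp).val x‖ ^ 2 ≤
      2 * M.gradSq v T + 2 * (N * C + 1) * M.jumpSq v T := by
  set h := Metric.diam (T : Set (Euc d)) with hh
  have hpos : 0 < h := (M.isElement' T).diam_pos hd
  set g := ∫ x in (T : Set (Euc d)), ‖(polyGrad hp).val x‖ ^ 2 with hg
  -- Young's weight K/h on the jump leaves, after the trace inequality, at most (NC/K) g/4 ≤ g/4 of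
  -- the gradient. Another g/4 comes from the weak gradient term, so half of g survives on the left.
  set K : ℝ := N * C + 1 with hK
  have hKpos : 0 < K := by positivity
  have hg0 : 0 ≤ g := integral_nonneg fun _ => sq_nonneg _
  have hid := M.integral_weakGrad v T hp hpv (polyGrad hp)
  simp only [real_inner_self_eq_norm_sq] at hid
  -- the weak gradient term
  have h1 : ∫ x in (T : Set (Euc d)), inner ℝ ((M.weakGrad v T).val x) ((polyGrad hp).val x) ≤
      M.gradSq v T + g / 4 := by
    rw [gradSq, hg, ← integral_div, ← integral_add (M.integrableOn_cell T (by fun_prop))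
      (M.integrableOn_cell T (by fun_prop))]
    refine integral_mono (M.integrableOn_cell T (by fun_prop))
      (M.integrableOn_cell T (by fun_prop)) fun x => ?_
    have := real_inner_le_norm ((M.weakGrad v T).val x) ((polyGrad hp).val x)
    nlinarith [sq_nonneg (‖(M.weakGrad v T).val x‖ - ‖(polyGrad hp).val x‖ / 2)]
  -- the boundary term
  have h2 : ∀ e ∈ M.facesOf T, |∫ x in (e : Set (Euc d)), (M.v0 v T x - M.vb v e x) *
        inner ℝ ((polyGrad hp).val x) (outwardNormal (T : Set (Euc d)) e) ∂(surf d)| ≤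
      K / h * ∫ x in (e : Set (Euc d)), (M.v0 v T x - M.vb v e x) ^ 2 ∂(surf d) +
        (4 * (K / h))⁻¹ * ∫ x in (e : Set (Euc d)), ‖(polyGrad hp).val x‖ ^ 2 ∂(surf d) := by
    intro e he
    refine M.abs_integral_face_le e (M.continuousOn_jump v he) (by fun_prop) (by fun_prop)
      (by positivity) fun x _ => ?_
    have := abs_real_inner_le_norm ((polyGrad hp).val x) (outwardNormal (T : Set (Euc d)) e)
    rwa [(M.isOutwardNormal he).1, mul_one] at this
  have h3 : ∑ e ∈ M.facesOf T, ∫ x in (e : Set (Euc d)), ‖(polyGrad hp).val x‖ ^ 2 ∂(surf d) ≤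
      N * C * h⁻¹ * g := by
    have e1 : ∀ e ∈ M.facesOf T, ∫ x in (e : Set (Euc d)), ‖(polyGrad hp).val x‖ ^ 2 ∂(surf d) =
        ∑ i, ∫ x in (e : Set (Euc d)), pval (MvPolynomial.pderiv i p) x ^ 2 ∂(surf d) := by
      intro e he
      simp_rw [norm_polyGrad_sq]
      exact integral_finsetSum _ fun i _ => M.integrableOn_face e (by fun_prop)
    have e2 : g = ∑ i, ∫ x in (T : Set (Euc d)), pval (MvPolynomial.pderiv i p) x ^ 2 := by
      rw [hg]
      simp_rw [norm_polyGrad_sq]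
      exact integral_finsetSum _ fun i _ => M.integrableOn_cell T (by fun_prop)
    rw [Finset.sum_congr rfl e1, Finset.sum_comm, e2, Finset.mul_sum]
    exact Finset.sum_le_sum fun i _ => M.sum_trace_le hC hN htr (pderiv_mem_poly' hp i)
  have h4 := Finset.sum_le_sum h2
  rw [Finset.sum_add_distrib, ← Finset.mul_sum, ← Finset.mul_sum] at h4
  have h5 := Finset.abs_sum_le_sum_abs (fun e : M.faces =>
    ∫ x in (e : Set (Euc d)), (M.v0 v T x - M.vb v e x) *
      inner ℝ ((polyGrad hp).val x) (outwardNormal (T : Set (Euc d)) e) ∂(surf d)) (M.facesOf T)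
  have h6 := (abs_le.1 (h5.trans h4)).2
  have h7 : (4 * (K / h))⁻¹ * ∑ e ∈ M.facesOf T, ∫ x in (e : Set (Euc d)),
      ‖(polyGrad hp).val x‖ ^ 2 ∂(surf d) ≤ g / 4 := by
    calc _ ≤ (4 * (K / h))⁻¹ * (N * C * h⁻¹ * g) := mul_le_mul_of_nonneg_left h3 (by positivity)
      _ = (N * C) / K * (g / 4) := by field_simp
      _ ≤ 1 * (g / 4) := mul_le_mul_of_nonneg_right
          ((div_le_one hKpos).2 (by linarith)) (by positivity)
      _ = g / 4 := one_mul _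
  have h8 : K / h * ∑ e ∈ M.facesOf T, ∫ x in (e : Set (Euc d)),
      (M.v0 v T x - M.vb v e x) ^ 2 ∂(surf d) = K * M.jumpSq v T := by
    rw [jumpSq, ← hh]; ring
  rw [h8] at h6
  change g ≤ _
  have h9 : ∫ x in (T : Set (Euc d)), ‖(polyGrad hp).val x‖ ^ 2 = g := rfl
  rw [h9] at hid
  linarith

/-- Discrete Poincaré inequality. -/
theorem exists_poincare (hd : 1 ≤ d) (k : ℕ) (Ω : Set (Euc d)) (hΩ : IsPolytopalDomain Ω)
    (c : ShapeConstants) : ∃ C : ℝ, 0 < C ∧ ∀ M : PolytopalMesh Ω, M.ShapeRegular c →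
      ∀ v ∈ M.V0 k, ∑ T : M.cells, ∫ x in (T : Set (Euc d)), M.v0 v T x ^ 2 ≤
        C * ∑ T : M.cells, (M.gradSq v T + M.jumpSq v T) := by
  obtain ⟨C, hC, htr⟩ := exists_trace hd k c
  obtain ⟨R, hRpos, hR⟩ : ∃ R : ℝ, 0 < R ∧ ∀ x ∈ closure Ω, ‖x‖ ≤ R := by
    obtain ⟨R, hR⟩ := hΩ.2.2.1.closure.exists_norm_le
    exact ⟨max R 1, lt_max_of_lt_right one_pos, fun x hx => (hR x hx).trans (le_max_left _ _)⟩
  set N := c.nFaces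
  -- Chosen so that R(h/K) times the traces of v₀² is at most a quarter of ‖v₀‖²_T.
  set K : ℝ := 4 * R * (N * C) + 1 with hK
  have hKpos : 0 < K := by positivity
  set A : ℝ := 16 * R ^ 2 * (N * C + 1) + 16 * R ^ 2 + 4 * R * (2 * R + K) with hA
  refine ⟨A, by positivity, fun M hM v hv => ?_⟩
  let i₀ : Fin d := ⟨0, hd⟩
  -- The only use of v ∈ V_h⁰: with v_b single-valued and zero on ∂Ω, the fluxes left over on the
  -- elements sum to zero.
  have hflux := M.sum_flux_eq_zero hd hΩ.1 (fun e x => M.vb v e x ^ 2 * x i₀)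
    (fun e he x _ => by simp only [hv e he, Pi.zero_apply]; ring) i₀
  have hcell : ∀ T : M.cells, ∫ x in (T : Set (Euc d)), M.v0 v T x ^ 2 ≤
      (∫ x in (T : Set (Euc d)), M.v0 v T x ^ 2) / 2 + A / 2 * (M.gradSq v T + M.jumpSq v T) +
      ∑ e ∈ M.facesOf T, ∫ x in (e : Set (Euc d)),
        M.vb v e x ^ 2 * x i₀ * outwardNormal (T : Set (Euc d)) e i₀ ∂(surf d) := by
    intro T
    set h := Metric.diam (T : Set (Euc d)) with hh
    have hpos : 0 < h := (M.isElement' T).diam_pos hd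
    have hTR : ∀ x ∈ (T : Set (Euc d)), ‖x‖ ≤ R := fun x hx => hR x (M.cell_subset T hx)
    have hh2R : h ≤ 2 * R := by
      refine Metric.diam_le_of_forall_dist_le (by positivity) fun x hx y hy => ?_
      rw [dist_eq_norm]
      linarith [norm_sub_le x y, hTR x hx, hTR y hy]
    obtain ⟨p, hp, hpv⟩ := M.exists_poly_v0 v T
    have hcard := hM.card_facesOf T
    have htrT := htr M hM T
    set m := ∫ x in (T : Set (Euc d)), pval p x ^ 2 with hm
    have hm0 : 0 ≤ m := integral_nonneg fun _ => sq_nonneg _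
    have hmv : ∫ x in (T : Set (Euc d)), M.v0 v T x ^ 2 = m :=
      setIntegral_congr_fun (M.isCompact_cell T).measurableSet fun x hx => by simp only [hpv x hx]
    rw [hmv]
    have hgrad := M.grad_le hd v hC hcard htrT hp hpv
    -- the divergence theorem for the field with the single component `p² x₀`
    have hdiv := M.integral_pderiv T (p * p * MvPolynomial.X i₀) i₀
    have hx0 : ∀ x ∈ (T : Set (Euc d)), |x i₀| ≤ R := fun x hx => by
      have := PiLp.norm_apply_le x i₀
      rw [Real.norm_eq_abs] at this
      exact this.trans (hTR x hx)
    -- With y = x₁ ∂₁p, the square (p/2 + 2y)² ≥ 0 gives p² + 2py ≥ (3/4)p² − 4y². Of the three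
    -- quarters, one pays for the traces and one half remains.
    have hlow : m / 2 + m / 4 - 4 * R ^ 2 * ∫ x in (T : Set (Euc d)), ‖(polyGrad hp).val x‖ ^ 2 ≤
        ∫ x in (T : Set (Euc d)),
          pval (MvPolynomial.pderiv i₀ (p * p * MvPolynomial.X i₀)) x := by
      rw [hm, ← integral_div, ← integral_div, ← integral_const_mul,
        ← integral_add (M.integrableOn_cell T (by fun_prop)) (M.integrableOn_cell T (by fun_prop)),
        ← integral_sub (M.integrableOn_cell T (by fun_prop)) (M.integrableOn_cell T (by fun_prop))]
      refine setIntegral_mono_on (M.integrableOn_cell T (by fun_prop))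
        (M.integrableOn_cell T (by fun_prop)) (M.isCompact_cell T).measurableSet fun x hx => ?_
      have e1 : pval (MvPolynomial.pderiv i₀ (p * p * MvPolynomial.X i₀)) x =
          pval p x ^ 2 + 2 * pval p x * pval (MvPolynomial.pderiv i₀ p) x * x i₀ := by
        simp only [Derivation.leibniz, smul_eq_mul, MvPolynomial.pderiv_X_self, pval_add, pval_mul,
          pval_X, mul_one]
        ring
      have e2 : pval (MvPolynomial.pderiv i₀ p) x ^ 2 ≤ ‖(polyGrad hp).val x‖ ^ 2 := by
        rw [norm_polyGrad_sq]
        exact Finset.single_le_sum (f := fun i => pval (MvPolynomial.pderiv i p) x ^ 2)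
          (fun i _ => sq_nonneg _) (Finset.mem_univ i₀)
      have e3 : (x i₀) ^ 2 ≤ R ^ 2 := sq_le_sq' (abs_le.1 (hx0 x hx)).1 (abs_le.1 (hx0 x hx)).2
      have e4 : (pval (MvPolynomial.pderiv i₀ p) x * x i₀) ^ 2 ≤
          R ^ 2 * ‖(polyGrad hp).val x‖ ^ 2 := by
        rw [mul_pow, mul_comm (R ^ 2)]
        exact mul_le_mul e2 e3 (sq_nonneg _) (sq_nonneg _)
      rw [e1]
      nlinarith [sq_nonneg (pval p x / 2 + 2 * (pval (MvPolynomial.pderiv i₀ p) x * x i₀))]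
    -- the boundary terms
    have hface : ∀ e ∈ M.facesOf T, ∫ x in (e : Set (Euc d)),
        pval (p * p * MvPolynomial.X i₀) x * outwardNormal (T : Set (Euc d)) e i₀ ∂(surf d) ≤
        R * (2 * R + K) * (h⁻¹ * ∫ x in (e : Set (Euc d)), (M.v0 v T x - M.vb v e x) ^ 2 ∂(surf d)) +
        R * (h / K) * ∫ x in (e : Set (Euc d)), pval p x ^ 2 ∂(surf d) +
        ∫ x in (e : Set (Euc d)),
          M.vb v e x ^ 2 * x i₀ * outwardNormal (T : Set (Euc d)) e i₀ ∂(surf d) := by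
      intro e he
      have hJ := M.continuousOn_jump v he
      have hvb := M.continuousOn_vb v e
      rw [← integral_const_mul, ← integral_const_mul, ← integral_const_mul, ← integral_add,
        ← integral_add]
      · refine setIntegral_mono_on (M.integrableOn_face e (by fun_prop)) ?_
          (M.isCompact_face e).measurableSet fun x hx => ?_
        · exact M.integrableOn_face_of_continuousOn e (by fun_prop)
        · have hxT := M.face_subset he hx
          have hn1 : |outwardNormal (T : Set (Euc d)) e i₀| ≤ 1 := by
            have := PiLp.norm_apply_le (outwardNormal (T : Set (Euc d)) e) i₀
            rwa [Real.norm_eq_abs, (M.isOutwardNormal he).1] at this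
          rw [hpv x hxT, pval_mul, pval_mul, pval_X]
          exact jump_bound hpos hh2R hKpos (hx0 x hxT) hn1
      all_goals exact M.integrableOn_face_of_continuousOn e (by fun_prop)
    have hsum := Finset.sum_le_sum hface
    rw [Finset.sum_add_distrib, Finset.sum_add_distrib, ← Finset.mul_sum, ← Finset.mul_sum,
      ← Finset.mul_sum, ← hdiv] at hsum
    have hjump : h⁻¹ * ∑ e ∈ M.facesOf T, ∫ x in (e : Set (Euc d)),
        (M.v0 v T x - M.vb v e x) ^ 2 ∂(surf d) = M.jumpSq v T := rfl
    rw [hjump] at hsum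
    have htrace : R * (h / K) * ∑ e ∈ M.facesOf T, ∫ x in (e : Set (Euc d)),
        pval p x ^ 2 ∂(surf d) ≤ m / 4 := by
      calc _ ≤ R * (h / K) * (N * C * h⁻¹ * m) :=
            mul_le_mul_of_nonneg_left (M.sum_trace_le hC hcard htrT hp) (by positivity)
        _ = (4 * R * (N * C)) / K * (m / 4) := by field_simp
        _ ≤ 1 * (m / 4) := mul_le_mul_of_nonneg_right
            ((div_le_one hKpos).2 (by linarith)) (by positivity)
        _ = m / 4 := one_mul _
    have hg0 := M.gradSq_nonneg v T
    have hj0 := M.jumpSq_nonneg v T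
    have hNC : 0 ≤ (N : ℝ) * C := by positivity
    have hgrad' := mul_le_mul_of_nonneg_left hgrad (show 0 ≤ 4 * R ^ 2 by positivity)
    have hfin : 4 * R ^ 2 * (2 * M.gradSq v T + 2 * (N * C + 1) * M.jumpSq v T) +
        R * (2 * R + K) * M.jumpSq v T ≤ A / 2 * (M.gradSq v T + M.jumpSq v T) := by
      have a1 : 8 * R ^ 2 ≤ A / 2 := by
        have : 0 ≤ R ^ 2 * (N * C + 1) := by positivity
        have : 0 ≤ R * (2 * R + K) := by positivity
        rw [hA]; linarith
      have a2 : 8 * R ^ 2 * (N * C + 1) + R * (2 * R + K) ≤ A / 2 := by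
        have : 0 ≤ R ^ 2 := by positivity
        have : 0 ≤ R * (2 * R + K) := by positivity
        rw [hA]; linarith
      have b1 := mul_le_mul_of_nonneg_right a1 hg0
      have b2 := mul_le_mul_of_nonneg_right a2 hj0
      linarith
    linarith
  -- Only after summation do the fluxes disappear; moving half of ‖v₀‖² to the left turns A/2 into
  -- A.
  have htot := Finset.sum_le_sum fun T (_ : T ∈ (Finset.univ : Finset M.cells)) => hcell T
  rw [Finset.sum_add_distrib, Finset.sum_add_distrib, ← Finset.sum_div, ← Finset.mul_sum,
    hflux] at htot
  linarith

end PolytopalMesh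

end Mesh

end WG

namespace WG
open Filter Topology

section Mesh

variable {d : ℕ} {Ω : Set (Euc d)} (M : PolytopalMesh Ω) {k : ℕ}

/-! ### Carathéodory coefficients -/

theorem inner_toEuclideanCLM (A : Matrix (Fin d) (Fin d) ℝ) (ξ η : Euc d) :
    inner ℝ (Matrix.toEuclideanCLM (𝕜 := ℝ) A ξ) η = ∑ i, ∑ j, A i j * ξ j * η i := by
  rw [PiLp.inner_apply]
  refine Finset.sum_congr rfl fun i _ => ?_
  rw [← Finset.sum_mul]
  simp [Matrix.ofLp_toEuclideanCLM, Matrix.mulVec, dotProduct, mul_comm]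

/-- For a simple `u` the composition is a finite sum of measurable functions cut off to level sets.
A measurable `u` is a pointwise limit of simple functions, and continuity in the second variable
passes to the limit. -/
theorem aemeasurable_caratheodory {α β : Type*} [MeasurableSpace α] [TopologicalSpace β]
    [TopologicalSpace.PseudoMetrizableSpace β]
    [MeasurableSpace β] [BorelSpace β] [SecondCountableTopology β] {μ : Measure α}
    {h : α → β → ℝ} (hm : ∀ y, AEMeasurable (fun x => h x y) μ)
    (hc : ∀ᵐ x ∂μ, Continuous (h x)) {u : α → β} (hu : Measurable u) :
    AEMeasurable (fun x => h x (u x)) μ := by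
  have hus := hu.stronglyMeasurable
  have hsimple : ∀ s : SimpleFunc α β, AEMeasurable (fun x => h x (s x)) μ := by
    intro s
    classical
    have : (fun x => h x (s x)) =
        fun x => ∑ y ∈ s.range, (s ⁻¹' {y}).indicator (fun x => h x y) x := by
      funext x
      rw [Finset.sum_eq_single (s x)]
      · rw [Set.indicator_of_mem (by simp)]
      · intro y _ hy
        exact Set.indicator_of_notMem (by simpa using hy.symm) _
      · intro hx
        exact absurd (s.mem_range_self x) hx
    rw [this]
    exact Finset.aemeasurable_fun_sum _ fun y _ => (hm y).indicator (s.measurableSet_preimage _)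
  refine aemeasurable_of_tendsto_metrizable_ae atTop (fun n => hsimple (hus.approx n)) ?_
  filter_upwards [hc] with x hx
  exact (hx.tendsto _).comp (hus.tendsto_approx x)

variable {lam Lam : ℝ} {a : Euc d → ℝ → Euc d → Matrix (Fin d) (Fin d) ℝ}

theorem IsCoefficient.abs_inner_le (ha : IsCoefficient Ω lam Lam a) {x : Euc d} (hx : x ∈ Ω)
    (η : ℝ) (p ξ ζ : Euc d) :
    |inner ℝ (Matrix.toEuclideanCLM (𝕜 := ℝ) (a x η p) ξ) ζ| ≤ Lam * ‖ξ‖ * ‖ζ‖ := by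
  refine (abs_real_inner_le_norm _ _).trans (mul_le_mul_of_nonneg_right ?_ (norm_nonneg _))
  exact (ContinuousLinearMap.le_opNorm _ _).trans
    (mul_le_mul_of_nonneg_right (ha.bounded x hx η p) (norm_nonneg _))

theorem IsCoefficient.le_inner (ha : IsCoefficient Ω lam Lam a) {x : Euc d} (hx : x ∈ Ω)
    (η : ℝ) (p ξ : Euc d) :
    lam * ‖ξ‖ ^ 2 ≤ inner ℝ (Matrix.toEuclideanCLM (𝕜 := ℝ) (a x η p) ξ) ξ := by
  have h := ha.elliptic x hx η p (fun i => ξ i)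
  have h1 : ‖ξ‖ ^ 2 = (fun i => ξ i) ⬝ᵥ (fun i => ξ i) := by
    rw [EuclideanSpace.real_norm_sq_eq]
    exact Finset.sum_congr rfl fun i _ => sq _
  have h2 : inner ℝ (Matrix.toEuclideanCLM (𝕜 := ℝ) (a x η p) ξ) ξ =
      (fun i => ξ i) ⬝ᵥ (a x η p).mulVec (fun i => ξ i) := by
    rw [inner_toEuclideanCLM]
    simp only [dotProduct, Matrix.mulVec, Finset.mul_sum]
    exact Finset.sum_congr rfl fun i _ => Finset.sum_congr rfl fun j _ => by ring
  rw [h1, h2]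
  exact h

namespace PolytopalMesh

theorem measurable_v0 (v : M.V k) (T : M.cells) : Measurable (M.v0 v T) := by
  obtain ⟨p, -, h⟩ := (v.1 T).2
  change Measurable (v.1 T : Euc d → ℝ)
  rw [h]
  exact (continuous_pval p).measurable.indicator (M.isCompact_cell T).measurableSet

/-- The integrand of the form `𝔞`. -/
noncomputable def integrand (a : Euc d → ℝ → Euc d → Matrix (Fin d) (Fin d) ℝ) (φ v w : M.V k)
    (T : M.cells) (x : Euc d) : ℝ :=
  inner ℝ (Matrix.toEuclideanCLM (𝕜 := ℝ) (a x (M.v0 φ T x) ((M.weakGrad φ T).val x))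
      ((M.weakGrad v T).val x)) ((M.weakGrad w T).val x)

theorem aestronglyMeasurable_integrand (ha : IsCoefficient Ω lam Lam a) (φ v w : M.V k)
    (T : M.cells) :
    AEStronglyMeasurable (M.integrand a φ v w T) (volume.restrict (T : Set (Euc d))) := by
  refine AEMeasurable.aestronglyMeasurable ?_
  have h1 : ∀ i j, AEMeasurable (fun x => a x (M.v0 φ T x) ((M.weakGrad φ T).val x) i j)
      (volume.restrict (T : Set (Euc d))) := by
    intro i j
    refine aemeasurable_caratheodory (h := fun x (z : ℝ × Euc d) => a x z.1 z.2 i j)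
      (fun z => (ha.measurable z.1 z.2 i j).mono_measure (M.restrict_cell_le T)) ?_
      (u := fun x => (M.v0 φ T x, (M.weakGrad φ T).val x))
      ((M.measurable_v0 φ T).prodMk (PolyVec.continuous_val _).measurable)
    filter_upwards [M.ae_mem_domain T] with x hx
    have := ha.continuous x hx
    exact this.matrix_elem i j
  have h2 : ∀ (G : PolyVec d (k - 1)) (i : Fin d), AEMeasurable (fun x => G.val x i)
      (volume.restrict (T : Set (Euc d))) := by
    intro G i
    have : Continuous fun x => G.val x i := by fun_prop
    exact this.measurable.aemeasurable
  unfold integrand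
  simp_rw [inner_toEuclideanCLM]
  exact Finset.aemeasurable_fun_sum _ fun i _ => Finset.aemeasurable_fun_sum _ fun j _ =>
    ((h1 i j).mul (h2 _ j)).mul (h2 _ i)

theorem abs_integrand_le (ha : IsCoefficient Ω lam Lam a) (φ v w : M.V k) (T : M.cells) :
    ∀ᵐ x ∂volume.restrict (T : Set (Euc d)), |M.integrand a φ v w T x| ≤
      Lam * ‖(M.weakGrad v T).val x‖ * ‖(M.weakGrad w T).val x‖ := by
  filter_upwards [M.ae_mem_domain T] with x hx
  exact ha.abs_inner_le hx _ _ _ _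

theorem integrableOn_integrand (ha : IsCoefficient Ω lam Lam a) (φ v w : M.V k) (T : M.cells) :
    IntegrableOn (M.integrand a φ v w T) (T : Set (Euc d)) := by
  have h : IntegrableOn (fun x => Lam * ‖(M.weakGrad v T).val x‖ * ‖(M.weakGrad w T).val x‖)
      (T : Set (Euc d)) := M.integrableOn_cell T (by fun_prop)
  refine Integrable.mono' h (M.aestronglyMeasurable_integrand ha φ v w T) ?_
  filter_upwards [M.abs_integrand_le ha φ v w T] with x hx using hx

theorem formA_eq (φ v w : M.V k) :
    M.formA a φ v w = ∑ T : M.cells, ∫ x in (T : Set (Euc d)), M.integrand a φ v w T x := rfl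

/-! ### The stabilized bilinear form and its bounds by the energy -/

theorem integrableOn_jump_mul (v w : M.V k) {T : M.cells} {e : M.faces} (he : e ∈ M.facesOf T) :
    IntegrableOn (fun x => (M.v0 v T x - M.vb v e x) * (M.v0 w T x - M.vb w e x))
      (e : Set (Euc d)) (surf d) :=
  M.integrableOn_face_of_continuousOn e ((M.continuousOn_jump v he).mul (M.continuousOn_jump w he))

theorem stab_comm (ρ : ℝ) (v w : M.V k) : M.stab ρ v w = M.stab ρ w v := by
  simp only [stab, mul_comm]

theorem stab_add_left (ρ : ℝ) (v v' w : M.V k) :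
    M.stab ρ (v + v') w = M.stab ρ v w + M.stab ρ v' w := by
  simp only [stab, Finset.mul_sum, ← Finset.sum_add_distrib]
  refine Finset.sum_congr rfl fun T _ => Finset.sum_congr rfl fun e he => ?_
  rw [← mul_add, ← mul_add,
    ← integral_add (M.integrableOn_jump_mul v w he) (M.integrableOn_jump_mul v' w he)]
  simp only [v0_add, vb_add, add_sub_add_comm, add_mul]

theorem stab_smul_left (ρ c : ℝ) (v w : M.V k) : M.stab ρ (c • v) w = c * M.stab ρ v w := by
  simp only [stab, v0_smul, vb_smul, ← mul_sub, mul_assoc, integral_const_mul, ← Finset.mul_sum,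
    mul_left_comm _ c]

/-- The stabilizer as a bilinear form. -/
noncomputable def stabForm (ρ : ℝ) (k : ℕ) : M.V k →ₗ[ℝ] M.V k →ₗ[ℝ] ℝ := LinearMap.mk₂ ℝ
  (fun v w => M.stab ρ v w)
  (fun v v' w => M.stab_add_left ρ v v' w)
  (fun c v w => M.stab_smul_left ρ c v w)
  (fun v w w' => by simp only [M.stab_comm ρ v, stab_add_left])
  (fun c v w => by simp only [M.stab_comm ρ v, stab_smul_left, smul_eq_mul])

/-- The stabilized form as a bilinear form in its last two arguments. -/
noncomputable def formAsL (ρ : ℝ) (ha : IsCoefficient Ω lam Lam a) (φ : M.V k) :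
    M.V k →ₗ[ℝ] M.V k →ₗ[ℝ] ℝ := (LinearMap.mk₂ ℝ
  (fun v w => M.formA a φ v w)
  (fun v v' w => by
    simp only [formA_eq, ← Finset.sum_add_distrib]
    refine Finset.sum_congr rfl fun T _ => ?_
    rw [← integral_add (M.integrableOn_integrand ha φ v w T) (M.integrableOn_integrand ha φ v' w T)]
    congr 1; funext x
    simp only [integrand, weakGrad_add, PolyVec.val_add, map_add, inner_add_left])
  (fun c v w => by
    simp only [formA_eq, smul_eq_mul, Finset.mul_sum]
    refine Finset.sum_congr rfl fun T _ => ?_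
    rw [← integral_const_mul]
    congr 1; funext x
    simp only [integrand, weakGrad_smul, PolyVec.val_smul, map_smul, real_inner_smul_left])
  (fun v w w' => by
    simp only [formA_eq, ← Finset.sum_add_distrib]
    refine Finset.sum_congr rfl fun T _ => ?_
    rw [← integral_add (M.integrableOn_integrand ha φ v w T) (M.integrableOn_integrand ha φ v w' T)]
    congr 1; funext x
    simp only [integrand, weakGrad_add, PolyVec.val_add, inner_add_right])
  (fun c v w => by
    simp only [formA_eq, smul_eq_mul, Finset.mul_sum]
    refine Finset.sum_congr rfl fun T _ => ?_
    rw [← integral_const_mul]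
    congr 1; funext x
    simp only [integrand, weakGrad_smul, PolyVec.val_smul, real_inner_smul_right])) +
  M.stabForm ρ k

theorem formAsL_apply (ρ : ℝ) (ha : IsCoefficient Ω lam Lam a) (φ v w : M.V k) :
    M.formAsL ρ ha φ v w = M.formAs ρ a φ v w := rfl

/-- The energy `Σ_T (‖∇_w v‖² + h_T⁻¹ ‖v₀ - v_b‖²)`. -/
noncomputable def energy (v : M.V k) : ℝ := ∑ T : M.cells, (M.gradSq v T + M.jumpSq v T)

theorem energy_nonneg (v : M.V k) : 0 ≤ M.energy v :=
  Finset.sum_nonneg fun T _ => add_nonneg (M.gradSq_nonneg v T) (M.jumpSq_nonneg v T)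

theorem stab_self (ρ : ℝ) (v : M.V k) : M.stab ρ v v = ρ * ∑ T : M.cells, M.jumpSq v T := by
  simp only [stab, jumpSq, sq]

theorem le_formAs (ρ : ℝ) (ha : IsCoefficient Ω lam Lam a) (φ v : M.V k) :
    min lam ρ * M.energy v ≤ M.formAs ρ a φ v v := by
  have h1 : lam * ∑ T : M.cells, M.gradSq v T ≤ M.formA a φ v v := by
    rw [formA_eq, Finset.mul_sum]
    refine Finset.sum_le_sum fun T _ => ?_
    rw [gradSq, ← integral_const_mul]
    refine integral_mono_ae (M.integrableOn_cell T (by fun_prop))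
      (M.integrableOn_integrand ha φ v v T) ?_
    filter_upwards [M.ae_mem_domain T] with x hx
    exact ha.le_inner hx _ _ _
  have h2 : 0 ≤ ∑ T : M.cells, M.gradSq v T := Finset.sum_nonneg fun T _ => M.gradSq_nonneg v T
  have h3 : 0 ≤ ∑ T : M.cells, M.jumpSq v T := Finset.sum_nonneg fun T _ => M.jumpSq_nonneg v T
  rw [formAs, stab_self, energy, Finset.sum_add_distrib, mul_add]
  exact add_le_add ((mul_le_mul_of_nonneg_right (min_le_left _ _) h2).trans h1)
    (mul_le_mul_of_nonneg_right (min_le_right _ _) h3)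

/-- Young's inequality is used pointwise on elements and faces, so the estimates simply add up. The
weight `s` stays free: a small one is needed to absorb into coercivity, while s = 1 gives
continuity. No sign of `Lam` is assumed, hence the absolute value. -/
theorem abs_formAs_le {ρ : ℝ} (hρ : 0 ≤ ρ) (ha : IsCoefficient Ω lam Lam a) (φ v w : M.V k) {s : ℝ}
    (hs : 0 < s) : |M.formAs ρ a φ v w| ≤
      s * M.energy w + (max |Lam| ρ) ^ 2 / (4 * s) * M.energy v := by
  set L := max |Lam| ρ with hL
  have hyoung : ∀ y z : ℝ, L * |y| * |z| ≤ s * z ^ 2 + L ^ 2 / (4 * s) * y ^ 2 := by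
    intro y z
    have : s * z ^ 2 + L ^ 2 / (4 * s) * y ^ 2 - L * |y| * |z| =
        s * (|z| - L / (2 * s) * |y|) ^ 2 := by
      rw [← sq_abs z, ← sq_abs y]; field_simp; ring
    have : 0 ≤ s * (|z| - L / (2 * s) * |y|) ^ 2 := by positivity
    linarith
  have hA : |M.formA a φ v w| ≤
      ∑ T : M.cells, (s * M.gradSq w T + L ^ 2 / (4 * s) * M.gradSq v T) := by
    rw [formA_eq]
    refine (Finset.abs_sum_le_sum_abs _ _).trans (Finset.sum_le_sum fun T _ => ?_)
    refine (abs_integral_le_integral_abs).trans ?_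
    rw [gradSq, gradSq, ← integral_const_mul, ← integral_const_mul,
      ← integral_add (M.integrableOn_cell T (by fun_prop)) (M.integrableOn_cell T (by fun_prop))]
    refine integral_mono_ae (M.integrableOn_integrand ha φ v w T).abs
      (M.integrableOn_cell T (by fun_prop)) ?_
    filter_upwards [M.abs_integrand_le ha φ v w T] with x hx
    refine hx.trans (le_trans ?_ (hyoung _ _))
    rw [abs_norm, abs_norm]
    gcongr
    exact (le_abs_self _).trans (le_max_left _ _)
  have hS : |M.stab ρ v w| ≤
      ∑ T : M.cells, (s * M.jumpSq w T + L ^ 2 / (4 * s) * M.jumpSq v T) := by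
    rw [stab, Finset.mul_sum]
    refine (Finset.abs_sum_le_sum_abs _ _).trans (Finset.sum_le_sum fun T _ => ?_)
    have hd : 0 ≤ (Metric.diam (T : Set (Euc d)))⁻¹ := inv_nonneg.2 Metric.diam_nonneg
    rw [mul_left_comm, abs_mul, abs_of_nonneg hd, jumpSq, jumpSq, mul_left_comm s,
      mul_left_comm (L ^ 2 / (4 * s)), ← mul_add, Finset.mul_sum, Finset.mul_sum, Finset.mul_sum,
      ← Finset.sum_add_distrib]
    refine mul_le_mul_of_nonneg_left ?_ hd
    refine (Finset.abs_sum_le_sum_abs _ _).trans (Finset.sum_le_sum fun e he => ?_)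
    have hv := M.continuousOn_jump v he
    have hw := M.continuousOn_jump w he
    rw [← integral_const_mul, ← integral_const_mul, ← integral_const_mul, ← integral_add]
    · refine (abs_integral_le_integral_abs).trans ?_
      refine integral_mono (M.integrableOn_face_of_continuousOn e (by fun_prop))
        (M.integrableOn_face_of_continuousOn e (by fun_prop)) fun x => ?_
      refine le_trans ?_ (hyoung _ _)
      rw [abs_mul, abs_mul, ← mul_assoc]
      gcongr
      rw [abs_of_nonneg hρ]
      exact le_max_right _ _
    all_goals exact M.integrableOn_face_of_continuousOn e (by fun_prop)
  rw [formAs, energy, energy, Finset.mul_sum, Finset.mul_sum, ← Finset.sum_add_distrib]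
  refine (abs_add_le _ _).trans ((add_le_add hA hS).trans (le_of_eq ?_))
  rw [← Finset.sum_add_distrib]
  exact Finset.sum_congr rfl fun T _ => by ring

end PolytopalMesh

end Mesh

end WG

/-! ### Boundary data, definiteness of the energy, and the load functional -/

namespace WG
open Filter Topology

instance finiteDimensional_polyOn {d k : ℕ} (S : Set (Euc d)) :
    FiniteDimensional ℝ (PolyOn k S) := by
  let L : Poly d k →ₗ[ℝ] PolyOn k S :=
    { toFun := fun p => ⟨S.indicator (pval (p : MvPolynomial (Fin d) ℝ)), p, p.2, rfl⟩
      map_add' := fun p q => Subtype.ext (by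
        funext x
        by_cases hx : x ∈ S <;> simp [hx, pval_add])
      map_smul' := fun c p => Subtype.ext (by
        funext x
        by_cases hx : x ∈ S <;> simp [hx, pval_smul]) }
  refine Module.Finite.of_surjective L ?_
  rintro ⟨_, p, hp, rfl⟩
  exact ⟨⟨p, hp⟩, rfl⟩

theorem continuousOn_of_mem_polyOn {d k : ℕ} {S : Set (Euc d)} {u : Euc d → ℝ}
    (hu : u ∈ PolyOn k S) : ContinuousOn u S := by
  obtain ⟨p, -, rfl⟩ := hu
  exact (continuous_pval p).continuousOn.congr fun x hx => Set.indicator_of_mem hx _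

section Mesh

variable {d : ℕ} {Ω : Set (Euc d)} (M : PolytopalMesh Ω) {k : ℕ}

namespace PolytopalMesh

/-- The space `V_h⁰` as a subspace. -/
def V0sub (k : ℕ) : Submodule ℝ (M.V k) where
  carrier := M.V0 k
  add_mem' := fun {v w} hv hw e he => by
    funext x
    rw [vb_add, hv e he, hw e he, Pi.zero_apply, add_zero]
  zero_mem' := fun _ _ => rfl
  smul_mem' := fun c v hv e he => by
    funext x
    rw [vb_smul, hv e he, Pi.zero_apply, mul_zero]

/-! ### The projection onto boundary polynomials -/

theorem integrableOn_mul_polyOn (e : M.faces) {u v : Euc d → ℝ}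
    (hu : u ∈ PolyOn k (e : Set (Euc d))) (hv : v ∈ PolyOn k (e : Set (Euc d))) :
    IntegrableOn (fun x => u x * v x) (e : Set (Euc d)) (surf d) :=
  M.integrableOn_face_of_continuousOn e
    ((continuousOn_of_mem_polyOn hu).mul (continuousOn_of_mem_polyOn hv))

theorem eq_zero_of_integral_sq_eq_zero (hd : 1 ≤ d) (e : M.faces) {u : Euc d → ℝ}
    (hu : u ∈ PolyOn k (e : Set (Euc d)))
    (h : ∫ x in (e : Set (Euc d)), u x * u x ∂(surf d) = 0) : u = 0 := by
  have hc := continuousOn_of_mem_polyOn hu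
  obtain ⟨p, hp, rfl⟩ := hu
  have h0 := (setIntegral_eq_zero_iff_of_nonneg_ae
    (Eventually.of_forall fun x => mul_self_nonneg _)
    (M.integrableOn_face_of_continuousOn e (hc.mul hc))).1 h
  have h1 : ∀ᵐ x ∂(surf d).restrict (e : Set (Euc d)), pval p x = 0 := by
    filter_upwards [h0, ae_restrict_mem (M.isCompact_face e).measurableSet] with x hx hxe
    simpa [Set.indicator_of_mem hxe] using hx
  have h2 := (M.isFlatFace' e).eqOn_zero_of_ae hd (continuous_pval p) h1
  funext x
  by_cases hx : x ∈ (e : Set (Euc d))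
  · rw [Set.indicator_of_mem hx, h2 x hx, Pi.zero_apply]
  · rw [Set.indicator_of_notMem hx, Pi.zero_apply]

/-- The `L²(e)` inner product on `P_k(e)`. -/
noncomputable def faceForm (e : M.faces) (k : ℕ) :
    PolyOn k (e : Set (Euc d)) →ₗ[ℝ] PolyOn k (e : Set (Euc d)) →ₗ[ℝ] ℝ := LinearMap.mk₂ ℝ
  (fun u q => ∫ x in (e : Set (Euc d)), (u : Euc d → ℝ) x * (q : Euc d → ℝ) x ∂(surf d))
  (fun u v q => by
    rw [← integral_add (M.integrableOn_mul_polyOn e u.2 q.2) (M.integrableOn_mul_polyOn e v.2 q.2)]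
    simp only [Submodule.coe_add, Pi.add_apply, add_mul])
  (fun c u q => by
    simp only [Submodule.coe_smul, Pi.smul_apply, smul_eq_mul, mul_assoc, integral_const_mul])
  (fun q u v => by
    rw [← integral_add (M.integrableOn_mul_polyOn e q.2 u.2) (M.integrableOn_mul_polyOn e q.2 v.2)]
    simp only [Submodule.coe_add, Pi.add_apply, mul_add])
  (fun c q u => by
    simp only [Submodule.coe_smul, Pi.smul_apply, smul_eq_mul, mul_left_comm _ c,
      integral_const_mul])

theorem exists_projection (hd : 1 ≤ d) (e : M.faces) (k : ℕ) {g : Euc d → ℝ}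
    (hg : IntegrableOn g (e : Set (Euc d)) (surf d)) :
    ∃ u : PolyOn k (e : Set (Euc d)), ∀ q ∈ PolyOn k (e : Set (Euc d)),
      ∫ x in (e : Set (Euc d)), (u : Euc d → ℝ) x * q x ∂(surf d) =
        ∫ x in (e : Set (Euc d)), g x * q x ∂(surf d) := by
  have hgq : ∀ q : PolyOn k (e : Set (Euc d)),
      IntegrableOn (fun x => g x * (q : Euc d → ℝ) x) (e : Set (Euc d)) (surf d) := fun q =>
    hg.mul_continuousOn (continuousOn_of_mem_polyOn q.2) (M.isCompact_face e)
  let L : PolyOn k (e : Set (Euc d)) →ₗ[ℝ] ℝ :=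
    { toFun := fun q => ∫ x in (e : Set (Euc d)), g x * (q : Euc d → ℝ) x ∂(surf d)
      map_add' := fun q q' => by
        rw [← integral_add (hgq q) (hgq q')]
        simp only [Submodule.coe_add, Pi.add_apply, mul_add]
      map_smul' := fun c q => by
        simp only [Submodule.coe_smul, Pi.smul_apply, smul_eq_mul, mul_left_comm _ c,
          integral_const_mul, RingHom.id_apply] }
  obtain ⟨u, hu⟩ := surjective_of_posDef (M.faceForm e k)
    (fun v hv => Subtype.ext (M.eq_zero_of_integral_sq_eq_zero hd e v.2 hv)) L
  exact ⟨u, fun q hq => LinearMap.congr_fun hu ⟨q, hq⟩⟩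

theorem nonempty_B (hd : 1 ≤ d) (k : ℕ) {g : Euc d → ℝ}
    (hg : MemLp g 2 ((surf d).restrict (frontier Ω))) : (M.B k g).Nonempty := by
  classical
  have h : ∀ e : M.faces, ∃ u : PolyOn k (e : Set (Euc d)), (e : Set (Euc d)) ⊆ frontier Ω →
      ∀ q ∈ PolyOn k (e : Set (Euc d)),
      ∫ x in (e : Set (Euc d)), (u : Euc d → ℝ) x * q x ∂(surf d) =
        ∫ x in (e : Set (Euc d)), g x * q x ∂(surf d) := by
    intro e
    by_cases he : (e : Set (Euc d)) ⊆ frontier Ω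
    · have hge : MemLp g 2 ((surf d).restrict (e : Set (Euc d))) :=
        hg.mono_measure (Measure.restrict_mono he le_rfl)
      obtain ⟨u, hu⟩ := M.exists_projection hd e k (hge.integrable one_le_two)
      exact ⟨u, fun _ => hu⟩
    · exact ⟨0, fun h => absurd h he⟩
  choose u hu using h
  exact ⟨(0, u), fun e he q hq => hu e he q hq⟩

theorem add_mem_B {g : Euc d → ℝ} {u v : M.V k} (hu : u ∈ M.B k g) (hv : v ∈ M.V0 k) :
    u + v ∈ M.B k g := by
  intro e he q hq
  rw [← hu e he q hq]
  simp only [vb_add, hv e he, Pi.zero_apply, add_zero]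

/-- Membership in B_{g,h} fixes the moments on boundary faces, so the difference of the boundary
components is orthogonal to P_k(e), in particular to itself. -/
theorem sub_mem_V0 (hd : 1 ≤ d) {g : Euc d → ℝ} {u ψ : M.V k} (hu : u ∈ M.B k g)
    (hψ : ψ ∈ M.B k g) : u - ψ ∈ M.V0 k := by
  intro e he
  have hw : M.vb (u - ψ) e ∈ PolyOn k (e : Set (Euc d)) := ((u - ψ).2 e).2
  refine M.eq_zero_of_integral_sq_eq_zero hd e hw ?_
  have h1 : ∀ x, M.vb (u - ψ) e x = M.vb u e x - M.vb ψ e x := fun x => rfl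
  have h2 : ∫ x in (e : Set (Euc d)), M.vb (u - ψ) e x * M.vb (u - ψ) e x ∂(surf d) =
      (∫ x in (e : Set (Euc d)), M.vb u e x * M.vb (u - ψ) e x ∂(surf d)) -
      ∫ x in (e : Set (Euc d)), M.vb ψ e x * M.vb (u - ψ) e x ∂(surf d) := by
    rw [← integral_sub (M.integrableOn_mul_polyOn (u := M.vb u e) e (u.2 e).2 hw)
      (M.integrableOn_mul_polyOn (u := M.vb ψ e) e (ψ.2 e).2 hw)]
    simp only [← sub_mul, ← h1]
  rw [h2, hu e he _ hw, hψ e he _ hw, sub_self]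

/-! ### The energy form -/

/-- The identity coefficient with ρ = 1 turns the energy into a case of the stabilized form, from
which it inherits bilinearity. -/
theorem isCoefficient_one : IsCoefficient Ω 1 1 (fun _ _ _ => (1 : Matrix (Fin d) (Fin d) ℝ)) where
  symm := fun _ _ _ _ => Matrix.isSymm_one
  elliptic := fun _ _ _ _ ξ => by simp
  bounded := fun _ _ _ _ => by
    rw [map_one]
    exact ContinuousLinearMap.norm_id_le
  measurable := fun _ _ _ _ => aemeasurable_const
  continuous := fun _ _ => continuous_const

/-- The bilinear form of the energy. -/
noncomputable def energyForm (k : ℕ) : M.V k →ₗ[ℝ] M.V k →ₗ[ℝ] ℝ :=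
  M.formAsL 1 (isCoefficient_one (Ω := Ω)) 0

theorem energyForm_self (v : M.V k) : M.energyForm k v v = M.energy v := by
  rw [energyForm, formAsL_apply, formAs, stab_self, formA_eq, energy, Finset.sum_add_distrib,
    one_mul]
  congr 1
  refine Finset.sum_congr rfl fun T _ => ?_
  simp only [gradSq, integrand, map_one, one_apply_eq_self, real_inner_self_eq_norm_sq]

theorem energyForm_symm (v w : M.V k) : M.energyForm k v w = M.energyForm k w v := by
  rw [energyForm, formAsL_apply, formAsL_apply, formAs, formAs, M.stab_comm 1 v, formA_eq, formA_eq]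
  simp only [integrand, map_one, one_apply_eq_self, real_inner_comm]

/-- The parallelogram identity with the nonnegative term E(v − w) dropped. -/
theorem energy_add_le (v w : M.V k) : M.energy (v + w) ≤ 2 * M.energy v + 2 * M.energy w := by
  have h := M.energy_nonneg (v - w)
  rw [← energyForm_self] at h
  rw [← energyForm_self, ← energyForm_self, ← energyForm_self]
  simp only [map_add, map_sub, LinearMap.add_apply, LinearMap.sub_apply,
    M.energyForm_symm w v] at h ⊢
  linarith

/-- Poincaré gives v₀ = 0. The jump on any element adjacent to a face, and every face has one, then
reduces to v_b and gives v_b = 0. -/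
theorem eq_zero_of_energy_eq_zero (hd : 1 ≤ d) {C : ℝ} {v : M.V k}
    (hC : ∑ T : M.cells, ∫ x in (T : Set (Euc d)), M.v0 v T x ^ 2 ≤ C * M.energy v)
    (h : M.energy v = 0) : v = 0 := by
  have hnn : ∀ T : M.cells, 0 ≤ ∫ x in (T : Set (Euc d)), M.v0 v T x ^ 2 :=
    fun T => integral_nonneg fun _ => sq_nonneg _
  have hsum := (Finset.sum_eq_zero_iff_of_nonneg fun T _ => hnn T).1
    (le_antisymm (by simpa [h] using hC) (Finset.sum_nonneg fun T _ => hnn T))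
  have h0 : ∀ T : M.cells, ∀ x, M.v0 v T x = 0 := by
    intro T
    obtain ⟨p, hp, hpv⟩ := M.exists_poly_v0 v T
    have h1 := (setIntegral_eq_zero_iff_of_nonneg_ae (Eventually.of_forall fun x => sq_nonneg _)
      (M.integrableOn_cell_of_continuousOn T ((M.continuousOn_v0 v T).pow 2))).1
      (hsum T (Finset.mem_univ T))
    have h2 : pval p =ᵐ[volume.restrict (interior (T : Set (Euc d)))] 0 := by
      filter_upwards [ae_restrict_of_ae_restrict_of_subset interior_subset h1,
        ae_restrict_mem isOpen_interior.measurableSet] with x hx hxT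
      rw [← hpv x (interior_subset hxT)]
      exact pow_eq_zero_iff (two_ne_zero) |>.1 hx
    have h3 := Measure.eqOn_open_of_ae_eq h2 isOpen_interior (continuous_pval p).continuousOn
      continuousOn_const
    have h4 : p = 0 := eq_zero_of_pval_eq_zero isOpen_interior
      (M.isElement' T).interior_nonempty fun x hx => h3 hx
    intro x
    by_cases hx : x ∈ (T : Set (Euc d))
    · rw [hpv x hx, h4, pval_zero]
    · exact M.v0_of_notMem v T hx
  have hE := (Finset.sum_eq_zero_iff_of_nonneg fun T _ =>
    add_nonneg (M.gradSq_nonneg v T) (M.jumpSq_nonneg v T)).1 h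
  have hb : ∀ e : M.faces, M.vb v e = 0 := by
    intro e
    obtain ⟨T, hT, heT⟩ := M.face_of_cell e e.2
    have he : e ∈ M.facesOf ⟨T, hT⟩ := M.mem_facesOf.2 heT
    have h1 : M.jumpSq v ⟨T, hT⟩ = 0 := by
      have := hE ⟨T, hT⟩ (Finset.mem_univ _)
      linarith [M.gradSq_nonneg v ⟨T, hT⟩, M.jumpSq_nonneg v ⟨T, hT⟩]
    have h2 : ∑ e ∈ M.facesOf ⟨T, hT⟩, ∫ x in (e : Set (Euc d)),
        (M.v0 v ⟨T, hT⟩ x - M.vb v e x) ^ 2 ∂(surf d) = 0 :=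
      (mul_eq_zero.1 h1).resolve_left (inv_ne_zero ((M.isElement T hT).diam_pos hd).ne')
    have h3 := (Finset.sum_eq_zero_iff_of_nonneg fun e _ =>
      integral_nonneg fun _ => sq_nonneg _).1 h2 e he
    refine M.eq_zero_of_integral_sq_eq_zero hd e (v.2 e).2 ?_
    rw [← h3]
    refine integral_congr_ae (Eventually.of_forall fun x => ?_)
    simp only [h0, zero_sub, neg_sq]
    exact (sq _).symm
  refine Prod.ext (funext fun T => Subtype.ext (funext (h0 T))) (funext fun e => Subtype.ext (hb e))

/-! ### The load functional -/

/-- The load functional `(f, v₀)`. -/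
noncomputable def load {f : Euc d → ℝ} (hf : IntegrableOn f Ω) (k : ℕ) : M.V k →ₗ[ℝ] ℝ :=
  have hfv : ∀ (v : M.V k) (T : M.cells),
      IntegrableOn (fun x => f x * M.v0 v T x) (T : Set (Euc d)) := fun v T =>
    IntegrableOn.mul_continuousOn (Integrable.mono_measure hf (M.restrict_cell_le T))
      (M.continuousOn_v0 v T) (M.isCompact_cell T)
  { toFun := fun v => ∑ T : M.cells, ∫ x in (T : Set (Euc d)), f x * M.v0 v T x
    map_add' := fun v w => by
      rw [← Finset.sum_add_distrib]
      refine Finset.sum_congr rfl fun T _ => ?_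
      rw [← integral_add (hfv v T) (hfv w T)]
      simp only [v0_add, mul_add]
    map_smul' := fun c v => by
      simp only [v0_smul, mul_left_comm _ c, integral_const_mul, ← Finset.mul_sum,
        RingHom.id_apply, smul_eq_mul] }

theorem load_apply {f : Euc d → ℝ} (hf : IntegrableOn f Ω) (v : M.V k) :
    M.load hf k v = ∑ T : M.cells, ∫ x in (T : Set (Euc d)), f x * M.v0 v T x := rfl

/-! ### Continuity of the form in its nonlinear argument -/

variable {lam Lam : ℝ} {a : Euc d → ℝ → Euc d → Matrix (Fin d) (Fin d) ℝ}

/-- Dominated convergence: the bound on `a` gives a majorant independent of the nonlinear argument,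
and `a` is continuous in (η, p) for each x. -/
theorem continuous_formA (ha : IsCoefficient Ω lam Lam a) {X : Type*} [TopologicalSpace X]
    [FirstCountableTopology X] {φ : X → M.V k} (v w : M.V k)
    (h0 : ∀ T x, Continuous fun c => M.v0 (φ c) T x)
    (h1 : ∀ T x, Continuous fun c => (M.weakGrad (φ c) T).val x) :
    Continuous fun c => M.formA a (φ c) v w := by
  simp only [formA_eq]
  refine continuous_finsetSum _ fun T _ => ?_
  refine continuous_of_dominated
    (bound := fun x => Lam * ‖(M.weakGrad v T).val x‖ * ‖(M.weakGrad w T).val x‖)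
    (fun c => M.aestronglyMeasurable_integrand ha (φ c) v w T)
    (fun c => M.abs_integrand_le ha (φ c) v w T) (M.integrableOn_cell T (by fun_prop)) ?_
  filter_upwards [M.ae_mem_domain T] with x hx
  simp only [integrand, inner_toEuclideanCLM]
  refine continuous_finsetSum _ fun i _ => continuous_finsetSum _ fun j _ => ?_
  have hc := ((ha.continuous x hx).comp ((h0 T x).prodMk (h1 T x))).matrix_elem i j
  exact (hc.mul continuous_const).mul continuous_const

end PolytopalMesh

end Mesh

end WG

namespace WG
open Filter Topology

/-- A finite-dimensional subspace is the injective image of a Euclidean space. -/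
theorem exists_euclidean_parametrization {V : Type*} [AddCommGroup V] [Module ℝ V]
    [FiniteDimensional ℝ V] (W : Submodule ℝ V) :
    ∃ (n : ℕ) (J : Euc n →ₗ[ℝ] V), (∀ c, J c = 0 → c = 0) ∧ ∀ v, v ∈ W ↔ ∃ c, J c = v := by
  let I : Euc (Module.finrank ℝ W) ≃ₗ[ℝ] W :=
    (WithLp.linearEquiv 2 ℝ (Fin _ → ℝ)).trans (Module.finBasis ℝ W).equivFun.symm
  refine ⟨_, W.subtype ∘ₗ I.toLinearMap, fun c hc => I.map_eq_zero_iff.1 (Subtype.ext hc),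
    fun v => ⟨fun hv => ⟨I.symm ⟨v, hv⟩, by simp⟩, ?_⟩⟩
  rintro ⟨c, rfl⟩
  exact (I c).2

section Mesh

variable {d : ℕ} {Ω : Set (Euc d)} (M : PolytopalMesh Ω) {k : ℕ}

namespace PolytopalMesh

variable {lam Lam ρ : ℝ} {a : Euc d → ℝ → Euc d → Matrix (Fin d) (Fin d) ℝ}

/-! ### Existence of solutions -/

theorem formAs_add_left (ha : IsCoefficient Ω lam Lam a) (φ v v' w : M.V k) :
    M.formAs ρ a φ (v + v') w = M.formAs ρ a φ v w + M.formAs ρ a φ v' w := by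
  simp only [← M.formAsL_apply ρ ha, map_add, LinearMap.add_apply]

/-- The cross term between ψ and w is split with Young weight min(λ, ρ)/4, a quarter of the
coercivity constant. The result is uniform in φ, hence usable with φ the unknown itself. -/
theorem coercivity (hlam : 0 < lam) (hρ : 0 < ρ) (ha : IsCoefficient Ω lam Lam a)
    (φ ψ w : M.V k) :
    3 / 4 * min lam ρ * M.energy w - (max |Lam| ρ) ^ 2 / min lam ρ * M.energy ψ ≤
      M.formAs ρ a φ (ψ + w) w := by
  have hm : 0 < min lam ρ := lt_min hlam hρ
  have h1 := M.le_formAs ρ ha φ w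
  have h2 := M.abs_formAs_le hρ.le ha φ ψ w (s := min lam ρ / 4) (by positivity)
  have h3 := neg_abs_le (M.formAs ρ a φ ψ w)
  rw [show 4 * (min lam ρ / 4) = min lam ρ by ring] at h2
  rw [M.formAs_add_left ha]
  linarith

/-- The parameter enters both the coefficient and the linear slot. Expanding the latter in
coordinates leaves forms with fixed linear arguments, where only the continuity of the coefficient
matters. -/
theorem continuous_formAs_add (ha : IsCoefficient Ω lam Lam a) {n : ℕ} (J : Euc n →ₗ[ℝ] M.V k)
    (u w : M.V k) : Continuous fun c => M.formAs ρ a (u + J c) (u + J c) w := by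
  have hlin : ∀ {F : Type} [AddCommGroup F] [Module ℝ F] [TopologicalSpace F]
      [IsTopologicalAddGroup F] [ContinuousSMul ℝ F] (L : M.V k →ₗ[ℝ] F),
      Continuous fun c => L (u + J c) := by
    intro F _ _ _ _ _ L
    simp only [map_add]
    exact continuous_const.add (LinearMap.continuous_of_finiteDimensional (L ∘ₗ J))
  have hφ : ∀ v, Continuous fun c => M.formAs ρ a (u + J c) v w := by
    intro v
    refine (M.continuous_formA ha v w (fun T x => ?_) fun T x => ?_).add continuous_const
    · exact hlin (F := ℝ)
        { toFun := fun v => M.v0 v T x, map_add' := fun _ _ => rfl, map_smul' := fun _ _ => rfl }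
    · exact hlin (F := Euc d)
        { toFun := fun v => (M.weakGrad v T).val x
          map_add' := fun v w => by rw [weakGrad_add, PolyVec.val_add]
          map_smul' := fun c v => by rw [weakGrad_smul, PolyVec.val_smul]; rfl }
  have hexp : ∀ c : Euc n, M.formAs ρ a (u + J c) (u + J c) w = M.formAs ρ a (u + J c) u w +
      ∑ i, c i * M.formAs ρ a (u + J c) (J (EuclideanSpace.single i 1)) w := by
    intro c
    rw [M.formAs_add_left ha]
    congr 1
    have hc : c = ∑ i, c i • EuclideanSpace.single i (1 : ℝ) := by
      have h := (EuclideanSpace.basisFun (Fin n) ℝ).sum_repr c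
      simpa using h.symm
    generalize u + J c = φ
    conv_lhs => rw [hc]
    simp only [← M.formAsL_apply ρ ha, map_sum, map_smul, LinearMap.sum_apply,
      LinearMap.smul_apply, smul_eq_mul]
  simp only [hexp]
  refine (hφ u).add (continuous_finsetSum _ fun i _ => Continuous.mul ?_ (hφ _))
  fun_prop

/-- In coordinates on ψ + V_h⁰ the scheme says that the residual vector field vanishes. The residual
paired with c is at least (m/2)E(Jc) − K, and E(Jc) grows like ‖c‖², so the field points outwards on
a large sphere and has a zero inside. -/
theorem exists_solution (hd : 1 ≤ d) {C : ℝ}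
    (hC : ∀ v ∈ M.V0 k, ∑ T : M.cells, ∫ x in (T : Set (Euc d)), M.v0 v T x ^ 2 ≤ C * M.energy v)
    (hlam : 0 < lam) (hρ : 0 < ρ) (ha : IsCoefficient Ω lam Lam a) {f g : Euc d → ℝ}
    (hf : IntegrableOn f Ω) (hg : MemLp g 2 ((surf d).restrict (frontier Ω))) :
    ∃ u : M.V k, M.IsSolution ρ a f g u := by
  obtain ⟨ψ, hψ⟩ := M.nonempty_B hd k hg
  have hm : 0 < min lam ρ := lt_min hlam hρ
  set m := min lam ρ with hm_def
  obtain ⟨n, J, hJinj, hJrange⟩ := exists_euclidean_parametrization (M.V0sub k)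
  have hJ : ∀ c, J c ∈ M.V0 k := fun c => (hJrange (J c)).2 ⟨c, rfl⟩
  let E : Euc n →ₗ[ℝ] Euc n →ₗ[ℝ] ℝ := (M.energyForm k).compl₁₂ J J
  have hE : ∀ c, E c c = M.energy (J c) := fun c => M.energyForm_self _
  -- By Poincaré the energy is positive definite on V_h⁰, so it dominates the load and every
  -- coordinate. These constants may depend on the mesh and on f, since only existence is at stake;
  -- this is why f ∈ L¹ suffices here.
  have hbound := exists_sq_le_of_posDef E (fun v w => M.energyForm_symm _ _)
    (fun c => by rw [hE]; exact M.energy_nonneg _)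
    (fun c hc => hJinj c (M.eq_zero_of_energy_eq_zero hd (hC _ (hJ c)) (by rw [← hE, hc])))
  obtain ⟨Cl, hCl, hload⟩ := hbound (M.load hf k ∘ₗ J)
  choose D hD hcoord using fun i : Fin n =>
    hbound (EuclideanSpace.proj i : Euc n →L[ℝ] ℝ).toLinearMap
  let L : Euc n → Euc n →ₗ[ℝ] ℝ := fun c =>
    (M.formAsL ρ ha (ψ + J c) (ψ + J c) - M.load hf k) ∘ₗ J
  have hL : ∀ c c', L c c' = M.formAs ρ a (ψ + J c) (ψ + J c) (J c') - M.load hf k (J c') :=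
    fun _ _ => rfl
  let G : Euc n → Euc n := fun c => WithLp.toLp 2 fun i => L c (EuclideanSpace.single i 1)
  have hG : Continuous G := (PiLp.continuous_toLp 2 fun _ : Fin n => ℝ).comp
    (continuous_pi fun i => (M.continuous_formAs_add ha J ψ _).sub continuous_const)
  have hGL : ∀ c c', inner ℝ (G c) c' = L c c' := by
    intro c c'
    have hc : c' = ∑ i, c' i • EuclideanSpace.single i (1 : ℝ) := by
      have h := (EuclideanSpace.basisFun (Fin n) ℝ).sum_repr c'
      simpa using h.symm
    conv_rhs => rw [hc]
    rw [PiLp.inner_apply, map_sum]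
    exact Finset.sum_congr rfl fun i _ => by simp [G]
  have hnorm : ∀ c : Euc n, ‖c‖ ^ 2 ≤ (∑ i, D i + 1) * M.energy (J c) := by
    intro c
    rw [EuclideanSpace.real_norm_sq_eq, add_mul, Finset.sum_mul, ← hE]
    have h1 : ∑ i, c i ^ 2 ≤ ∑ i, D i * E c c := Finset.sum_le_sum fun i _ => hcoord i c
    have h2 : 0 ≤ E c c := by rw [hE]; exact M.energy_nonneg _
    linarith
  have hDpos : 0 < ∑ i, D i + 1 := by
    have := Finset.sum_nonneg fun i (_ : i ∈ Finset.univ) => (hD i).le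
    linarith
  set D' := ∑ i, D i + 1
  set K := (max |Lam| ρ) ^ 2 / m * M.energy ψ + Cl / m with hK
  have hKpos : 0 < K := by
    have := M.energy_nonneg ψ
    positivity
  have hcoer : ∀ c, m / 2 * M.energy (J c) - K ≤ L c c := by
    intro c
    have h1 := M.coercivity hlam hρ ha (ψ + J c) ψ (J c)
    have h2 : M.load hf k (J c) ^ 2 ≤ Cl * M.energy (J c) := by
      rw [← hE]; exact hload c
    have h3 : M.load hf k (J c) ≤ m / (4 * Cl) * M.load hf k (J c) ^ 2 + Cl / m := by
      have h : m / (4 * Cl) * M.load hf k (J c) ^ 2 + Cl / m - M.load hf k (J c) =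
          m / (4 * Cl) * (M.load hf k (J c) - 2 * Cl / m) ^ 2 := by
        field_simp; ring
      have : 0 ≤ m / (4 * Cl) * (M.load hf k (J c) - 2 * Cl / m) ^ 2 := by positivity
      linarith
    have h4 : m / (4 * Cl) * M.load hf k (J c) ^ 2 ≤ m / 4 * M.energy (J c) := by
      refine (mul_le_mul_of_nonneg_left h2 (by positivity)).trans (le_of_eq ?_)
      field_simp
    rw [hL]
    simp only [← hm_def] at h1
    linarith
  -- The squared radius: ‖c‖² ≤ D' E(Jc) then forces (m/2)E(Jc) > K on the sphere.
  have hR0 : 0 < 2 * D' * K / m + 1 := by positivity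
  obtain ⟨c, -, hc⟩ := exists_zero_of_continuous (Real.sqrt_pos.2 hR0) hG fun c hcR => by
    rw [hGL]
    refine lt_of_lt_of_le ?_ (hcoer c)
    have h1 := hnorm c
    rw [hcR, Real.sq_sqrt hR0.le] at h1
    have h2 : 2 * D' * K / m < D' * M.energy (J c) := by linarith
    rw [div_lt_iff₀ hm] at h2
    have h3 : D' * (2 * K) < D' * (m * M.energy (J c)) := by linarith
    have h4 := lt_of_mul_lt_mul_left h3 hDpos.le
    linarith
  refine ⟨ψ + J c, M.add_mem_B hψ (hJ c), fun v hv => ?_⟩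
  obtain ⟨c', rfl⟩ := (hJrange v).1 hv
  have h := hGL c c'
  rw [hc, inner_zero_left, hL, load_apply] at h
  linarith

/-! ### Stability -/

theorem load_le {f : Euc d → ℝ} (hf : IntegrableOn f Ω) (hf2 : MemLp f 2 (volume.restrict Ω))
    (v : M.V k) {s : ℝ} (hs : 0 < s) :
    M.load hf k v ≤ s * (∑ T : M.cells, ∫ x in (T : Set (Euc d)), M.v0 v T x ^ 2) +
      (4 * s)⁻¹ * ∫ x in Ω, f x ^ 2 := by
  have hsq : IntegrableOn (fun x => f x ^ 2) Ω := hf2.integrable_sq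
  rw [load_apply, M.integral_domain hsq, Finset.mul_sum, Finset.mul_sum, ← Finset.sum_add_distrib]
  refine Finset.sum_le_sum fun T _ => ?_
  have h1 : IntegrableOn (fun x => s * M.v0 v T x ^ 2) (T : Set (Euc d)) :=
    M.integrableOn_cell_of_continuousOn T (continuousOn_const.mul ((M.continuousOn_v0 v T).pow 2))
  have h2 : IntegrableOn (fun x => (4 * s)⁻¹ * f x ^ 2) (T : Set (Euc d)) :=
    (Integrable.mono_measure hsq (M.restrict_cell_le T)).const_mul _
  rw [← integral_const_mul, ← integral_const_mul, ← integral_add h1 h2]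
  refine integral_mono (IntegrableOn.mul_continuousOn
    (Integrable.mono_measure hf (M.restrict_cell_le T)) (M.continuousOn_v0 v T)
    (M.isCompact_cell T)) (h1.add h2) fun x => ?_
  have h : s * M.v0 v T x ^ 2 + (4 * s)⁻¹ * f x ^ 2 - f x * M.v0 v T x =
      s * (M.v0 v T x - f x / (2 * s)) ^ 2 := by
    field_simp; ring
  have : 0 ≤ s * (M.v0 v T x - f x / (2 * s)) ^ 2 := by positivity
  change f x * M.v0 v T x ≤ s * M.v0 v T x ^ 2 + (4 * s)⁻¹ * f x ^ 2
  linarith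

/-- Testing with w = u − ψ ∈ V_h⁰ and using coercivity gives (m/2)E(w) ≤ (C/m)‖f‖² + (L²/m)E(ψ),
where m = min(λ, ρ) and L = max(|Λ|, ρ). Then E(u) ≤ 2E(ψ) + 2E(w). -/
theorem energy_le_of_isSolution (hd : 1 ≤ d) {C : ℝ} (hCpos : 0 < C)
    (hC : ∀ v ∈ M.V0 k, ∑ T : M.cells, ∫ x in (T : Set (Euc d)), M.v0 v T x ^ 2 ≤ C * M.energy v)
    (hlam : 0 < lam) (hρ : 0 < ρ) (ha : IsCoefficient Ω lam Lam a) {f g : Euc d → ℝ}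
    (hf : IntegrableOn f Ω) (hf2 : MemLp f 2 (volume.restrict Ω)) {u ψ : M.V k}
    (hu : M.IsSolution ρ a f g u) (hψ : ψ ∈ M.B k g) :
    M.energy u ≤ 4 * C / min lam ρ ^ 2 * (∫ x in Ω, f x ^ 2) +
      (4 * (max |Lam| ρ) ^ 2 / min lam ρ ^ 2 + 2) * M.energy ψ := by
  have hm : 0 < min lam ρ := lt_min hlam hρ
  have hw := M.sub_mem_V0 hd hu.1 hψ
  have hsol := hu.2 _ hw
  have h1 := M.coercivity hlam hρ ha u ψ (u - ψ)
  -- With this weight Poincaré turns the v₀ term into (m/4)E(u − ψ), which the coercivity term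
  -- absorbs.
  have h2 := M.load_le hf hf2 (u - ψ) (s := min lam ρ / (4 * C)) (by positivity)
  have h3 := M.energy_add_le ψ (u - ψ)
  rw [add_sub_cancel] at h1 h3
  rw [hsol, ← M.load_apply hf] at h1
  set m := min lam ρ
  have h4 := mul_le_mul_of_nonneg_left (hC _ hw) (show 0 ≤ m / (4 * C) by positivity)
  have h5 : m / (4 * C) * (C * M.energy (u - ψ)) = m / 4 * M.energy (u - ψ) := by field_simp
  have h6 : (4 * (m / (4 * C)))⁻¹ = C / m := by field_simp
  rw [h6] at h2
  have h7 : m / 2 * M.energy (u - ψ) ≤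
      C / m * (∫ x in Ω, f x ^ 2) + (max |Lam| ρ) ^ 2 / m * M.energy ψ := by linarith
  have h8 := mul_le_mul_of_nonneg_left h7 (show 0 ≤ 4 / m by positivity)
  have h9 : 4 / m * (m / 2 * M.energy (u - ψ)) = 2 * M.energy (u - ψ) := by field_simp; ring
  have h10 : 4 / m * (C / m * (∫ x in Ω, f x ^ 2) + (max |Lam| ρ) ^ 2 / m * M.energy ψ) =
      4 * C / m ^ 2 * (∫ x in Ω, f x ^ 2) + 4 * (max |Lam| ρ) ^ 2 / m ^ 2 * M.energy ψ := by
    field_simp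
  linarith

/-- The energy bound is translated by the equivalence of E with the squared norms: boundedness at
the arbitrary φ on the left, coercivity at φ = 0 on the right. The square root is split by √(x + y)
≤ √x + √y. -/
theorem tripleNorm_le_of_isSolution (hd : 1 ≤ d) {C : ℝ} (hCpos : 0 < C)
    (hC : ∀ v ∈ M.V0 k, ∑ T : M.cells, ∫ x in (T : Set (Euc d)), M.v0 v T x ^ 2 ≤ C * M.energy v)
    (hlam : 0 < lam) (hρ : 0 < ρ) (ha : IsCoefficient Ω lam Lam a) {f g : Euc d → ℝ}
    (hf : IntegrableOn f Ω) (hf2 : MemLp f 2 (volume.restrict Ω)) {u ψ : M.V k}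
    (hu : M.IsSolution ρ a f g u) (hψ : ψ ∈ M.B k g) (φ : M.V k) :
    M.tripleNorm ρ a φ u ≤ √((1 + (max |Lam| ρ) ^ 2 / 4) * (4 * C / min lam ρ ^ 2 +
      (4 * (max |Lam| ρ) ^ 2 / min lam ρ ^ 2 + 2) / min lam ρ)) *
      (√(∫ x in Ω, f x ^ 2) + M.tripleNorm ρ a 0 ψ) := by
  have hm : 0 < min lam ρ := lt_min hlam hρ
  have h1 := M.energy_le_of_isSolution hd hCpos hC hlam hρ ha hf hf2 hu hψ
  have h2 := M.le_formAs ρ ha 0 ψ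
  have h3 := (le_abs_self _).trans (M.abs_formAs_le hρ.le ha φ u u one_pos)
  have hF : 0 ≤ ∫ x in Ω, f x ^ 2 := integral_nonneg fun _ => sq_nonneg _
  have hE := M.energy_nonneg ψ
  set m := min lam ρ
  set L := max |Lam| ρ
  set F := ∫ x in Ω, f x ^ 2
  have hN : 0 ≤ M.formAs ρ a 0 ψ ψ := (mul_nonneg hm.le hE).trans h2
  have h4 : M.energy ψ ≤ M.formAs ρ a 0 ψ ψ / m := by rwa [le_div_iff₀' hm]
  have h5 : M.energy u ≤ (4 * C / m ^ 2 + (4 * L ^ 2 / m ^ 2 + 2) / m) *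
      (F + M.formAs ρ a 0 ψ ψ) := by
    have h6 := mul_le_mul_of_nonneg_left h4 (show 0 ≤ 4 * L ^ 2 / m ^ 2 + 2 by positivity)
    have h7 : 0 ≤ 4 * C / m ^ 2 * M.formAs ρ a 0 ψ ψ := by positivity
    have h8 : 0 ≤ (4 * L ^ 2 / m ^ 2 + 2) / m * F := by positivity
    have h9 : (4 * L ^ 2 / m ^ 2 + 2) * (M.formAs ρ a 0 ψ ψ / m) =
      (4 * L ^ 2 / m ^ 2 + 2) / m * M.formAs ρ a 0 ψ ψ := by ring
    linarith
  have h6 : M.formAs ρ a φ u u ≤ (1 + L ^ 2 / 4) * ((4 * C / m ^ 2 + (4 * L ^ 2 / m ^ 2 + 2) / m) *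
      (F + M.formAs ρ a 0 ψ ψ)) := by
    refine le_trans (le_of_le_of_eq h3 ?_) (mul_le_mul_of_nonneg_left h5 (by positivity))
    ring
  rw [← mul_assoc] at h6
  rw [tripleNorm, tripleNorm]
  refine (Real.sqrt_le_sqrt h6).trans ?_
  rw [Real.sqrt_mul (by positivity)]
  refine mul_le_mul_of_nonneg_left (Real.sqrt_le_iff.2 ⟨by positivity, ?_⟩) (Real.sqrt_nonneg _)
  have hmul : 0 ≤ √F * √(M.formAs ρ a 0 ψ ψ) := by positivity
  rw [add_sq, Real.sq_sqrt hF, Real.sq_sqrt hN]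
  linarith

end PolytopalMesh

end Mesh

end WG

/-! ### The main theorem -/

theorem mainTheorem3 (d : ℕ) (hd : 2 ≤ d) (k : ℕ) (hk : 1 ≤ k)
    (Ω : Set (WG.Euc d)) (hΩ : WG.IsPolytopalDomain Ω)
    (lam Lam ρ : ℝ) (hlam : 0 < lam) (hρ : 0 < ρ) (c : WG.ShapeConstants) :
    ∃ C : ℝ, 0 < C ∧
      ∀ (M : WG.PolytopalMesh Ω) (_ : M.ShapeRegular c)
        (a : WG.Euc d → ℝ → WG.Euc d → Matrix (Fin d) (Fin d) ℝ)
        (_ : WG.IsCoefficient Ω lam Lam a)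
        (f : WG.Euc d → ℝ) (_ : IntegrableOn f Ω)
        (g : WG.Euc d → ℝ) (_ : MemLp g 2 ((WG.surf d).restrict (frontier Ω))),
        (∃ u : M.V k, M.IsSolution ρ a f g u) ∧
        (MemLp f 2 (volume.restrict Ω) →
          ∀ u : M.V k, M.IsSolution ρ a f g u → ∀ φ : M.V k,
            M.tripleNorm ρ a φ u ≤
              C * (√(∫ x in Ω, f x ^ 2) + ⨅ ψ : M.B k g, M.tripleNorm ρ a 0 (ψ : M.V k))) := by
  have hd1 : 1 ≤ d := by omega
  obtain ⟨C, hC, hP⟩ := WG.PolytopalMesh.exists_poincare hd1 k Ω hΩ c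
  have hm : 0 < min lam ρ := lt_min hlam hρ
  have hA : 0 < √((1 + (max |Lam| ρ) ^ 2 / 4) * (4 * C / min lam ρ ^ 2 +
      (4 * (max |Lam| ρ) ^ 2 / min lam ρ ^ 2 + 2) / min lam ρ)) :=
    Real.sqrt_pos.2 (by positivity)
  refine ⟨_, hA, fun M hM a ha f hf g hg =>
    ⟨M.exists_solution hd1 (hP M hM) hlam hρ ha hf hg, fun hf2 u hu φ => ?_⟩⟩
  have : Nonempty (M.B k g) := ⟨⟨u, hu.1⟩⟩
  -- The bound holds for each ψ with one constant; isolating the infimum makes it a lower bound over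
  -- a family that is nonempty because it contains u itself.
  rw [mul_comm, ← div_le_iff₀ hA, ← sub_le_iff_le_add']
  refine le_ciInf fun ψ => ?_
  rw [sub_le_iff_le_add', div_le_iff₀ hA, mul_comm]
  exact M.tripleNorm_le_of_isSolution hd1 hC (hP M hM) hlam hρ ha hf hf2 hu ψ.2 φ
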